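/- **Setting.** Let $d\in\mathbb N$, $\mathbb T^d=\mathbb R^d/\mathbb Z^d$, $T>0$, $Q_T=\mathbb T^d\times(0,T)$. Consider the mean field games system $$-u_t+H(x,D_xu)=f(x,m),\quad m_t-\mathrm{div}(mD_pH(x,D_xu))=0\ \text{ in }Q_T,\qquad m(\cdot,0)=m_0,\quad u(\cdot,T)=g(\cdot,m(\cdot,T))\ \text{ on }\mathbb T^d .\tag{MFG}$$ Let $C_0>0$ and $0\le\tau<1$ be constants, and assume: * $m_0\in C^4(\mathbb T^d)$, $m_0>0$, $\int_{\mathbb T^d}m_0=1$. * $H:\mathbb T^d\times\mathbb R^d\to\mathbb R$; $H,D_pH,D^2_{pp}H$ are of class $C^4$, and for all $(x,p)$: $\frac1{C_0}I\le D^2_{pp}H\le C_0I$, $\;D_pH\cdot p\ge 2H-C_0$, $\;|D^3_{ppp}H|\le C_0(1+|p|)^{-1}$, $\;|D^3_{xxp}H|\le C_0(1+|p|)^{\tau}$, $\;|D^3_{xpp}H|\le C_0(1+|p|)^{\tau-1}$. * $f,g:\mathbb T^d\times[0,\infty)\to[-\infty,\infty)$ are continuous, strictly increasing in the second variable $m$,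 $C^4$ on $\mathbb T^d\times(0,\infty)$, with $f_m,g_m>0$ there. * (SE) $f(\cdot,0)\equiv-\infty$. * $\liminf_{m\to\infty}\min_{x}mf_m(x,m)>0$; with $\chi(x,w):=mf_m(x,m)|_{m=f^{-1}(x,w)}$, where $f^{-1}(x,\cdot):\mathbb R\to(0,\infty)$ is the inverse of $f(x,\cdot)$, one has $|\chi_w|\le C_0$; and on $\mathbb T^d\times(0,\infty)$, $|m(D_xf)_m|\le C_0|D_xf|$ and $|D_xf|,|D^2_{xx}f|\le C_0\big(1+|f|^{\tau/2}+|mf_m|^{(1+\tau)/2}\big)$. * For each $x$, $\lim_{m\to\infty}g(x,m)=\sup_{\mathbb T^d\times[0,\infty)}g$ and $g(x,0)=\inf_{\mathbb T^d\times[0,\infty)}g$. * $C_0$ is chosen so large (which is always possible under the above assumptions) that moreover $\frac1{C_0}|p|^2-C_0\le H\le C_0|p|^2+C_0$, $|D_pH|\le C_0(1+|p|)$, $|D_xH|,|D^2_{xx}H|\le C_0(1+|p|^{1+\tau})$, $|D^2_{xp}H|\le C_0(1+|p|)^\tau$, and $\|\chi(\cdot,0)\|_{C^0(\mathbb T^d)}+\|m_0\|_{C^1(\mathbb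 T^d)}+\|f\|_{C^2(\mathbb T^d\times[\min m_0,\max m_0])}\le C_0$. **Notation.** For $m>0$ put $f_0(m)=\min_xf(x,m)$, $f_1(m)=\max_xf(x,m)$, $g_0(m)=\min_xg(x,m)$, $g_1(m)=\max_xg(x,m)$ (strictly increasing functions on $(0,\infty)$; juxtaposition denotes composition), $s^-=\max(-s,0)$, $h=\sqrt\chi$, and for $K>0$ $$\beta_K=\|f\|_{C^1(\mathbb T^d\times[\frac1K,K])}+\|D_xg\|_{C^1(\mathbb T^d\times[\frac1K,K])}+\Big\|\frac1\chi\Big\|_{C^0(\mathbb T^d\times[-K,\infty))}+\|h_w\|_{C^0(\mathbb T^d\times[-K,\infty))}.$$ We write $C=C(a_1,\dots,a_k)$ for a positive constant that is a nondecreasing function of each of $a_1,\dots,a_k$ and, apart from the dimension $d$, depends on nothing else. **Theorem.** There exist constants $$L_1=L_1(C_0,\tau,T),\qquad L=L\Big(L_1,\ |g_1f_0^{-1}(L_1)|,\ |g_0f_1^{-1}(-L_1)|,\ g_0^{-1}g_1f_0^{-1}(L_1),\ \frac1{g_1^{-1}g_0f_1^{-1}(-L_1)}\Big),$$ $$K_1=K_1\Big(L,\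 f_0\big(\tfrac1L\big)^-,\ \tfrac1T\Big),\qquad K=K(K_1,\beta_{K_1})$$ (nondecreasing functions of the indicated quantities, the same for all data and all solutions; here $C_0>0$, $0\le\tau<1$, $T>0$) such that, under the above assumptions, every solution $(u,m)\in C^3(\overline{Q_T})\times C^2(\overline{Q_T})$ of (MFG) with $m\ge0$ satisfies $m(\cdot,T)>0$, $$\|u\|_{C^0(\overline{Q_T})}+\|m(\cdot,T)\|_{C^0(\mathbb T^d)}+\Big\|\frac1{m(\cdot,T)}\Big\|_{C^0(\mathbb T^d)}\le L ,$$ and, with $\beta_{K_1}<\infty$ and $Du=(D_xu,u_t)$, $$\|Du\|_{C^0(\overline{Q_T})}\le K .$$ -/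

import Mathlib

noncomputable section

namespace MFG

open Set Filter Topology MeasureTheory
open scoped ENNReal

/-- The Euclidean space `ℝ^d`. Functions on the flat torus `𝕋^d = ℝ^d/ℤ^d` are represented by
`ℤ^d`-periodic functions on it. -/
abbrev Sp (d : ℕ) : Type := EuclideanSpace ℝ (Fin d)

/-- `ℤ^d`-periodicity. -/
def Periodic {d : ℕ} {Y : Type} (φ : Sp d → Y) : Prop :=
  ∀ (x : Sp d) (i : Fin d), φ (x + EuclideanSpace.single i 1) = φ x

/-- A fundamental domain of the torus. -/
def unitCube (d : ℕ) : Set (Sp d) := {x | ∀ i, x i ∈ Ico (0 : ℝ) 1}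

/-- The divergence of a vector field. -/
def divergence {d : ℕ} (V : Sp d → Sp d) (x : Sp d) : ℝ :=
  ∑ i, (fderiv ℝ V x (EuclideanSpace.single i 1)) i

/-! ### Norms -/

/-- The `C^0` norm over `S`, as an extended nonnegative real (so that it is never a junk value). -/
def c0Norm {X Y : Type} [NormedAddCommGroup Y] (S : Set X) (φ : X → Y) : ℝ≥0∞ :=
  ⨆ z ∈ S, ‖φ z‖ₑ

/-- The `C^k` norm over `S` of a function that is `C^k` in a neighbourhood of `S`. -/
def ckNorm {X Y : Type} [NormedAddCommGroup X] [NormedSpace ℝ X] [NormedAddCommGroup Y]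
    [NormedSpace ℝ Y] (k : ℕ) (S : Set X) (φ : X → Y) : ℝ≥0∞ :=
  ∑ j ∈ Finset.range (k + 1), c0Norm S (iteratedFDeriv ℝ j φ)

/-! ### Derivatives of the Hamiltonian `H(x,p)` -/

section Hamiltonian

variable {d : ℕ} (H : Sp d → Sp d → ℝ) (x p : Sp d)

def Hx : Sp d := gradient (fun y => H y p) x
def Hp : Sp d := gradient (H x) p
def Hxx : Sp d →L[ℝ] Sp d := fderiv ℝ (fun y => Hx H y p) x
def Hxp : Sp d →L[ℝ] Sp d := fderiv ℝ (fun y => Hp H y p) x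
def Hpp : Sp d →L[ℝ] Sp d := fderiv ℝ (fun q => Hp H x q) p
def Hppp : Sp d →L[ℝ] Sp d →L[ℝ] Sp d := fderiv ℝ (fun q => Hpp H x q) p
def Hxpp : Sp d →L[ℝ] Sp d →L[ℝ] Sp d := fderiv ℝ (fun y => Hpp H y p) x
def Hxxp : Sp d →L[ℝ] Sp d →L[ℝ] Sp d := fderiv ℝ (fun y => Hxp H y p) x

end Hamiltonian

/-! ### Derivatives and inverses of the couplings

A coupling is a map `F : 𝕋^d × [0,∞) → [-∞,∞)`; values at `m < 0` are irrelevant. For `m > 0` it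
is real valued. -/

section Coupling

variable {d : ℕ} (F : Sp d → ℝ → EReal)

/-- The real number `F(x,m)`, where it is finite. -/
def val (x : Sp d) (m : ℝ) : ℝ := (F x m).toReal

/-- `F_m`. -/
def Dm (x : Sp d) (m : ℝ) : ℝ := deriv (fun r => val F x r) m

/-- `D_x F`. -/
def Dx (x : Sp d) (m : ℝ) : Sp d := gradient (fun y => val F y m) x

/-- `D_xx F`. -/
def Dxx (x : Sp d) (m : ℝ) : Sp d →L[ℝ] Sp d := fderiv ℝ (fun y => Dx F y m) x

/-- `(D_x F)_m`. -/
def Dxm (x : Sp d) (m : ℝ) : Sp d := deriv (fun r => Dx F x r) m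

/-- `F_0(m) = min_x F(x,m)`. -/
def lowerEnv (m : ℝ) : ℝ := ⨅ x, val F x m

/-- `F_1(m) = max_x F(x,m)`. -/
def upperEnv (m : ℝ) : ℝ := ⨆ x, val F x m

/-- The inverse of a strictly increasing function defined on `(0,∞)`. -/
def inv (φ : ℝ → ℝ) (w : ℝ) : ℝ := Function.invFunOn φ (Ioi 0) w

/-- `χ(x,w) = m F_m(x,m)` at `m = F⁻¹(x,w)`. -/
def chi (x : Sp d) (w : ℝ) : ℝ := inv (val F x) w * Dm F x (inv (val F x) w)

/-- `h = √χ`. -/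
def hfun (x : Sp d) (w : ℝ) : ℝ := Real.sqrt (chi F x w)

/-- What is required of both `f` and `g`: continuity on `𝕋^d × [0,∞)` with values in `[-∞,∞)`,
`C^4` regularity for `m > 0`, strict monotonicity in `m`, positive `m`-derivative. -/
structure IsCoupling : Prop where
  periodic : ∀ m, 0 ≤ m → Periodic (fun x => F x m)
  ne_top : ∀ x m, 0 ≤ m → F x m ≠ ⊤
  continuousOn : ContinuousOn (fun z : Sp d × ℝ => F z.1 z.2) (univ ×ˢ Ici 0)
  contDiffOn : ContDiffOn ℝ 4 (fun z : Sp d × ℝ => val F z.1 z.2) (univ ×ˢ Ioi 0)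
  strictMonoOn : ∀ x, StrictMonoOn (F x) (Ici 0)
  Dm_pos : ∀ x m, 0 < m → 0 < Dm F x m

end Coupling

/-! ### The standing assumptions -/

/-- The initial density. -/
structure InitialDensity {d : ℕ} (m₀ : Sp d → ℝ) : Prop where
  periodic : Periodic m₀
  contDiff : ContDiff ℝ 4 m₀
  pos : ∀ x, 0 < m₀ x
  mass : ∫ x in unitCube d, m₀ x = 1

/-- The Hamiltonian: regularity, uniform convexity, quadratic growth, and subquadratic
oscillation in space. -/
structure HamiltonianAssumptions {d : ℕ} (C₀ τ : ℝ) (H : Sp d → Sp d → ℝ) : Prop where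
  periodic : ∀ p, Periodic (fun x => H x p)
  contDiff : ContDiff ℝ 4 (fun z : Sp d × Sp d => H z.1 z.2)
  contDiff_Hp : ContDiff ℝ 4 (fun z : Sp d × Sp d => Hp H z.1 z.2)
  contDiff_Hpp : ContDiff ℝ 4 (fun z : Sp d × Sp d => Hpp H z.1 z.2)
  convex : ∀ x p ξ, 1 / C₀ * ‖ξ‖ ^ 2 ≤ inner ℝ (Hpp H x p ξ) ξ ∧
    inner ℝ (Hpp H x p ξ) ξ ≤ C₀ * ‖ξ‖ ^ 2
  growth : ∀ x p, 2 * H x p - C₀ ≤ inner ℝ (Hp H x p) p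
  Hppp_le : ∀ x p, ‖Hppp H x p‖ ≤ C₀ * (1 + ‖p‖)⁻¹
  Hxxp_le : ∀ x p, ‖Hxxp H x p‖ ≤ C₀ * (1 + ‖p‖) ^ τ
  Hxpp_le : ∀ x p, ‖Hxpp H x p‖ ≤ C₀ * (1 + ‖p‖) ^ (τ - 1)

/-- The coupling `f`, in the strictly elliptic case `f(·,0) ≡ -∞`. -/
structure RunningCostAssumptions {d : ℕ} (C₀ τ : ℝ) (f : Sp d → ℝ → EReal) : Prop where
  isCoupling : IsCoupling f
  strictlyElliptic : ∀ x, f x 0 = ⊥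
  /-- `liminf m f_m > 0` as `m → ∞`, uniformly in `x`. -/
  growth : ∃ c : ℝ, 0 < c ∧ ∀ᶠ m : ℝ in atTop, ∀ x, c ≤ m * Dm f x m
  chi_w_le : ∀ x w, |deriv (fun r => chi f x r) w| ≤ C₀
  Dxm_le : ∀ x m, 0 < m → ‖m • Dxm f x m‖ ≤ C₀ * ‖Dx f x m‖
  Dx_le : ∀ x m, 0 < m →
    ‖Dx f x m‖ ≤ C₀ * (1 + |val f x m| ^ (τ / 2) + |m * Dm f x m| ^ ((1 + τ) / 2))
  Dxx_le : ∀ x m, 0 < m →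
    ‖Dxx f x m‖ ≤ C₀ * (1 + |val f x m| ^ (τ / 2) + |m * Dm f x m| ^ ((1 + τ) / 2))

/-- The terminal cost `g`; suprema and infima are taken in `[-∞,∞]`. -/
structure TerminalCostAssumptions {d : ℕ} (g : Sp d → ℝ → EReal) : Prop where
  isCoupling : IsCoupling g
  tendsto_sup : ∀ x, Tendsto (g x) atTop (𝓝 (⨆ (y : Sp d) (m : ℝ) (_ : 0 ≤ m), g y m))
  zero_eq_inf : ∀ x, g x 0 = ⨅ (y : Sp d) (m : ℝ) (_ : 0 ≤ m), g y m

/-- The convention on the size of `C₀`. Given the other assumptions, all these inequalities hold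
once `C₀` is taken large enough (and enlarging `C₀` preserves all the assumptions). -/
structure LargeConstant {d : ℕ} (C₀ τ : ℝ) (H : Sp d → Sp d → ℝ) (f : Sp d → ℝ → EReal)
    (m₀ : Sp d → ℝ) : Prop where
  H_ge : ∀ x p, 1 / C₀ * ‖p‖ ^ 2 - C₀ ≤ H x p
  H_le : ∀ x p, H x p ≤ C₀ * ‖p‖ ^ 2 + C₀
  Hp_le : ∀ x p, ‖Hp H x p‖ ≤ C₀ * (1 + ‖p‖)
  Hx_le : ∀ x p, ‖Hx H x p‖ ≤ C₀ * (1 + ‖p‖ ^ (1 + τ))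
  Hxx_le : ∀ x p, ‖Hxx H x p‖ ≤ C₀ * (1 + ‖p‖ ^ (1 + τ))
  Hxp_le : ∀ x p, ‖Hxp H x p‖ ≤ C₀ * (1 + ‖p‖) ^ τ
  data_le : c0Norm univ (fun x => chi f x 0) + ckNorm 1 univ m₀ +
    ckNorm 2 (univ ×ˢ Icc (⨅ x, m₀ x) (⨆ x, m₀ x)) (fun z : Sp d × ℝ => val f z.1 z.2)
      ≤ ENNReal.ofReal C₀

/-! ### Classical solutions of the mean field games system -/

/-- `D_x u(x,t)`. -/
def spaceGrad {d : ℕ} (u : Sp d → ℝ → ℝ) (x : Sp d) (t : ℝ) : Sp d :=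
  gradient (fun y => u y t) x

/-- `Du = (D_x u, u_t)` on `𝕋^d × [0,T]`, with the Euclidean norm on `ℝ^d × ℝ`; at `t = 0` and
`t = T` the time derivative is one-sided. -/
def fullGrad {d : ℕ} (T : ℝ) (u : Sp d → ℝ → ℝ) (z : Sp d × ℝ) : WithLp 2 (Sp d × ℝ) :=
  WithLp.toLp 2 (spaceGrad u z.1 z.2, derivWithin (u z.1) (Icc 0 T) z.2)

/-- `(u,m) ∈ C^3 × C^2` on the closed cylinder `𝕋^d × [0,T]` solves the system
`-u_t + H(x,D_x u) = f(x,m)`, `m_t - div(m D_p H(x,D_x u)) = 0` in `𝕋^d × (0,T)`,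
`m(·,0) = m₀`, `u(·,T) = g(·,m(·,T))`. -/
structure IsClassicalSolution {d : ℕ} (T : ℝ) (H : Sp d → Sp d → ℝ) (f g : Sp d → ℝ → EReal)
    (m₀ : Sp d → ℝ) (u m : Sp d → ℝ → ℝ) : Prop where
  u_periodic : ∀ t ∈ Icc 0 T, Periodic (fun x => u x t)
  m_periodic : ∀ t ∈ Icc 0 T, Periodic (fun x => m x t)
  u_contDiffOn : ContDiffOn ℝ 3 (fun z : Sp d × ℝ => u z.1 z.2) (univ ×ˢ Icc 0 T)
  m_contDiffOn : ContDiffOn ℝ 2 (fun z : Sp d × ℝ => m z.1 z.2) (univ ×ˢ Icc 0 T)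
  m_nonneg : ∀ x, ∀ t ∈ Icc 0 T, 0 ≤ m x t
  hamiltonJacobi : ∀ x, ∀ t ∈ Ioo 0 T,
    ((-deriv (u x) t + H x (spaceGrad u x t) : ℝ) : EReal) = f x (m x t)
  continuity : ∀ x, ∀ t ∈ Ioo 0 T,
    deriv (m x) t - divergence (fun y => m y t • Hp H y (spaceGrad u y t)) x = 0
  initial : ∀ x, m x 0 = m₀ x
  terminal : ∀ x, (u x T : EReal) = g x (m x T)

/-! ### Constants -/

/-- A positive constant depending monotonically on `n` real parameters ranging over `S`. -/
structure IsMonotoneConstant {n : ℕ} (S : Set (Fin n → ℝ)) (C : (Fin n → ℝ) → ℝ) : Prop where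
  pos : ∀ v ∈ S, 0 < C v
  mono : MonotoneOn C S

/-- The range of the parameters `(C₀, τ, T)`. -/
def baseParams : Set (Fin 3 → ℝ) := {v | 0 < v 0 ∧ 0 ≤ v 1 ∧ v 1 < 1 ∧ 0 < v 2}

/-- `β_K = ‖f‖_{C^1(𝕋^d×[1/K,K])} + ‖D_x g‖_{C^1(𝕋^d×[1/K,K])} + ‖1/χ‖_{C^0(𝕋^d×[-K,∞))}
+ ‖h_w‖_{C^0(𝕋^d×[-K,∞))}`. -/
def beta {d : ℕ} (f g : Sp d → ℝ → EReal) (K : ℝ) : ℝ≥0∞ :=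
  ckNorm 1 (univ ×ˢ Icc (1 / K) K) (fun z : Sp d × ℝ => val f z.1 z.2) +
  ckNorm 1 (univ ×ˢ Icc (1 / K) K) (fun z : Sp d × ℝ => Dx g z.1 z.2) +
  c0Norm (univ ×ˢ Ici (-K)) (fun z : Sp d × ℝ => 1 / chi f z.1 z.2) +
  c0Norm (univ ×ˢ Ici (-K)) (fun z : Sp d × ℝ => deriv (fun w => hfun f z.1 w) z.2)

/-- The five quantities on which `L` depends:
`L₁`, `|g₁ f₀⁻¹(L₁)|`, `|g₀ f₁⁻¹(-L₁)|`, `g₀⁻¹ g₁ f₀⁻¹(L₁)`, `1 / (g₁⁻¹ g₀ f₁⁻¹(-L₁))`. -/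
def boundParams {d : ℕ} (f g : Sp d → ℝ → EReal) (L₁ : ℝ) : Fin 5 → ℝ :=
  let a := upperEnv g (inv (lowerEnv f) L₁)
  let b := lowerEnv g (inv (upperEnv f) (-L₁))
  ![L₁, |a|, |b|, inv (lowerEnv g) a, 1 / inv (upperEnv g) b]

end MFG

end

noncomputable section

namespace MFG

open Set Filter Topology MeasureTheory
open scoped ENNReal

/-! ### Calculus -/

section Calculus

variable {E E₁ E₂ Y : Type} [NormedAddCommGroup E] [NormedSpace ℝ E]
  [NormedAddCommGroup E₁] [NormedSpace ℝ E₁] [NormedAddCommGroup E₂] [NormedSpace ℝ E₂]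
  [NormedAddCommGroup Y] [NormedSpace ℝ Y]

/-! Since `f(·,0) = -∞` while `-u_t + H(x,D_xu)` is finite up to the boundary, the density is
positive on the closed cylinder (`cost_eq_of_mem`). Along the direction `(b,-1)`, `b =
D_pH(x,D_xu)`, the continuity equation becomes a second-order elliptic equation for `u` alone in its
second-order part: `D²u((b,-1),(b,-1)) + χ tr(D²_pp H D²_xx u)` equals lower-order terms
(`elliptic_eq`). The estimates are maximum principles for this equation.

Values: at an interior critical point in `x`, the lower-order terms are at most linear in `u_t`, so
a spatially constant exponential barrier forces the maximum of `±u + k(t)` to the boundary; the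
known initial density excludes `t = 0`. At `t = T` the one-sided derivative condition bounds
`±f(x,m)` by `L₁` at that point. This bounds `m` there, hence `u = g(x,m)` there, hence `u`
everywhere, and finally `m(·,T)` through `g` (`exists_terminal_max`, `value_bounds`).

Time derivative: differentiating the equation in `t` gives a linear equation for `u_t` without
zero-order term, so `±u_t` is maximal at `t = 0` or `t = T` (`tder_le_of_boundary`). There `u_t = H
- f` with `f` controlled. Hence `u_t ≤ max H + C`, so `f = -u_t + H` is bounded below wherever
`H(x,D_xu)` is nearly maximal; this is the region in which `β` controls `1/χ` and `h_w`.

Space gradient, by Bernstein's method: maximise `H(x,D_xu) + κ ũ²/2`, where `ũ = u + c t + c'` is at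
most `-1` at `t = 0` and at least `1` at `t = T`. The derivative `η` of `ũ` along `(b,-1)` grows
like `P²`, `P = 1 + |D_xu|`. On the boundary the first-order condition compares `κ η` with
quantities linear in `P`, except in one terminal case, settled by the growth of `D_xu · D_pH`. In
the interior the second-order conditions in the directions `(b,-1)` and `(e_i,0)`, with `e_i` an
eigenbasis of `D²_pp H`, are added so that all third derivatives cancel (`bernstein_inequality`).
The result is `κ η² ≤ C P^(3+τ) + C κ² P⁴` (`bernstein_estimate`); a small `κ` and `τ < 1` then
bound `P` (`le_of_absorption`). Since `κ ũ²/2 ≤ 1`, the bound at the maximum point bounds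
`H(x,D_xu)`, and therefore `Du`, everywhere (`gradient_bound`). -/

theorem fderiv_fderiv_nonpos_of_isLocalMax {φ : E → ℝ} {z : E} (h : IsLocalMax φ z)
    (hφ : ContDiffAt ℝ 2 φ z) (v : E) : fderiv ℝ (fderiv ℝ φ) z v v ≤ 0 := by
  by_contra! hpos
  have hline : ∀ s : ℝ, HasDerivAt (fun s : ℝ => z + s • v) v s := fun s => by
    simpa using ((hasDerivAt_id s).smul_const v).const_add z
  have hcont : ContinuousAt (fun s : ℝ => z + s • v) 0 := (hline 0).continuousAt
  have h0 : z + (0 : ℝ) • v = z := by simp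
  have hev : ∀ᶠ y in 𝓝 z, DifferentiableAt ℝ φ y := by
    filter_upwards [hφ.eventually (by simp)] with y hy
    exact hy.differentiableAt (by simp)
  have hev' : ∀ᶠ s : ℝ in 𝓝 0,
      deriv (fun s : ℝ => φ (z + s • v)) s = fderiv ℝ φ (z + s • v) v := by
    have : Tendsto (fun s : ℝ => z + s • v) (𝓝 0) (𝓝 z) := by
      simpa [ContinuousAt, h0] using hcont
    filter_upwards [this.eventually hev] with s hs
    exact (hs.hasFDerivAt.comp_hasDerivAt s (hline s)).deriv
  have hd2 : deriv (deriv fun s : ℝ => φ (z + s • v)) 0 = fderiv ℝ (fderiv ℝ φ) z v v := by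
    rw [EventuallyEq.deriv_eq hev']
    have h1 : DifferentiableAt ℝ (fderiv ℝ φ) z :=
      (hφ.fderiv_right (m := 1) (by norm_num)).differentiableAt (by simp)
    have h2 : HasFDerivAt (fderiv ℝ φ) (fderiv ℝ (fderiv ℝ φ) z) (z + (0 : ℝ) • v) := by
      rw [h0]; exact h1.hasFDerivAt
    have h3 := h2.comp_hasDerivAt (0 : ℝ) (hline 0)
    exact (h3.clm_apply (hasDerivAt_const (0 : ℝ) v)).deriv.trans (by simp)
  have hmax : IsLocalMax (fun s : ℝ => φ (z + s • v)) 0 := by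
    have : IsLocalMax φ (z + (0 : ℝ) • v) := by rwa [h0]
    exact this.comp_continuous (g := fun s : ℝ => z + s • v) hcont
  -- With a positive second derivative the maximum on the line would also be a minimum, so `φ` would
  -- be constant there near `z`, and the second derivative would vanish.
  have hmin := isLocalMin_of_deriv_deriv_pos (by rw [hd2]; exact hpos) hmax.deriv_eq_zero
    (by
      have : ContinuousAt φ (z + (0 : ℝ) • v) := by rw [h0]; exact hφ.continuousAt
      exact ContinuousAt.comp (f := fun s : ℝ => z + s • v) this hcont)
  have hconst : (fun s : ℝ => φ (z + s • v)) =ᶠ[𝓝 0] fun _ => φ (z + (0 : ℝ) • v) := by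
    filter_upwards [hmax, hmin] with s h1 h2
    exact le_antisymm h1 h2
  have : deriv (deriv fun s : ℝ => φ (z + s • v)) 0 = 0 := by
    rw [hconst.deriv.deriv_eq]
    simp
  linarith

theorem hasFDerivAt_of_partial {G : E₁ → E₂ → Y} {a : E₁} {b : E₂}
    (h : DifferentiableAt ℝ (fun z : E₁ × E₂ => G z.1 z.2) (a, b)) :
    HasFDerivAt (fun z : E₁ × E₂ => G z.1 z.2)
      ((fderiv ℝ (fun y => G y b) a).coprod (fderiv ℝ (G a) b)) (a, b) := by
  have h1 : HasFDerivAt (fun y => G y b) _ a :=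
    HasFDerivAt.comp (g := fun z : E₁ × E₂ => G z.1 z.2) (f := fun y => (y, b)) a h.hasFDerivAt
      (hasFDerivAt_prodMk_left a b)
  have h2 : HasFDerivAt (fun y => G a y) _ b :=
    HasFDerivAt.comp (g := fun z : E₁ × E₂ => G z.1 z.2) (f := fun y => (a, y)) b h.hasFDerivAt
      (hasFDerivAt_prodMk_right a b)
  convert h.hasFDerivAt using 1
  rw [h1.fderiv, h2.fderiv]
  ext v <;> simp

theorem HasFDerivWithinAt.comp_partial {G : E₁ → E₂ → Y} {α : E → E₁} {γ : E → E₂}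
    {α' : E →L[ℝ] E₁} {γ' : E →L[ℝ] E₂} {s : Set E} {z : E}
    (h : DifferentiableAt ℝ (fun z : E₁ × E₂ => G z.1 z.2) (α z, γ z))
    (hα : HasFDerivWithinAt α α' s z) (hγ : HasFDerivWithinAt γ γ' s z) :
    HasFDerivWithinAt (fun z => G (α z) (γ z))
      ((fderiv ℝ (fun y => G y (γ z)) (α z)).comp α' + (fderiv ℝ (G (α z)) (γ z)).comp γ') s z := by
  have := (hasFDerivAt_of_partial h).comp_hasFDerivWithinAt z (hα.prodMk hγ)
  refine this.congr_fderiv ?_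
  ext v; simp

/-- Both sides are the full second derivative of `G` at `(v,0)` and `(0,y)`, which is symmetric for
a `C²` map. -/
theorem fderiv_fderiv_partial_comm {G : E₁ → E₂ → Y} {a : E₁} {b : E₂}
    (h : ContDiffAt ℝ 2 (fun z : E₁ × E₂ => G z.1 z.2) (a, b)) (v : E₁) (y : E₂) :
    fderiv ℝ (fun q => fderiv ℝ (fun x => G x q) a) b y v =
      fderiv ℝ (fun x => fderiv ℝ (G x) b) a v y := by
  set Γ := fun z : E₁ × E₂ => G z.1 z.2
  have hev : ∀ᶠ z in 𝓝 (a, b), DifferentiableAt ℝ Γ z := by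
    filter_upwards [h.eventually (by simp)] with y hy
    exact hy.differentiableAt (by simp)
  have h2 : HasFDerivAt (fderiv ℝ Γ) (fderiv ℝ (fderiv ℝ Γ) (a, b)) (a, b) :=
    ((h.fderiv_right (m := 1) (by norm_num)).differentiableAt (by simp)).hasFDerivAt
  have hsymm : IsSymmSndFDerivAt ℝ Γ (a, b) := h.isSymmSndFDerivAt (by simp)
  have e1 : (fun q => fderiv ℝ (fun x => G x q) a) =ᶠ[𝓝 b]
      fun q => (fderiv ℝ Γ (a, q)).comp (ContinuousLinearMap.inl ℝ E₁ E₂) := by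
    have : Tendsto (fun q => (a, q)) (𝓝 b) (𝓝 (a, b)) := by
      exact (Continuous.prodMk_right a).tendsto b
    filter_upwards [this.eventually hev] with q hq
    exact (HasFDerivAt.comp (g := Γ) (f := fun y => (y, q)) a hq.hasFDerivAt
      (hasFDerivAt_prodMk_left a q)).fderiv
  have e2 : (fun x => fderiv ℝ (G x) b) =ᶠ[𝓝 a]
      fun x => (fderiv ℝ Γ (x, b)).comp (ContinuousLinearMap.inr ℝ E₁ E₂) := by
    have : Tendsto (fun x => (x, b)) (𝓝 a) (𝓝 (a, b)) := by
      exact (Continuous.prodMk_left b).tendsto a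
    filter_upwards [this.eventually hev] with q hq
    exact (HasFDerivAt.comp (g := Γ) (f := fun y => (q, y)) b hq.hasFDerivAt
      (hasFDerivAt_prodMk_right q b)).fderiv
  rw [e1.fderiv_eq, e2.fderiv_eq]
  have d1 := (HasFDerivAt.comp (f := fun y => (a, y)) b h2 (hasFDerivAt_prodMk_right a b)).clm_comp
    (hasFDerivAt_const (ContinuousLinearMap.inl ℝ E₁ E₂) b)
  have d2 := (HasFDerivAt.comp (f := fun y => (y, b)) a h2 (hasFDerivAt_prodMk_left a b)).clm_comp
    (hasFDerivAt_const (ContinuousLinearMap.inr ℝ E₁ E₂) a)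
  erw [d1.fderiv, d2.fderiv]
  simpa using hsymm (0, y) (v, 0)

/-- First-order conditions at a maximum over a closed cylinder. -/
theorem first_order_of_isMaxOn {T : ℝ} {Φ : E × ℝ → ℝ} {L : E × ℝ →L[ℝ] ℝ} {z : E × ℝ}
    (hz : z ∈ univ ×ˢ Icc 0 T) (hmax : IsMaxOn Φ (univ ×ˢ Icc 0 T) z)
    (hL : HasFDerivWithinAt Φ L (univ ×ˢ Icc 0 T) z) :
    (∀ v, L (v, 0) = 0) ∧ (z.2 < T → L (0, 1) ≤ 0) ∧ (0 < z.2 → 0 ≤ L (0, 1)) := by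
  -- The cylinder is convex, so every direction leading to another of its points lies in the tangent
  -- cone. Spatial directions can be reversed; time directions only away from the end times.
  have key : ∀ y : E × ℝ, z.2 + y.2 ∈ Icc 0 T → L y ≤ 0 := by
    intro y hy
    refine hmax.localize.hasFDerivWithinAt_nonpos hL ?_
    refine mem_posTangentConeAt_of_segment_subset ?_
    refine (convex_univ.prod (convex_Icc 0 T)).segment_subset hz ?_
    exact ⟨mem_univ _, hy⟩
  obtain ⟨-, h0, hT⟩ := hz
  refine ⟨fun v => ?_, fun h => ?_, fun h => ?_⟩
  · have h1 := key (v, 0) (by simpa using ⟨h0, hT⟩)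
    have h2 := key (-v, 0) (by simpa using ⟨h0, hT⟩)
    have : L (-v, 0) = - L (v, 0) := by rw [← map_neg]; simp
    linarith
  · have h1 := key (0, T - z.2) ⟨by simpa using h0.trans hT, by simp⟩
    have : L (0, T - z.2) = (T - z.2) * L (0, 1) := by
      rw [← smul_eq_mul, ← map_smul]; simp
    rw [this] at h1
    exact nonpos_of_mul_nonpos_right h1 (sub_pos.2 h)
  · have h1 := key (0, -z.2) ⟨by simp, by simpa using h0.trans hT⟩
    have : L (0, -z.2) = -(z.2 * L (0, 1)) := by
      rw [← smul_eq_mul, ← map_smul, ← map_neg]; simp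
    rw [this] at h1
    nlinarith

end Calculus

/-! ### Periodic functions -/

section PeriodicFunctions

variable {d : ℕ} {Y : Type}

theorem Periodic.comp {Y' : Type} {φ : Sp d → Y} (h : Periodic φ) (g : Y → Y') :
    Periodic fun x => g (φ x) := fun x i => congrArg g (h x i)

theorem Periodic.add_single_int {φ : Sp d → Y} (h : Periodic φ) (i : Fin d) (n : ℤ) (x : Sp d) :
    φ (x + EuclideanSpace.single i (n : ℝ)) = φ x := by
  have key : Function.Periodic (fun s : ℝ => φ (x + EuclideanSpace.single i s)) 1 := fun s => by
    have : x + EuclideanSpace.single i (s + 1) =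
        (x + EuclideanSpace.single i s) + EuclideanSpace.single i 1 := by
      ext j
      by_cases hj : j = i <;> simp [hj, add_assoc]
    simp only [this, h _ i]
  have h0 : EuclideanSpace.single i (0 : ℝ) = 0 := by ext j; simp
  simpa [h0] using key.int_mul n 0

/-- The closed unit cube. -/
def cube (d : ℕ) : Set (Sp d) := {x | ∀ i, x i ∈ Icc (0 : ℝ) 1}

theorem isCompact_cube : IsCompact (cube d) := by
  have h : IsCompact (Set.pi univ fun _ : Fin d => Icc (0 : ℝ) 1) :=
    isCompact_univ_pi fun _ => isCompact_Icc
  convert h.image (EuclideanSpace.equiv (Fin d) ℝ).symm.continuous using 1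
  ext x
  constructor
  · intro hx
    exact ⟨fun i => x i, fun i _ => hx i, rfl⟩
  · rintro ⟨y, hy, rfl⟩ i
    exact hy i (mem_univ i)

theorem cube_nonempty : (cube d).Nonempty := ⟨0, fun i => by simp⟩

/-- Translate by the integer parts of the coordinates. The point `y` is chosen before the function,
so one representative serves all periodic functions. -/
theorem exists_mem_cube (x : Sp d) :
    ∃ y ∈ cube d, ∀ {Y : Type} (φ : Sp d → Y), Periodic φ → φ x = φ y := by
  have key : ∀ (s : Finset (Fin d)) {Y : Type} (φ : Sp d → Y), Periodic φ →
      φ (x + ∑ i ∈ s, EuclideanSpace.single i ((-⌊x i⌋ : ℤ) : ℝ)) = φ x := by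
    intro s Y φ hφ
    induction s using Finset.induction_on with
    | empty => simp
    | insert i s hi ih =>
      rw [Finset.sum_insert hi, add_comm (EuclideanSpace.single i _), ← add_assoc,
        hφ.add_single_int, ih]
  refine ⟨x + ∑ i, EuclideanSpace.single i ((-⌊x i⌋ : ℤ) : ℝ), fun j => ?_,
    fun φ hφ => (key _ φ hφ).symm⟩
  have : (x + ∑ i, EuclideanSpace.single i ((-⌊x i⌋ : ℤ) : ℝ)) j = Int.fract (x j) := by
    simp [Int.fract, Finset.sum_apply, Pi.single_apply, sub_eq_add_neg]
  rw [this]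
  exact ⟨Int.fract_nonneg _, (Int.fract_lt_one _).le⟩

/-- This plays the role of compactness of the torus: a maximum over the compact cube is global by
periodicity. -/
theorem exists_isMaxOn_cylinder {S : Set ℝ} (hS : IsCompact S) (hne : S.Nonempty)
    {Φ : Sp d × ℝ → ℝ} (hc : ContinuousOn Φ (univ ×ˢ S))
    (hp : ∀ t ∈ S, Periodic fun x => Φ (x, t)) :
    ∃ z ∈ cube d ×ˢ S, IsMaxOn Φ (univ ×ˢ S) z := by
  obtain ⟨z, hz, hmax⟩ := (isCompact_cube.prod hS).exists_isMaxOn (cube_nonempty.prod hne)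
    (hc.mono (prod_mono (subset_univ _) subset_rfl))
  refine ⟨z, hz, fun z' hz' => ?_⟩
  obtain ⟨y, hy, h⟩ := exists_mem_cube z'.1
  have := h _ (hp z'.2 hz'.2)
  exact this.le.trans (hmax (show (y, z'.2) ∈ cube d ×ˢ S from ⟨hy, hz'.2⟩))

theorem exists_bound_cylinder {S : Set ℝ} (hS : IsCompact S) {Y : Type} [NormedAddCommGroup Y]
    {Φ : Sp d × ℝ → Y} (hc : ContinuousOn Φ (univ ×ˢ S))
    (hp : ∀ t ∈ S, Periodic fun x => Φ (x, t)) :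
    ∃ B, ∀ z ∈ univ ×ˢ S, ‖Φ z‖ ≤ B := by
  rcases S.eq_empty_or_nonempty with rfl | hne
  · exact ⟨0, fun z hz => hz.2.elim⟩
  · obtain ⟨z, -, h⟩ := exists_isMaxOn_cylinder hS hne hc.norm fun t ht => (hp t ht).comp norm
    exact ⟨_, h⟩

theorem Periodic.fderiv [NormedAddCommGroup Y] [NormedSpace ℝ Y] {φ : Sp d → Y}
    (h : Periodic φ) : Periodic (fderiv ℝ φ) := fun x i => by
  have : (fun y => φ (y + EuclideanSpace.single i 1)) = φ := funext fun y => h y i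
  rw [← fderiv_comp_add_right, this]

theorem Periodic.gradient {φ : Sp d → ℝ} (h : Periodic φ) : Periodic (gradient φ) :=
  h.fderiv.comp _

end PeriodicFunctions

end MFG

end

noncomputable section

namespace MFG

open Set Filter Topology MeasureTheory
open scoped ENNReal

/-! ### The extended norms -/

section Norms

variable {X Y : Type} [NormedAddCommGroup Y]

theorem norm_le_of_c0Norm_le {S : Set X} {φ : X → Y} {r : ℝ} (hr : 0 ≤ r)
    (h : c0Norm S φ ≤ ENNReal.ofReal r) {z : X} (hz : z ∈ S) : ‖φ z‖ ≤ r := by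
  have : ‖φ z‖ₑ ≤ ENNReal.ofReal r := (le_iSup₂ (f := fun z _ => ‖φ z‖ₑ) z hz).trans h
  rwa [← ofReal_norm, ENNReal.ofReal_le_ofReal_iff hr] at this

theorem c0Norm_le {S : Set X} {φ : X → Y} {r : ℝ} (h : ∀ z ∈ S, ‖φ z‖ ≤ r) :
    c0Norm S φ ≤ ENNReal.ofReal r :=
  iSup₂_le fun z hz => by
    rw [← ofReal_norm]; exact ENNReal.ofReal_le_ofReal (h z hz)

theorem c0Norm_ne_top {S : Set X} {φ : X → Y} {r : ℝ} (h : ∀ z ∈ S, ‖φ z‖ ≤ r) :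
    c0Norm S φ ≠ ⊤ := ((c0Norm_le h).trans_lt ENNReal.ofReal_lt_top).ne

variable {X : Type} [NormedAddCommGroup X] [NormedSpace ℝ X] [NormedSpace ℝ Y]

theorem c0Norm_le_ckNorm (k : ℕ) (S : Set X) (φ : X → Y) : c0Norm S φ ≤ ckNorm k S φ := by
  refine le_trans (le_of_eq ?_) (Finset.single_le_sum
    (f := fun j => c0Norm S (iteratedFDeriv ℝ j φ)) (fun _ _ => zero_le)
    (Finset.mem_range.2 k.succ_pos))
  simp only [c0Norm, ← ofReal_norm, norm_iteratedFDeriv_zero]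

theorem c0Norm_fderiv_le_ckNorm {k : ℕ} (hk : 1 ≤ k) (S : Set X) (φ : X → Y) :
    c0Norm S (fderiv ℝ φ) ≤ ckNorm k S φ := by
  refine le_trans (le_of_eq ?_) (Finset.single_le_sum
    (f := fun j => c0Norm S (iteratedFDeriv ℝ j φ)) (fun _ _ => zero_le)
    (Finset.mem_range.2 (Nat.lt_succ_of_le hk)))
  simp only [c0Norm, ← ofReal_norm, norm_iteratedFDeriv_one]

theorem ckNorm_one_eq (S : Set X) (φ : X → Y) :
    ckNorm 1 S φ = c0Norm S φ + c0Norm S (fderiv ℝ φ) := by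
  simp only [ckNorm, Finset.sum_range_succ, Finset.sum_range_zero, zero_add, c0Norm,
    ← ofReal_norm, norm_iteratedFDeriv_zero, norm_iteratedFDeriv_one]

end Norms

theorem inner_gradient {d : ℕ} (φ : Sp d → ℝ) (x v : Sp d) :
    inner ℝ (gradient φ x) v = fderiv ℝ φ x v := by
  simp [gradient]

/-- The Riesz isomorphism, as a continuous linear map. -/
def riesz (d : ℕ) : (Sp d →L[ℝ] ℝ) →L[ℝ] Sp d :=
  LinearMap.toContinuousLinearMap
    { toFun := fun l => (InnerProductSpace.toDual ℝ (Sp d)).symm l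
      map_add' := fun l l' => map_add _ l l'
      map_smul' := fun c l => by simp }

theorem inner_riesz {d : ℕ} (l : Sp d →L[ℝ] ℝ) (v : Sp d) : inner ℝ (riesz d l) v = l v := by
  simp [riesz]

/-! ### Couplings -/

theorem inv_spec {φ : ℝ → ℝ} {w : ℝ} (h : ∃ m ∈ Ioi (0 : ℝ), φ m = w) :
    0 < inv φ w ∧ φ (inv φ w) = w :=
  ⟨Function.invFunOn_mem h, Function.invFunOn_eq h⟩

namespace IsCoupling

variable {d : ℕ} {F : Sp d → ℝ → EReal} (hF : IsCoupling F) {x : Sp d} {m : ℝ}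

include hF

/-- Strict monotonicity puts `F x m` above `F x 0`, hence above `⊥`. -/
theorem coe_val (hm : 0 < m) : (val F x m : EReal) = F x m :=
  EReal.coe_toReal (hF.ne_top x m hm.le)
    ((bot_le.trans_lt (hF.strictMonoOn x self_mem_Ici hm.le hm)).ne')

theorem val_lt_val (hm : 0 < m) {m' : ℝ} (h : m < m') : val F x m < val F x m' := by
  rw [← EReal.coe_lt_coe_iff, hF.coe_val hm, hF.coe_val (hm.trans h)]
  exact hF.strictMonoOn x hm.le (hm.trans h).le h

theorem strictMonoOn_val (x : Sp d) : StrictMonoOn (val F x) (Ioi 0) :=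
  fun _ hm _ _ h => hF.val_lt_val hm h

theorem val_le_val (hm : 0 < m) {m' : ℝ} (h : m ≤ m') : val F x m ≤ val F x m' :=
  (hF.strictMonoOn_val x).monotoneOn hm (hm.trans_le h) h

theorem periodic_val (hm : 0 ≤ m) : Periodic fun x => val F x m :=
  (hF.periodic m hm).comp EReal.toReal

theorem contDiffAt_val (hm : 0 < m) :
    ContDiffAt ℝ 4 (fun z : Sp d × ℝ => val F z.1 z.2) (x, m) :=
  hF.contDiffOn.contDiffAt ((isOpen_univ.prod isOpen_Ioi).mem_nhds ⟨mem_univ _, hm⟩)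

theorem contDiffAt_val_right (hm : 0 < m) : ContDiffAt ℝ 4 (val F x) m :=
  (hF.contDiffAt_val (x := x) hm).comp m (contDiffAt_const.prodMk contDiffAt_id)

theorem hasDerivAt_val (hm : 0 < m) : HasDerivAt (val F x) (Dm F x m) m :=
  ((hF.contDiffAt_val_right hm).differentiableAt (by simp)).hasDerivAt

theorem contDiffAt_Dx (hm : 0 < m) :
    ContDiffAt ℝ 3 (fun z : Sp d × ℝ => Dx F z.1 z.2) (x, m) := by
  have h : ContDiffAt ℝ 3 (fun z : Sp d × ℝ => fderiv ℝ (fun y => val F y z.2) z.1) (x, m) := ?_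
  · exact (riesz d).contDiff.contDiffAt.comp (x, m) h
  refine ContDiffAt.fderiv (n := 4) (f := fun (z : Sp d × ℝ) y => val F y z.2)
    (g := fun z : Sp d × ℝ => z.1) ?_ contDiffAt_fst (by norm_num)
  exact ContDiffAt.comp (g := fun z : Sp d × ℝ => val F z.1 z.2)
    (f := fun z : (Sp d × ℝ) × Sp d => (z.2, z.1.2)) ((x, m), x) (hF.contDiffAt_val hm)
    (contDiffAt_snd.prodMk (contDiffAt_snd.comp _ contDiffAt_fst))

theorem contDiffAt_Dm (hm : 0 < m) :
    ContDiffAt ℝ 3 (fun z : Sp d × ℝ => Dm F z.1 z.2) (x, m) := by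
  have h : ContDiffAt ℝ 3 (fun z : Sp d × ℝ => fderiv ℝ (val F z.1) z.2) (x, m) := by
    refine ContDiffAt.fderiv (n := 4) (f := fun (z : Sp d × ℝ) r => val F z.1 r)
      (g := fun z : Sp d × ℝ => z.2) ?_ contDiffAt_snd (by norm_num)
    exact ContDiffAt.comp (g := fun z : Sp d × ℝ => val F z.1 z.2)
      (f := fun z : (Sp d × ℝ) × ℝ => (z.1.1, z.2)) ((x, m), m) (hF.contDiffAt_val hm)
      ((contDiffAt_fst.comp _ contDiffAt_fst).prodMk contDiffAt_snd)
  exact h.clm_apply contDiffAt_const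

theorem contDiffAt_Dm_right (hm : 0 < m) : ContDiffAt ℝ 3 (Dm F x) m :=
  (hF.contDiffAt_Dm (x := x) hm).comp m (contDiffAt_const.prodMk contDiffAt_id)

/-- The mixed derivatives of a coupling agree. -/
theorem fderiv_Dm (hm : 0 < m) (v : Sp d) :
    fderiv ℝ (fun y => Dm F y m) x v = inner ℝ (Dxm F x m) v := by
  have h := fderiv_fderiv_partial_comm (G := val F) (a := x) (b := m)
    ((hF.contDiffAt_val hm).of_le (by norm_num)) v 1
  have hd : DifferentiableAt ℝ (fun r => Dx F x r) m :=
    (((hF.contDiffAt_Dx (x := x) hm).comp m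
      (contDiffAt_const.prodMk contDiffAt_id)).differentiableAt (by simp))
  have e1 : inner ℝ (Dxm F x m) v = fderiv ℝ (fun q => fderiv ℝ (fun x => val F x q) x) m 1 v := by
    have h1 : HasDerivAt (fun r => inner ℝ (Dx F x r) v) (inner ℝ (Dxm F x m) v) m := by
      exact (hd.hasDerivAt.inner ℝ (hasDerivAt_const m v)).congr_deriv (by simp [Dxm])
    have h2 : DifferentiableAt ℝ (fun q => fderiv ℝ (fun x => val F x q) x) m := by
      refine (ContDiffAt.fderiv (n := 4) (m := 3) (f := fun (q : ℝ) y => val F y q)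
        (g := fun _ : ℝ => x) ?_ contDiffAt_const (by norm_num)).differentiableAt (by simp)
      exact ContDiffAt.comp (g := fun z : Sp d × ℝ => val F z.1 z.2)
        (f := fun z : ℝ × Sp d => (z.2, z.1)) (m, x) (hF.contDiffAt_val hm)
        (contDiffAt_snd.prodMk contDiffAt_fst)
    have h3 : HasDerivAt (fun r => fderiv ℝ (fun x => val F x r) x v)
        (fderiv ℝ (fun q => fderiv ℝ (fun x => val F x q) x) m 1 v) m := by
      simpa using h2.hasFDerivAt.hasDerivAt.clm_apply (hasDerivAt_const m v)
    refine h1.unique (h3.congr_of_eventuallyEq ?_)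
    exact Eventually.of_forall fun r => inner_gradient _ _ _
  rw [e1, h]
  have h2 : DifferentiableAt ℝ (fun y => fderiv ℝ (val F y) m) x := by
    refine (ContDiffAt.fderiv (n := 4) (m := 3) (f := fun (y : Sp d) r => val F y r)
      (g := fun _ => m) (hF.contDiffAt_val hm) contDiffAt_const
      (by norm_num)).differentiableAt (by simp)
  have h3 := h2.hasFDerivAt.clm_apply (hasFDerivAt_const (1 : ℝ) x)
  have h4 : fderiv ℝ (fun y => Dm F y m) x = _ := h3.fderiv
  rw [h4]; simp

theorem periodic_Dx (hm : 0 ≤ m) : Periodic fun x => Dx F x m :=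
  (hF.periodic_val hm).gradient

theorem periodic_Dm (hm : 0 < m) : Periodic fun x => Dm F x m := fun x i => by
  refine EventuallyEq.deriv_eq ?_
  filter_upwards [lt_mem_nhds hm] with r hr
  exact hF.periodic_val hr.le x i

/-! ### Extrema over the torus -/

theorem exists_min (hm : 0 < m) : ∃ x, lowerEnv F m = val F x m ∧ ∀ y, val F x m ≤ val F y m := by
  have hc : ContinuousOn (fun z : Sp d × ℝ => -val F z.1 z.2) (univ ×ˢ {m}) := by
    rintro ⟨y, r⟩ ⟨-, rfl⟩
    exact (hF.contDiffAt_val hm).continuousAt.continuousWithinAt.neg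
  obtain ⟨⟨x, r⟩, ⟨-, rfl⟩, h⟩ := exists_isMaxOn_cylinder isCompact_singleton
    (singleton_nonempty m) hc (by rintro t rfl; exact (hF.periodic_val hm.le).comp Neg.neg)
  have h' : ∀ y, val F x r ≤ val F y r := fun y => by
    simpa using h (show (y, r) ∈ univ ×ˢ {r} from ⟨mem_univ _, rfl⟩)
  exact ⟨x, le_antisymm (ciInf_le ⟨_, forall_mem_range.2 h'⟩ x) (le_ciInf h'), h'⟩

theorem exists_max (hm : 0 < m) : ∃ x, upperEnv F m = val F x m ∧ ∀ y, val F y m ≤ val F x m := by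
  have hc : ContinuousOn (fun z : Sp d × ℝ => val F z.1 z.2) (univ ×ˢ {m}) := by
    rintro ⟨y, r⟩ ⟨-, rfl⟩
    exact (hF.contDiffAt_val hm).continuousAt.continuousWithinAt
  obtain ⟨⟨x, r⟩, ⟨-, rfl⟩, h⟩ := exists_isMaxOn_cylinder isCompact_singleton
    (singleton_nonempty m) hc (by rintro t rfl; exact hF.periodic_val hm.le)
  have h' : ∀ y, val F y r ≤ val F x r := fun y => by
    simpa using h (show (y, r) ∈ univ ×ˢ {r} from ⟨mem_univ _, rfl⟩)
  exact ⟨x, le_antisymm (ciSup_le h') (le_ciSup (f := fun y => val F y r)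
    ⟨_, forall_mem_range.2 h'⟩ x), h'⟩

theorem lowerEnv_le (hm : 0 < m) (x : Sp d) : lowerEnv F m ≤ val F x m := by
  obtain ⟨y, h, h'⟩ := hF.exists_min hm
  exact h.trans_le (h' x)

theorem le_upperEnv (hm : 0 < m) (x : Sp d) : val F x m ≤ upperEnv F m := by
  obtain ⟨y, h, h'⟩ := hF.exists_max hm
  exact (h' x).trans_eq h.symm

/-- By periodicity the infimum is taken over the compact cube, and an infimum over a fixed compact
set depends continuously on the parameter. -/
theorem continuousOn_lowerEnv : ContinuousOn (lowerEnv F) (Ioi 0) := by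
  rw [continuousOn_iff_continuous_domRestrict]
  have hc : Continuous (fun q : Ioi (0 : ℝ) × Sp d => val F q.2 q.1) := by
    refine continuous_iff_continuousAt.2 fun ⟨r, y⟩ => ?_
    exact ContinuousAt.comp (g := fun z : Sp d × ℝ => val F z.1 z.2)
      (f := fun q : Ioi (0 : ℝ) × Sp d => (q.2, (q.1 : ℝ)))
      (hF.contDiffAt_val r.2).continuousAt (by fun_prop)
  convert isCompact_cube.continuous_sInf (K := cube d) (f := fun (r : Ioi (0 : ℝ)) y => val F y r)
    hc using 2 with r
  obtain ⟨x, h, h'⟩ := hF.exists_min r.2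
  obtain ⟨y, hy, hxy⟩ := exists_mem_cube x
  have hx := hxy _ (hF.periodic_val (le_of_lt r.2))
  rw [Set.domRestrict_apply, h, hx]
  symm
  apply IsLeast.csInf_eq
  refine ⟨⟨y, hy, rfl⟩, ?_⟩
  rintro _ ⟨y', -, rfl⟩
  exact hx.symm.trans_le (h' y')

theorem continuousOn_upperEnv : ContinuousOn (upperEnv F) (Ioi 0) := by
  rw [continuousOn_iff_continuous_domRestrict]
  have hc : Continuous (fun q : Ioi (0 : ℝ) × Sp d => val F q.2 q.1) := by
    refine continuous_iff_continuousAt.2 fun ⟨r, y⟩ => ?_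
    exact ContinuousAt.comp (g := fun z : Sp d × ℝ => val F z.1 z.2)
      (f := fun q : Ioi (0 : ℝ) × Sp d => (q.2, (q.1 : ℝ)))
      (hF.contDiffAt_val r.2).continuousAt (by fun_prop)
  convert isCompact_cube.continuous_sSup (K := cube d) (f := fun (r : Ioi (0 : ℝ)) y => val F y r)
    hc using 2 with r
  obtain ⟨x, h, h'⟩ := hF.exists_max r.2
  obtain ⟨y, hy, hxy⟩ := exists_mem_cube x
  have hx := hxy _ (hF.periodic_val (le_of_lt r.2))
  rw [Set.domRestrict_apply, h, hx]
  symm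
  apply IsGreatest.csSup_eq
  refine ⟨⟨y, hy, rfl⟩, ?_⟩
  rintro _ ⟨y', -, rfl⟩
  exact (h' y').trans_eq hx

/-! ### Small and large densities, uniformly over the torus -/

/-- The strict inequality at `m = 0` extends to a neighbourhood by continuity into `EReal`;
compactness of the cube makes the neighbourhood uniform in `x`. -/
theorem exists_forall_lt_of_zero {c : EReal} (h : ∀ x, F x 0 < c) :
    ∃ δ > 0, ∀ x, ∀ r ∈ Icc 0 δ, F x r < c := by
  have key : ∀ᶠ r in 𝓝 (0 : ℝ), ∀ y ∈ cube d, 0 ≤ r → F y r < c := by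
    refine isCompact_cube.eventually_forall_of_forall_eventually fun y _ => ?_
    have hc : ContinuousWithinAt (fun z : Sp d × ℝ => F z.1 z.2) (univ ×ˢ Ici 0) (y, 0) :=
      hF.continuousOn _ ⟨mem_univ _, self_mem_Ici⟩
    have h1 := eventually_nhdsWithin_iff.1 (hc.eventually (gt_mem_nhds (h y)))
    have h2 := (continuous_swap.tendsto ((0 : ℝ), y)).eventually h1
    filter_upwards [h2] with z hz h0
    exact hz ⟨mem_univ _, h0⟩
  obtain ⟨ε, hε, hball⟩ := Metric.eventually_nhds_iff.1 key
  refine ⟨ε / 2, by positivity, fun x r hr => ?_⟩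
  obtain ⟨y, hy, hxy⟩ := exists_mem_cube x
  rw [hxy _ (hF.periodic r hr.1)]
  refine hball ?_ y hy hr.1
  rw [Real.dist_eq, sub_zero, abs_of_nonneg hr.1]
  linarith [hr.2]

/-- A Dini-type argument: the inequality at a single `r` persists for nearby `x`, monotonicity
carries it to all larger densities, and finitely many neighbourhoods cover the cube. -/
theorem exists_forall_lt_of_large {c : EReal} (h : ∀ x, ∃ r ≥ 0, c < F x r) :
    ∃ M > 0, ∀ x, ∀ r ≥ M, c < F x r := by
  have key : ∃ M ≥ 0, ∀ y ∈ cube d, ∀ r ≥ M, c < F y r := by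
    refine isCompact_cube.induction_on (p := fun s => ∃ M ≥ 0, ∀ y ∈ s, ∀ r ≥ M, c < F y r)
      ⟨0, le_rfl, by simp⟩ ?_ ?_ ?_
    · rintro s t hst ⟨M, hM, hs⟩
      exact ⟨M, hM, fun y hy => hs y (hst hy)⟩
    · rintro s t ⟨M, hM, hs⟩ ⟨N, hN, ht⟩
      refine ⟨max M N, le_max_of_le_left hM, fun y hy r hr => ?_⟩
      rcases hy with hy | hy
      · exact hs y hy r (le_of_max_le_left hr)
      · exact ht y hy r (le_of_max_le_right hr)
    · intro x _
      obtain ⟨r, hr, hx⟩ := h x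
      have hc : ContinuousAt (fun y => F y r) x := by
        have := (hF.continuousOn (x, r) ⟨mem_univ _, hr⟩).comp
          (f := fun y => (y, r)) (s := univ) (x := x)
          (Continuous.prodMk_left r).continuousAt.continuousWithinAt
          (fun y _ => ⟨mem_univ _, hr⟩)
        exact continuousWithinAt_univ _ _ |>.1 this
      refine ⟨_, mem_nhdsWithin_of_mem_nhds (hc.eventually (lt_mem_nhds hx)), r, hr,
        fun y hy r' hr' => ?_⟩
      exact lt_of_lt_of_le hy ((hF.strictMonoOn y).monotoneOn hr (hr.le.trans hr') hr')
  obtain ⟨M, hM, hs⟩ := key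
  refine ⟨M + 1, by positivity, fun x r hr => ?_⟩
  obtain ⟨y, hy, hxy⟩ := exists_mem_cube x
  have hr' : M ≤ r := by linarith
  rw [hxy _ (hF.periodic r (hM.le.trans hr'))]
  exact hs y hy r hr'

/-- `inv` is meaningful only at attained values, so attainment has to come from bracketing `w` and
the intermediate value theorem. -/
theorem lowerEnv_inv_spec {w a b : ℝ} (ha : 0 < a) (hb : 0 < b) (h1 : lowerEnv F a ≤ w)
    (h2 : w ≤ lowerEnv F b) :
    0 < inv (lowerEnv F) w ∧ lowerEnv F (inv (lowerEnv F) w) = w := by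
  refine inv_spec ?_
  have := isPreconnected_Ioi.intermediate_value (a := a) (b := b) (s := Ioi (0 : ℝ)) ha hb
    hF.continuousOn_lowerEnv ⟨h1, h2⟩
  simpa using this

theorem upperEnv_inv_spec {w a b : ℝ} (ha : 0 < a) (hb : 0 < b) (h1 : upperEnv F a ≤ w)
    (h2 : w ≤ upperEnv F b) :
    0 < inv (upperEnv F) w ∧ upperEnv F (inv (upperEnv F) w) = w := by
  refine inv_spec ?_
  have := isPreconnected_Ioi.intermediate_value (a := a) (b := b) (s := Ioi (0 : ℝ)) ha hb
    hF.continuousOn_upperEnv ⟨h1, h2⟩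
  simpa using this

theorem inv_val (hm : 0 < m) : inv (val F x) (val F x m) = m := by
  obtain ⟨h1, h2⟩ := inv_spec (φ := val F x) ⟨m, hm, rfl⟩
  exact (hF.strictMonoOn_val x).injOn h1 hm h2

theorem chi_val (hm : 0 < m) : chi F x (val F x m) = m * Dm F x m := by
  rw [chi, hF.inv_val hm]

/-- `χ` is `m F_m` composed with the inverse of `F(x,·)`, whose derivative is `1 / F_m`. -/
theorem hasDerivAt_chi (hm : 0 < m) :
    HasDerivAt (chi F x) ((Dm F x m + m * deriv (Dm F x) m) / Dm F x m) (val F x m) := by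
  have hs : HasStrictDerivAt (val F x) (Dm F x m) m :=
    (hF.contDiffAt_val_right hm).hasStrictDerivAt (by simp)
  have hpos := hF.Dm_pos x m hm
  have hi : HasDerivAt (inv (val F x)) (Dm F x m)⁻¹ (val F x m) := by
    refine (hs.to_local_left_inverse hpos.ne' ?_).hasDerivAt
    filter_upwards [lt_mem_nhds hm] with r hr
    exact hF.inv_val hr
  have hi' : inv (val F x) (val F x m) = m := hF.inv_val hm
  have hD : HasDerivAt (Dm F x) (deriv (Dm F x) m) (inv (val F x) (val F x m)) := by
    rw [hi']
    exact ((hF.contDiffAt_Dm_right hm).differentiableAt (by simp)).hasDerivAt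
  have := hi.mul (hD.comp _ hi)
  refine this.congr_deriv ?_
  simp only [Function.comp_apply, hi']
  field_simp

end IsCoupling

/-! ### Surjectivity of `f(x,·)` onto the line; growth and positivity of `χ`. -/

namespace RunningCostAssumptions

variable {d : ℕ} {C₀ τ : ℝ} {f : Sp d → ℝ → EReal} (hf : RunningCostAssumptions C₀ τ f)

include hf

theorem exists_small (K : ℝ) : ∃ δ > 0, ∀ x, ∀ m, 0 < m → m ≤ δ → val f x m < K := by
  obtain ⟨δ, hδ, h⟩ := hf.isCoupling.exists_forall_lt_of_zero (c := (K : EReal)) fun x => by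
    rw [hf.strictlyElliptic]; exact EReal.bot_lt_coe K
  refine ⟨δ, hδ, fun x m hm hmδ => ?_⟩
  rw [← EReal.coe_lt_coe_iff, hf.isCoupling.coe_val hm]
  exact h x m ⟨hm.le, hmδ⟩

/-- From `m f_m ≥ c` for large `m`, the function `f - c log m` is eventually nondecreasing, so `f`
grows at least logarithmically. -/
theorem exists_val_gt (K : ℝ) (x : Sp d) : ∃ m > 0, K < val f x m := by
  obtain ⟨c, hc, hev⟩ := hf.growth
  obtain ⟨M, hM⟩ := (hev.and (eventually_ge_atTop 1)).exists_forall_of_atTop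
  have hM1 : 1 ≤ M := (hM M le_rfl).2
  have hM0 : 0 < M := by linarith
  have hd : ∀ r, M ≤ r → HasDerivAt (fun r => val f x r - c * Real.log r)
      (Dm f x r - c * r⁻¹) r := fun r hr =>
    (hf.isCoupling.hasDerivAt_val (hM0.trans_le hr)).sub
      ((Real.hasDerivAt_log (hM0.trans_le hr).ne').const_mul c)
  have hmono : MonotoneOn (fun r => val f x r - c * Real.log r) (Ici M) := by
    refine monotoneOn_of_deriv_nonneg (convex_Ici M)
      (fun r hr => (hd r hr).continuousAt.continuousWithinAt)
      (fun r hr => (hd r (interior_subset hr)).differentiableAt.differentiableWithinAt)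
      fun r hr => ?_
    have hr' : M ≤ r := interior_subset hr
    have hr0 : 0 < r := hM0.trans_le hr'
    rw [(hd r hr').deriv, sub_nonneg, ← div_eq_mul_inv, div_le_iff₀' hr0]
    exact (hM r hr').1 x
  have hlim : Tendsto (fun r => c * Real.log r) atTop atTop :=
    Real.tendsto_log_atTop.const_mul_atTop hc
  obtain ⟨r, hr, hr'⟩ := ((hlim.eventually_gt_atTop
    (K - (val f x M - c * Real.log M))).and (eventually_ge_atTop M)).exists
  refine ⟨r, hM0.trans_le hr', ?_⟩
  have := hmono self_mem_Ici hr' hr'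
  simp only at this
  linarith

theorem exists_large (K : ℝ) : ∃ M > 0, ∀ x, ∀ m ≥ M, K < val f x m := by
  obtain ⟨M, hM, h⟩ := hf.isCoupling.exists_forall_lt_of_large (c := (K : EReal)) fun x => by
    obtain ⟨m, hm, h⟩ := hf.exists_val_gt K x
    exact ⟨m, hm.le, by rw [← hf.isCoupling.coe_val hm]; exact_mod_cast h⟩
  refine ⟨M, hM, fun x m hm => ?_⟩
  rw [← EReal.coe_lt_coe_iff, hf.isCoupling.coe_val (hM.trans_le hm)]
  exact h x m hm

theorem exists_val_eq (x : Sp d) (w : ℝ) : ∃ m > 0, val f x m = w := by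
  obtain ⟨δ, hδ, h1⟩ := hf.exists_small w
  obtain ⟨M, hM, h2⟩ := hf.exists_large w
  have hc : ContinuousOn (val f x) (Ioi 0) := fun m hm =>
    (hf.isCoupling.hasDerivAt_val hm).continuousAt.continuousWithinAt
  have := isPreconnected_Ioi.intermediate_value (a := δ) (b := M) (s := Ioi (0 : ℝ)) hδ hM
    hc ⟨(h1 x δ hδ le_rfl).le, (h2 x M le_rfl).le⟩
  simpa using this

theorem chi_pos (x : Sp d) (w : ℝ) : 0 < chi f x w := by
  obtain ⟨m, hm, rfl⟩ := hf.exists_val_eq x w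
  rw [hf.isCoupling.chi_val hm]
  exact mul_pos hm (hf.isCoupling.Dm_pos x m hm)

theorem differentiable_chi (x : Sp d) : Differentiable ℝ (chi f x) := fun w => by
  obtain ⟨m, hm, rfl⟩ := hf.exists_val_eq x w
  exact (hf.isCoupling.hasDerivAt_chi hm).differentiableAt

theorem chi_le (x : Sp d) (w : ℝ) : chi f x w ≤ chi f x 0 + C₀ * |w| := by
  have h := Convex.norm_image_sub_le_of_norm_deriv_le (f := chi f x) (s := univ) (x := 0) (y := w)
    (C := C₀) (fun w _ => hf.differentiable_chi x w) (fun w _ => hf.chi_w_le x w) convex_univ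
    (mem_univ _) (mem_univ _)
  rw [sub_zero, Real.norm_eq_abs, Real.norm_eq_abs] at h
  linarith [le_abs_self (chi f x w - chi f x 0)]

theorem deriv_hfun (x : Sp d) (w : ℝ) :
    deriv (hfun f x) w = deriv (chi f x) w / (2 * Real.sqrt (chi f x w)) :=
  ((hf.differentiable_chi x w).hasDerivAt.sqrt (hf.chi_pos x w).ne').deriv

/-- The condition `w ≥ -K` excludes small densities because `f → -∞` uniformly as `m → 0`. Large
densities are covered by the growth assumption, and the remaining ones form a compact set on which
`m f_m` is positive and continuous. -/
theorem exists_chi_lower_bound (K : ℝ) : ∃ c > 0, ∀ x, ∀ w ≥ -K, c ≤ chi f x w := by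
  have hfc := hf.isCoupling
  obtain ⟨c, hc, hev⟩ := hf.growth
  obtain ⟨M, hM⟩ := hev.exists_forall_of_atTop
  obtain ⟨δ, hδ, hs⟩ := hf.exists_small (-K)
  have hcont : ContinuousOn (fun z : Sp d × ℝ => -(z.2 * Dm f z.1 z.2))
      (univ ×ˢ Icc δ (max δ M)) := by
    rintro ⟨x, m⟩ ⟨-, hm, -⟩
    exact (continuousAt_snd.mul
      (hfc.contDiffAt_Dm (hδ.trans_le hm)).continuousAt).neg.continuousWithinAt
  obtain ⟨⟨x₀, m₀⟩, ⟨-, hm₀⟩, hmax⟩ := exists_isMaxOn_cylinder isCompact_Icc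
    ⟨δ, by simp⟩ hcont (fun t ht => (hfc.periodic_Dm (hδ.trans_le ht.1)).comp fun y => -(t * y))
  have hm₀' : 0 < m₀ := hδ.trans_le hm₀.1
  refine ⟨min c (m₀ * Dm f x₀ m₀), lt_min hc (mul_pos hm₀' (hfc.Dm_pos _ _ hm₀')),
    fun x w hw => ?_⟩
  obtain ⟨m, hm, rfl⟩ := hf.exists_val_eq x w
  rw [hfc.chi_val hm]
  rcases le_or_gt M m with h | h
  · exact (min_le_left _ _).trans (hM m h x)
  · have hδm : δ ≤ m := by
      by_contra! hlt
      exact absurd (hs x m hm hlt.le) (not_lt.2 hw)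
    have := hmax (show (x, m) ∈ univ ×ˢ Icc δ (max δ M) from
      ⟨mem_univ _, hδm, le_max_of_le_right h.le⟩)
    simp only [mem_ofPred_eq, neg_le_neg_iff] at this
    exact (min_le_right _ _).trans this

theorem lowerEnv_inv_spec (w : ℝ) :
    0 < inv (lowerEnv f) w ∧ lowerEnv f (inv (lowerEnv f) w) = w := by
  obtain ⟨δ, hδ, h1⟩ := hf.exists_small w
  obtain ⟨M, hM, h2⟩ := hf.exists_large w
  obtain ⟨x, hx, -⟩ := hf.isCoupling.exists_min hM
  exact hf.isCoupling.lowerEnv_inv_spec hδ hM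
    ((hf.isCoupling.lowerEnv_le hδ 0).trans (h1 0 δ hδ le_rfl).le)
    (by rw [hx]; exact (h2 x M le_rfl).le)

theorem upperEnv_inv_spec (w : ℝ) :
    0 < inv (upperEnv f) w ∧ upperEnv f (inv (upperEnv f) w) = w := by
  obtain ⟨δ, hδ, h1⟩ := hf.exists_small w
  obtain ⟨M, hM, h2⟩ := hf.exists_large w
  obtain ⟨x, hx, -⟩ := hf.isCoupling.exists_max hδ
  exact hf.isCoupling.upperEnv_inv_spec hδ hM
    (by rw [hx]; exact (h1 x δ hδ le_rfl).le)
    ((h2 0 M le_rfl).le.trans (hf.isCoupling.le_upperEnv hM 0))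

end RunningCostAssumptions

/-! ### Well-posedness of the compositions `g₀⁻¹ g₁` and `g₁⁻¹ g₀`. -/

namespace TerminalCostAssumptions

variable {d : ℕ} {g : Sp d → ℝ → EReal} (hg : TerminalCostAssumptions g)

include hg

/-- `g₁(μ)` is a value of `g`, hence strictly below `sup g` by strict monotonicity. Since `g(x,·)`
tends to that same supremum for every `x`, `g₀` eventually exceeds `g₁(μ)`. -/
theorem lowerEnv_inv_upperEnv_spec {μ : ℝ} (hμ : 0 < μ) :
    0 < inv (lowerEnv g) (upperEnv g μ) ∧
      lowerEnv g (inv (lowerEnv g) (upperEnv g μ)) = upperEnv g μ := by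
  have hgc := hg.isCoupling
  obtain ⟨x₀, hx₀, -⟩ := hgc.exists_max hμ
  have hlt : (upperEnv g μ : EReal) < ⨆ (y : Sp d) (m : ℝ) (_ : 0 ≤ m), g y m := by
    rw [hx₀, hgc.coe_val hμ]
    refine lt_of_lt_of_le (hgc.strictMonoOn x₀ hμ.le (show (0 : ℝ) ≤ μ + 1 by positivity)
      (lt_add_one μ)) ?_
    exact le_iSup_of_le x₀ (le_iSup₂_of_le (μ + 1) (by positivity) le_rfl)
  obtain ⟨M, hM, h⟩ := hgc.exists_forall_lt_of_large (c := (upperEnv g μ : EReal)) fun x => by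
    obtain ⟨r, hr, hr'⟩ := (((hg.tendsto_sup x).eventually (lt_mem_nhds hlt)).and
      (eventually_ge_atTop 0)).exists
    exact ⟨r, hr', hr⟩
  obtain ⟨x, hx, -⟩ := hgc.exists_min hM
  refine hgc.lowerEnv_inv_spec hμ hM ((hgc.lowerEnv_le hμ 0).trans (hgc.le_upperEnv hμ 0)) ?_
  rw [hx, ← EReal.coe_le_coe_iff, hgc.coe_val hM]
  exact (h x M le_rfl).le

/-- `g₀(ν)` lies strictly above `inf g`, which is the common value of `g(·,0)`, so `g₁` is below
`g₀(ν)` for small densities. -/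
theorem upperEnv_inv_lowerEnv_spec {ν : ℝ} (hν : 0 < ν) :
    0 < inv (upperEnv g) (lowerEnv g ν) ∧
      upperEnv g (inv (upperEnv g) (lowerEnv g ν)) = lowerEnv g ν := by
  have hgc := hg.isCoupling
  obtain ⟨x₀, hx₀, -⟩ := hgc.exists_min hν
  obtain ⟨δ, hδ, h⟩ := hgc.exists_forall_lt_of_zero (c := (lowerEnv g ν : EReal)) fun x => by
    rw [hx₀, hgc.coe_val hν, hg.zero_eq_inf x, ← hg.zero_eq_inf x₀]
    exact hgc.strictMonoOn x₀ self_mem_Ici hν.le hν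
  obtain ⟨x, hx, -⟩ := hgc.exists_max hδ
  refine hgc.upperEnv_inv_spec hδ hν ?_ ((hgc.lowerEnv_le hν 0).trans (hgc.le_upperEnv hν 0))
  rw [hx, ← EReal.coe_le_coe_iff, hgc.coe_val hδ]
  exact (h x δ ⟨hδ.le, le_rfl⟩).le

end TerminalCostAssumptions

/-! ### Finiteness of `β_K` -/

theorem ckNorm_one_ne_top {d : ℕ} {Y : Type} [NormedAddCommGroup Y] [NormedSpace ℝ Y]
    {Φ : Sp d × ℝ → Y} (hc : ∀ x m, 0 < m → ContDiffAt ℝ 1 Φ (x, m))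
    (hp : ∀ m, 0 < m → Periodic fun x => Φ (x, m)) {a b : ℝ} (ha : 0 < a) :
    ckNorm 1 (univ ×ˢ Icc a b) Φ ≠ ⊤ := by
  rw [ckNorm_one_eq]
  obtain ⟨B₀, h₀⟩ := exists_bound_cylinder (S := Icc a b) isCompact_Icc (Φ := Φ)
    (fun z hz => (hc z.1 z.2 (ha.trans_le hz.2.1)).continuousAt.continuousWithinAt)
    (fun t ht => hp t (ha.trans_le ht.1))
  obtain ⟨B₁, h₁⟩ := exists_bound_cylinder (S := Icc a b) isCompact_Icc (Φ := fderiv ℝ Φ)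
    (fun z hz => (((hc z.1 z.2 (ha.trans_le hz.2.1)).fderiv_right
      (m := 0) (by norm_num)).continuousAt).continuousWithinAt)
    (fun t ht x i => by
      have : (fun z => Φ (z + (EuclideanSpace.single i 1, 0))) =ᶠ[𝓝 (x, t)] Φ := by
        filter_upwards [(isOpen_univ.prod isOpen_Ioi).mem_nhds
          (show (x, t) ∈ univ ×ˢ Ioi (0 : ℝ) from ⟨mem_univ _, ha.trans_le ht.1⟩)] with z hz
        have := hp z.2 hz.2 z.1 i
        rwa [show z + (EuclideanSpace.single i 1, 0) = (z.1 + EuclideanSpace.single i 1, z.2) by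
          ext <;> simp]
      have h := this.fderiv_eq (𝕜 := ℝ)
      rw [fderiv_comp_add_right] at h
      simpa using h)
  exact ENNReal.add_ne_top.2 ⟨c0Norm_ne_top h₀, c0Norm_ne_top h₁⟩

/-- The first two terms are norms of smooth periodic functions over a compact range of densities.
The last two follow from the lower bound for `χ` on `w ≥ -K`, since `h_w = χ_w / (2√χ)`. -/
theorem beta_ne_top {d : ℕ} {C₀ τ : ℝ} {f g : Sp d → ℝ → EReal}
    (hf : RunningCostAssumptions C₀ τ f) (hg : TerminalCostAssumptions g) {K : ℝ} (hK : 0 < K) :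
    beta f g K ≠ ⊤ := by
  have hfc := hf.isCoupling
  have hgc := hg.isCoupling
  obtain ⟨c, hc, hchi⟩ := hf.exists_chi_lower_bound K
  refine ENNReal.add_ne_top.2 ⟨ENNReal.add_ne_top.2 ⟨ENNReal.add_ne_top.2 ⟨?_, ?_⟩, ?_⟩, ?_⟩
  · exact ckNorm_one_ne_top (fun x m hm => (hfc.contDiffAt_val hm).of_le (by norm_num))
      (fun m hm => hfc.periodic_val hm.le) (by positivity)
  · exact ckNorm_one_ne_top (fun x m hm => (hgc.contDiffAt_Dx hm).of_le (by norm_num))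
      (fun m hm => hgc.periodic_Dx hm.le) (by positivity)
  · refine c0Norm_ne_top (r := 1 / c) fun z hz => ?_
    have := hchi z.1 z.2 hz.2
    rw [Real.norm_eq_abs, abs_of_pos (by positivity [hf.chi_pos z.1 z.2])]
    exact one_div_le_one_div_of_le hc this
  · refine c0Norm_ne_top (r := C₀ / (2 * Real.sqrt c)) fun z hz => ?_
    have h1 := hchi z.1 z.2 hz.2
    have h2 := hf.chi_w_le z.1 z.2
    have h3 := hf.deriv_hfun z.1 z.2
    change ‖deriv (hfun f z.1) z.2‖ ≤ _
    rw [h3, Real.norm_eq_abs, abs_div, abs_of_nonneg (show 0 ≤ 2 * √(chi f z.1 z.2) by positivity)]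
    have h4 := Real.sqrt_le_sqrt h1
    have h5 := Real.sqrt_pos.2 hc
    exact div_le_div₀ ((abs_nonneg _).trans h2) h2 (by positivity) (by linarith)

end MFG

end

noncomputable section

namespace MFG

open Set Filter Topology MeasureTheory
open scoped ENNReal

/-! ### The Hamiltonian -/

section Hamiltonian

variable {d : ℕ}

theorem inner_fderiv_riesz {E : Type} [NormedAddCommGroup E] [NormedSpace ℝ E]
    {c : E → Sp d →L[ℝ] ℝ} {z : E} (hc : DifferentiableAt ℝ c z) (y : E) (v : Sp d) :
    inner ℝ (fderiv ℝ (fun q => riesz d (c q)) z y) v = fderiv ℝ c z y v := by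
  have := ((riesz d).hasFDerivAt.comp z hc.hasFDerivAt).fderiv
  rw [show (fun q => riesz d (c q)) = riesz d ∘ c from rfl, this]
  simp [inner_riesz]

namespace HamiltonianAssumptions

variable {C₀ τ : ℝ} {H : Sp d → Sp d → ℝ} (hH : HamiltonianAssumptions C₀ τ H)

include hH

theorem contDiff_Hx : ContDiff ℝ 3 (fun z : Sp d × Sp d => Hx H z.1 z.2) := by
  have h : ContDiff ℝ 3 (fun z : Sp d × Sp d => fderiv ℝ (fun y => H y z.2) z.1) := by
    refine ContDiff.fderiv (m := 4) (f := fun (z : Sp d × Sp d) y => H y z.2)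
      (g := fun z : Sp d × Sp d => z.1) ?_ contDiff_fst (by norm_num)
    exact hH.contDiff.comp (g := fun z : Sp d × Sp d => H z.1 z.2)
      (f := fun z : (Sp d × Sp d) × Sp d => (z.2, z.1.2)) (by fun_prop)
  exact (riesz d).contDiff.comp h

theorem contDiff_Hxp : ContDiff ℝ 3 (fun z : Sp d × Sp d => Hxp H z.1 z.2) := by
  refine ContDiff.fderiv (m := 4) (f := fun (z : Sp d × Sp d) y => Hp H y z.2)
    (g := fun z : Sp d × Sp d => z.1) ?_ contDiff_fst (by norm_num)
  exact hH.contDiff_Hp.comp (g := fun z : Sp d × Sp d => Hp H z.1 z.2)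
    (f := fun z : (Sp d × Sp d) × Sp d => (z.2, z.1.2)) (by fun_prop)

theorem inner_fderiv_Hx (x p v y : Sp d) :
    inner ℝ (fderiv ℝ (fun q => Hx H x q) p y) v = inner ℝ (Hxp H x p v) y := by
  have h1 : DifferentiableAt ℝ (fun q => fderiv ℝ (fun x => H x q) x) p := by
    refine (ContDiff.fderiv (m := 4) (n := 3) (f := fun (q : Sp d) y => H y q)
      (g := fun _ => x) ?_ contDiff_const (by norm_num)).contDiffAt.differentiableAt (by simp)
    exact hH.contDiff.comp (g := fun z : Sp d × Sp d => H z.1 z.2)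
      (f := fun z : Sp d × Sp d => (z.2, z.1)) (by fun_prop)
  have h2 : DifferentiableAt ℝ (fun x => fderiv ℝ (H x) p) x := by
    refine (ContDiff.fderiv (m := 4) (n := 3) (f := fun (x : Sp d) y => H x y)
      (g := fun _ => p) hH.contDiff contDiff_const
      (by norm_num)).contDiffAt.differentiableAt (by simp)
  have e1 := inner_fderiv_riesz h1 y v
  have e2 := inner_fderiv_riesz h2 v y
  have e3 := fderiv_fderiv_partial_comm (G := H) (a := x) (b := p)
    (hH.contDiff.contDiffAt.of_le (by norm_num)) v y
  rw [e3] at e1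
  exact e1.trans e2.symm

theorem fderiv_Hxp_apply (x p v y : Sp d) :
    fderiv ℝ (fun q => Hxp H x q) p y v = Hxpp H x p v y :=
  fderiv_fderiv_partial_comm (G := Hp H) (a := x) (b := p)
    (hH.contDiff_Hp.contDiffAt.of_le (by norm_num)) v y

theorem inner_Hpp_comm (x p v y : Sp d) :
    inner ℝ (Hpp H x p v) y = inner ℝ v (Hpp H x p y) := by
  have hc : ContDiff ℝ 4 (H x) := hH.contDiff.comp (g := fun z : Sp d × Sp d => H z.1 z.2)
    (f := fun q => (x, q)) (by fun_prop)
  have h1 : DifferentiableAt ℝ (fderiv ℝ (H x)) p :=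
    (hc.contDiffAt.fderiv_right (m := 1) (by norm_num)).differentiableAt (by simp)
  have hs : IsSymmSndFDerivAt ℝ (H x) p := hc.contDiffAt.isSymmSndFDerivAt (by simp; norm_num)
  have e1 := inner_fderiv_riesz h1 y v
  have e2 := inner_fderiv_riesz h1 v y
  rw [hs.eq y v] at e1
  rw [real_inner_comm (Hpp H x p y) v]
  exact e2.trans e1.symm

end HamiltonianAssumptions

end Hamiltonian

/-! ### Derived quantities of a solution -/

section Fields

variable {d : ℕ}

/-- The closed cylinder. -/
def cyl (d : ℕ) (T : ℝ) : Set (Sp d × ℝ) := univ ×ˢ Icc 0 T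

/-- `D_x u` as a space-time field. -/
def grd (u : Sp d → ℝ → ℝ) (z : Sp d × ℝ) : Sp d := spaceGrad u z.1 z.2

/-- `u_t` as a space-time field. -/
def tder (T : ℝ) (u : Sp d → ℝ → ℝ) (z : Sp d × ℝ) : ℝ := derivWithin (u z.1) (Icc 0 T) z.2

/-- `D_p H(x, D_x u)`. -/
def vel (H : Sp d → Sp d → ℝ) (u : Sp d → ℝ → ℝ) (z : Sp d × ℝ) : Sp d := Hp H z.1 (grd u z)

/-- `H(x, D_x u)`. -/
def ham (H : Sp d → Sp d → ℝ) (u : Sp d → ℝ → ℝ) (z : Sp d × ℝ) : ℝ := H z.1 (grd u z)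

/-- `f(x, m)`. -/
def cost (f : Sp d → ℝ → EReal) (m : Sp d → ℝ → ℝ) (z : Sp d × ℝ) : ℝ := val f z.1 (m z.1 z.2)

/-- `div D_p H(x, D_x u)`. -/
def dvg (H : Sp d → Sp d → ℝ) (u : Sp d → ℝ → ℝ) (z : Sp d × ℝ) : ℝ :=
  ∑ i, (fderiv ℝ (vel H u) z (EuclideanSpace.single i 1, 0)) i

theorem interior_cyl (T : ℝ) : interior (cyl d T) = univ ×ˢ Ioo 0 T := by
  rw [cyl, interior_prod_eq, interior_univ, interior_Icc]

theorem uniqueDiffOn_cyl {T : ℝ} (hT : 0 < T) : UniqueDiffOn ℝ (cyl d T) :=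
  uniqueDiffOn_univ.prod (uniqueDiffOn_Icc hT)

theorem cyl_mem_nhds {T : ℝ} {z : Sp d × ℝ} (hz : z.2 ∈ Ioo 0 T) : cyl d T ∈ 𝓝 z :=
  prod_mem_nhds univ_mem (Icc_mem_nhds hz.1 hz.2)

theorem closure_interior_cyl {T : ℝ} (hT : 0 < T) : closure (interior (cyl d T)) = cyl d T := by
  rw [interior_cyl, closure_prod_eq, closure_univ, closure_Ioo hT.ne, cyl]

/-- Both sides are the trace of the spatial block of `L`. This allows divergences to be computed in
an eigenbasis of `D²_pp H`. -/
theorem sum_fderiv_basis {ι : Type} [Fintype ι] (L : Sp d × ℝ →L[ℝ] Sp d)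
    (e : OrthonormalBasis ι ℝ (Sp d)) :
    ∑ i, (L (EuclideanSpace.single i 1, 0)) i = ∑ i, inner ℝ (e i) (L (e i, 0)) := by
  set A : Sp d →ₗ[ℝ] Sp d := (L.comp (ContinuousLinearMap.inl ℝ (Sp d) ℝ)).toLinearMap
  have h1 := LinearMap.trace_eq_sum_inner A e
  have h2 := LinearMap.trace_eq_sum_inner A (EuclideanSpace.basisFun (Fin d) ℝ)
  have h3 := h2.symm.trans h1
  simpa [A, EuclideanSpace.inner_single_left] using h3

theorem fderiv_fderiv_apply {E Y : Type} [NormedAddCommGroup E] [NormedSpace ℝ E]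
    [NormedAddCommGroup Y] [NormedSpace ℝ Y] {φ : E → Y} {c : E → E} {z : E}
    (h : DifferentiableAt ℝ (fderiv ℝ φ) z) (hc : DifferentiableAt ℝ c z) (a : E) :
    fderiv ℝ (fun y => fderiv ℝ φ y (c y)) z a =
      fderiv ℝ (fderiv ℝ φ) z a (c z) + fderiv ℝ φ z (fderiv ℝ c z a) := by
  rw [(h.hasFDerivAt.clm_apply hc.hasFDerivAt).fderiv]
  simp [add_comm]

theorem fderiv_fderiv_const {E Y : Type} [NormedAddCommGroup E] [NormedSpace ℝ E]
    [NormedAddCommGroup Y] [NormedSpace ℝ Y] {φ : E → Y} {z : E}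
    (h : DifferentiableAt ℝ (fderiv ℝ φ) z) (a b : E) :
    fderiv ℝ (fun y => fderiv ℝ φ y b) z a = fderiv ℝ (fderiv ℝ φ) z a b := by
  simpa using fderiv_fderiv_apply h (differentiableAt_const b) a

theorem differentiableAt_fderiv {E Y : Type} [NormedAddCommGroup E] [NormedSpace ℝ E]
    [NormedAddCommGroup Y] [NormedSpace ℝ Y] {φ : E → Y} {z : E} (h : ContDiffAt ℝ 2 φ z) :
    DifferentiableAt ℝ (fderiv ℝ φ) z :=
  (h.fderiv_right (m := 1) (by norm_num)).differentiableAt (by simp)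

end Fields

/-! ### Regularity up to the boundary -/

namespace IsClassicalSolution

variable {d : ℕ} {T : ℝ} {H : Sp d → Sp d → ℝ} {f g : Sp d → ℝ → EReal}
    {m₀ : Sp d → ℝ} {u m : Sp d → ℝ → ℝ} (hs : IsClassicalSolution T H f g m₀ u m)

include hs

theorem contDiffOn_u : ContDiffOn ℝ 3 (fun z : Sp d × ℝ => u z.1 z.2) (cyl d T) := hs.u_contDiffOn

theorem contDiffOn_m : ContDiffOn ℝ 2 (fun z : Sp d × ℝ => m z.1 z.2) (cyl d T) := hs.m_contDiffOn

theorem hasFDerivWithinAt_u {z : Sp d × ℝ} (hz : z ∈ cyl d T) :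
    HasFDerivWithinAt (fun z : Sp d × ℝ => u z.1 z.2)
      (fderivWithin ℝ (fun z : Sp d × ℝ => u z.1 z.2) (cyl d T) z) (cyl d T) z :=
  (hs.contDiffOn_u.differentiableOn (by simp) z hz).hasFDerivWithinAt

theorem inner_grd {z : Sp d × ℝ} (hz : z ∈ cyl d T) (v : Sp d) :
    inner ℝ (grd u z) v = fderivWithin ℝ (fun z : Sp d × ℝ => u z.1 z.2) (cyl d T) z (v, 0) := by
  have h := (hs.hasFDerivWithinAt_u hz).comp (f := fun y => (y, z.2)) (s := univ) z.1
    (hasFDerivAt_prodMk_left z.1 z.2).hasFDerivWithinAt (fun y _ => ⟨mem_univ _, hz.2⟩)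
  have h' := (hasFDerivWithinAt_univ.1 h).fderiv
  rw [grd, spaceGrad, inner_gradient]
  have := congrArg (fun L => L v) h'
  rw [ContinuousLinearMap.comp_apply, ContinuousLinearMap.inl_apply] at this
  exact this

theorem tder_eq (hT : 0 < T) {z : Sp d × ℝ} (hz : z ∈ cyl d T) :
    tder T u z = fderivWithin ℝ (fun z : Sp d × ℝ => u z.1 z.2) (cyl d T) z (0, 1) := by
  have h := (hs.hasFDerivWithinAt_u hz).comp (f := fun s => (z.1, s)) (s := Icc 0 T) z.2
    (hasFDerivAt_prodMk_right z.1 z.2).hasFDerivWithinAt (fun y hy => ⟨mem_univ _, hy⟩)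
  have h' := h.hasDerivWithinAt.derivWithin (uniqueDiffOn_Icc hT _ hz.2)
  exact h'.trans (by simp)

theorem fderivWithin_u (hT : 0 < T) {z : Sp d × ℝ} (hz : z ∈ cyl d T) (a : Sp d × ℝ) :
    fderivWithin ℝ (fun z : Sp d × ℝ => u z.1 z.2) (cyl d T) z a =
      inner ℝ (grd u z) a.1 + tder T u z * a.2 := by
  rw [hs.inner_grd hz, hs.tder_eq hT hz, mul_comm, ← smul_eq_mul, ← map_smul, ← map_add]
  simp

theorem contDiffOn_grd (hT : 0 < T) : ContDiffOn ℝ 2 (grd u) (cyl d T) := by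
  have h := hs.contDiffOn_u.fderivWithin (uniqueDiffOn_cyl hT) (m := 2) (by norm_num)
  have h1 : ContDiffOn ℝ 2 (fun z => riesz d
      ((fderivWithin ℝ (fun z : Sp d × ℝ => u z.1 z.2) (cyl d T) z).comp
        (ContinuousLinearMap.inl ℝ (Sp d) ℝ))) (cyl d T) :=
    (riesz d).contDiff.comp_contDiffOn (h.clm_comp contDiffOn_const)
  refine h1.congr fun z hz => ext_inner_right ℝ fun v => ?_
  rw [inner_riesz, hs.inner_grd hz]
  simp

theorem contDiffOn_tder (hT : 0 < T) : ContDiffOn ℝ 2 (tder T u) (cyl d T) := by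
  have h := hs.contDiffOn_u.fderivWithin (uniqueDiffOn_cyl hT) (m := 2) (by norm_num)
  have h1 : ContDiffOn ℝ 2 (fun z =>
      (fderivWithin ℝ (fun z : Sp d × ℝ => u z.1 z.2) (cyl d T) z) (0, 1)) (cyl d T) :=
    h.clm_apply contDiffOn_const
  exact h1.congr fun z hz => hs.tder_eq hT hz

theorem hasFDerivWithinAt_grd (hT : 0 < T) {z : Sp d × ℝ} (hz : z ∈ cyl d T) :
    HasFDerivWithinAt (grd u) (fderivWithin ℝ (grd u) (cyl d T) z) (cyl d T) z :=
  ((hs.contDiffOn_grd hT).differentiableOn (by simp) z hz).hasFDerivWithinAt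

theorem hasFDerivWithinAt_tder (hT : 0 < T) {z : Sp d × ℝ} (hz : z ∈ cyl d T) :
    HasFDerivWithinAt (tder T u) (fderivWithin ℝ (tder T u) (cyl d T) z) (cyl d T) z :=
  ((hs.contDiffOn_tder hT).differentiableOn (by simp) z hz).hasFDerivWithinAt

/-- The second derivatives of `u` are symmetric. -/
theorem snd_deriv_comm (hT : 0 < T) {z : Sp d × ℝ} (hz : z ∈ cyl d T) (a b : Sp d × ℝ) :
    inner ℝ (fderivWithin ℝ (grd u) (cyl d T) z a) b.1 +
        fderivWithin ℝ (tder T u) (cyl d T) z a * b.2 =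
      inner ℝ (fderivWithin ℝ (grd u) (cyl d T) z b) a.1 +
        fderivWithin ℝ (tder T u) (cyl d T) z b * a.2 := by
  set uu := fun z : Sp d × ℝ => u z.1 z.2
  have hsymm : IsSymmSndFDerivWithinAt ℝ uu (cyl d T) z := by
    refine (hs.contDiffOn_u z hz).isSymmSndFDerivWithinAt (by simp; norm_num)
      (uniqueDiffOn_cyl hT) ?_ hz
    rwa [closure_interior_cyl hT]
  have key : ∀ a b : Sp d × ℝ,
      fderivWithin ℝ (fderivWithin ℝ uu (cyl d T)) (cyl d T) z a b =
      inner ℝ (fderivWithin ℝ (grd u) (cyl d T) z a) b.1 +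
        fderivWithin ℝ (tder T u) (cyl d T) z a * b.2 := fun a b => by
    have hu := uniqueDiffOn_cyl hT z hz
    have h1 := (((hs.contDiffOn_u.fderivWithin (uniqueDiffOn_cyl hT) (m := 2)
      (by norm_num)).differentiableOn (by simp) z hz).hasFDerivWithinAt).clm_apply
        (hasFDerivWithinAt_const b z (cyl d T))
    have h2 := ((hs.hasFDerivWithinAt_grd hT hz).inner ℝ
      (hasFDerivWithinAt_const b.1 z (cyl d T))).add
      ((hs.hasFDerivWithinAt_tder hT hz).mul_const b.2)
    have h3 := h2.congr (fun y hy => hs.fderivWithin_u hT hy b) (hs.fderivWithin_u hT hz b)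
    have := congrArg (fun L => L a) (hu.eq h1 h3)
    simpa [mul_comm, real_inner_comm] using this
  rw [← key, ← key]
  exact hsymm a b

theorem periodic_grd {t : ℝ} (ht : t ∈ Icc 0 T) : Periodic fun x => grd u (x, t) :=
  (hs.u_periodic t ht).gradient

theorem periodic_tder {t : ℝ} (ht : t ∈ Icc 0 T) : Periodic fun x => tder T u (x, t) :=
  fun x i => derivWithin_congr (fun s hs' => hs.u_periodic s hs' x i) (hs.u_periodic t ht x i)

omit hs in
theorem tder_of_mem_Ioo {z : Sp d × ℝ} (hz : z.2 ∈ Ioo 0 T) : tder T u z = deriv (u z.1) z.2 :=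
  derivWithin_of_mem_nhds (Icc_mem_nhds hz.1 hz.2)

theorem contDiffAt_grd {z : Sp d × ℝ} (hz : z.2 ∈ Ioo 0 T) : ContDiffAt ℝ 2 (grd u) z :=
  (hs.contDiffOn_grd (hz.1.trans hz.2)).contDiffAt (cyl_mem_nhds hz)

theorem contDiffAt_tder {z : Sp d × ℝ} (hz : z.2 ∈ Ioo 0 T) : ContDiffAt ℝ 2 (tder T u) z :=
  (hs.contDiffOn_tder (hz.1.trans hz.2)).contDiffAt (cyl_mem_nhds hz)

theorem contDiffAt_m {z : Sp d × ℝ} (hz : z.2 ∈ Ioo 0 T) :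
    ContDiffAt ℝ 2 (fun z : Sp d × ℝ => m z.1 z.2) z :=
  hs.contDiffOn_m.contDiffAt (cyl_mem_nhds hz)

variable {C₀ τ : ℝ} (hH : HamiltonianAssumptions C₀ τ H) (hf : RunningCostAssumptions C₀ τ f)

section

include hH

theorem contDiffOn_ham (hT : 0 < T) : ContDiffOn ℝ 2 (ham H u) (cyl d T) :=
  (hH.contDiff.of_le (by norm_num)).comp_contDiffOn (g := fun z : Sp d × Sp d => H z.1 z.2)
    (f := fun z => (z.1, grd u z)) (contDiffOn_fst.prodMk (hs.contDiffOn_grd hT))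

theorem contDiffOn_vel (hT : 0 < T) : ContDiffOn ℝ 2 (vel H u) (cyl d T) :=
  (hH.contDiff_Hp.of_le (by norm_num)).comp_contDiffOn (g := fun z : Sp d × Sp d => Hp H z.1 z.2)
    (f := fun z => (z.1, grd u z)) (contDiffOn_fst.prodMk (hs.contDiffOn_grd hT))

theorem periodic_ham {t : ℝ} (ht : t ∈ Icc 0 T) : Periodic fun x => ham H u (x, t) := fun x i => by
  have h := hs.periodic_grd ht x i
  simp only [ham] at h ⊢
  rw [h]
  exact hH.periodic _ x i

theorem hasFDerivWithinAt_ham (hT : 0 < T) {z : Sp d × ℝ} (hz : z ∈ cyl d T) :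
    HasFDerivWithinAt (ham H u)
      ((innerSL ℝ (Hx H z.1 (grd u z))).comp (ContinuousLinearMap.fst ℝ (Sp d) ℝ) +
        (innerSL ℝ (vel H u z)).comp (fderivWithin ℝ (grd u) (cyl d T) z)) (cyl d T) z := by
  have h := HasFDerivWithinAt.comp_partial (G := H) (α := Prod.fst) (γ := grd u)
    (hH.contDiff.contDiffAt.differentiableAt (by simp)) hasFDerivWithinAt_fst
    (hs.hasFDerivWithinAt_grd hT hz)
  refine h.congr_fderiv ?_
  ext a <;> simp [vel, Hx, Hp]

end

include hH hf

/-- The density is positive, and the Hamilton-Jacobi equation holds up to the boundary. -/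
theorem cost_eq_of_mem (hT : 0 < T) {z : Sp d × ℝ}
    (hz : z ∈ cyl d T) : 0 < m z.1 z.2 ∧ cost f m z = -tder T u z + ham H u z := by
  have h1 : ContinuousOn (fun z : Sp d × ℝ => f z.1 (m z.1 z.2)) (cyl d T) :=
    hf.isCoupling.continuousOn.comp (g := fun z : Sp d × ℝ => f z.1 z.2)
      (f := fun z : Sp d × ℝ => (z.1, m z.1 z.2))
      (continuousOn_fst.prodMk hs.contDiffOn_m.continuousOn)
      fun z hz => ⟨mem_univ _, hs.m_nonneg z.1 z.2 hz.2⟩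
  have h2 : ContinuousOn (fun z : Sp d × ℝ => ((-tder T u z + ham H u z : ℝ) : EReal))
      (cyl d T) :=
    continuous_coe_real_ereal.comp_continuousOn
      ((hs.contDiffOn_tder hT).continuousOn.neg.add (hs.contDiffOn_ham hH hT).continuousOn)
  -- Both sides are continuous into `EReal` on the closed cylinder, which is the closure of its
  -- interior.
  have h3 : f z.1 (m z.1 z.2) = ((-tder T u z + ham H u z : ℝ) : EReal) := by
    have heq : EqOn (fun z : Sp d × ℝ => f z.1 (m z.1 z.2))
        (fun z : Sp d × ℝ => ((-tder T u z + ham H u z : ℝ) : EReal)) (interior (cyl d T)) := by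
      intro y hy
      rw [interior_cyl] at hy
      have := hs.hamiltonJacobi y.1 y.2 hy.2
      rw [← tder_of_mem_Ioo hy.2] at this
      exact this.symm
    exact heq.of_subset_closure h1 h2 interior_subset (closure_interior_cyl hT).symm.subset hz
  -- At a zero of `m` the left side of `h3` would be `⊥`, while the right side is a real number.
  have hpos : 0 < m z.1 z.2 := by
    refine (hs.m_nonneg z.1 z.2 hz.2).lt_of_ne fun h0 => ?_
    rw [← h0, hf.strictlyElliptic] at h3
    exact EReal.bot_ne_coe _ h3
  refine ⟨hpos, ?_⟩
  rw [← EReal.coe_eq_coe_iff, cost, hf.isCoupling.coe_val hpos, h3]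

theorem hasFDerivWithinAt_cost (hT : 0 < T) {z : Sp d × ℝ} (hz : z ∈ cyl d T) :
    HasFDerivWithinAt (cost f m)
      ((innerSL ℝ (Dx f z.1 (m z.1 z.2))).comp (ContinuousLinearMap.fst ℝ (Sp d) ℝ) +
        Dm f z.1 (m z.1 z.2) •
          fderivWithin ℝ (fun z : Sp d × ℝ => m z.1 z.2) (cyl d T) z) (cyl d T) z := by
  have hpos := (hs.cost_eq_of_mem hH hf hT hz).1
  have h := HasFDerivWithinAt.comp_partial (G := val f) (α := Prod.fst)
    (γ := fun z : Sp d × ℝ => m z.1 z.2)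
    ((hf.isCoupling.contDiffAt_val hpos).differentiableAt (by simp)) hasFDerivWithinAt_fst
    (hs.contDiffOn_m.differentiableOn (by simp) z hz).hasFDerivWithinAt
  refine h.congr_fderiv ?_
  ext a <;> simp [Dx, Dm, mul_comm]

/-- Differentiating the Hamilton-Jacobi equation. -/
theorem fderiv_cost_eq (hT : 0 < T) {z : Sp d × ℝ} (hz : z ∈ cyl d T) (a : Sp d × ℝ) :
    inner ℝ (Dx f z.1 (m z.1 z.2)) a.1 + Dm f z.1 (m z.1 z.2) *
        fderivWithin ℝ (fun z : Sp d × ℝ => m z.1 z.2) (cyl d T) z a =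
      -fderivWithin ℝ (tder T u) (cyl d T) z a + (inner ℝ (Hx H z.1 (grd u z)) a.1 +
        inner ℝ (vel H u z) (fderivWithin ℝ (grd u) (cyl d T) z a)) := by
  have h1 := (hs.hasFDerivWithinAt_tder hT hz).neg.add (hs.hasFDerivWithinAt_ham hH hT hz)
  have h2 := h1.congr (f₁ := cost f m) (fun y hy => (hs.cost_eq_of_mem hH hf hT hy).2)
    (hs.cost_eq_of_mem hH hf hT hz).2
  have := (uniqueDiffOn_cyl hT z hz).eq (hs.hasFDerivWithinAt_cost hH hf hT hz) h2
  simpa using congrArg (fun L => L a) this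

/-- The derivative of `H(x, D_x u)` along the (reversed) characteristics. -/
theorem ham_along (hT : 0 < T) {z : Sp d × ℝ} (hz : z ∈ cyl d T) :
    inner ℝ (Hx H z.1 (grd u z)) (vel H u z) +
        inner ℝ (vel H u z) (fderivWithin ℝ (grd u) (cyl d T) z (vel H u z, -1)) =
      inner ℝ (Dx f z.1 (m z.1 z.2)) (vel H u z) + Dm f z.1 (m z.1 z.2) *
        fderivWithin ℝ (fun z : Sp d × ℝ => m z.1 z.2) (cyl d T) z (vel H u z, 0) := by
  have h1 := hs.fderiv_cost_eq hH hf hT hz (vel H u z, 0)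
  -- The term `b · D_x u_t` of the differentiated equation is, by symmetry, the time part of the
  -- derivative of `D_x u` along `(b,-1)`.
  have h2 := hs.snd_deriv_comm hT hz (0, 1) (vel H u z, 0)
  have h3 : fderivWithin ℝ (grd u) (cyl d T) z (vel H u z, -1) =
      fderivWithin ℝ (grd u) (cyl d T) z (vel H u z, 0) -
        fderivWithin ℝ (grd u) (cyl d T) z (0, 1) := by
    rw [← map_sub]; simp
  rw [h1, h3, inner_sub_right]
  simp only [mul_zero, add_zero, inner_zero_right, mul_one, zero_add] at h2
  rw [real_inner_comm] at h2
  simp only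
  rw [h2]; ring

end IsClassicalSolution

end MFG

end

noncomputable section

namespace MFG

open Set Filter Topology MeasureTheory
open scoped ENNReal

/-! ### Second-order calculus in the interior -/

theorem eventually_mem_Ioo {d : ℕ} {T : ℝ} {z : Sp d × ℝ} (hz : z.2 ∈ Ioo 0 T) :
    ∀ᶠ y : Sp d × ℝ in 𝓝 z, y.2 ∈ Ioo 0 T :=
  continuous_snd.continuousAt.eventually (isOpen_Ioo.mem_nhds hz)

theorem mem_cyl_of_mem_Ioo {d : ℕ} {T : ℝ} {z : Sp d × ℝ} (hz : z.2 ∈ Ioo 0 T) : z ∈ cyl d T :=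
  ⟨mem_univ _, Ioo_subset_Icc_self hz⟩

namespace IsClassicalSolution

variable {d : ℕ} {T : ℝ} {H : Sp d → Sp d → ℝ} {f g : Sp d → ℝ → EReal}
    {m₀ : Sp d → ℝ} {u m : Sp d → ℝ → ℝ} (hs : IsClassicalSolution T H f g m₀ u m)
    {C₀ τ : ℝ} (hH : HamiltonianAssumptions C₀ τ H) (hf : RunningCostAssumptions C₀ τ f)
    {z : Sp d × ℝ} (hz : z.2 ∈ Ioo 0 T)

include hs hz

theorem fderiv_comm (a b : Sp d × ℝ) :
    inner ℝ (fderiv ℝ (grd u) z a) b.1 + fderiv ℝ (tder T u) z a * b.2 =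
      inner ℝ (fderiv ℝ (grd u) z b) a.1 + fderiv ℝ (tder T u) z b * a.2 := by
  have := hs.snd_deriv_comm (hz.1.trans hz.2) (mem_cyl_of_mem_Ioo hz) a b
  simpa only [fderivWithin_of_mem_nhds (cyl_mem_nhds hz)] using this

theorem inner_fderiv_grd_comm (v y : Sp d) :
    inner ℝ (fderiv ℝ (grd u) z (v, 0)) y = inner ℝ (fderiv ℝ (grd u) z (y, 0)) v := by
  simpa using hs.fderiv_comm hz (v, 0) (y, 0)

theorem differentiableAt_grd : DifferentiableAt ℝ (grd u) z :=
  (hs.contDiffAt_grd hz).differentiableAt (by simp)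

theorem differentiableAt_tder : DifferentiableAt ℝ (tder T u) z :=
  (hs.contDiffAt_tder hz).differentiableAt (by simp)

/-- Third derivatives of `u` enter as second derivatives of `grd u` and `tder T u`; their symmetry
is obtained by differentiating `fderiv_comm`. -/
theorem fderiv_fderiv_comm (a b c : Sp d × ℝ) :
    inner ℝ (fderiv ℝ (fderiv ℝ (grd u)) z c a) b.1 + fderiv ℝ (fderiv ℝ (tder T u)) z c a * b.2 =
      inner ℝ (fderiv ℝ (fderiv ℝ (grd u)) z c b) a.1 +
        fderiv ℝ (fderiv ℝ (tder T u)) z c b * a.2 := by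
  have h1 := differentiableAt_fderiv (hs.contDiffAt_grd hz)
  have h2 := differentiableAt_fderiv (hs.contDiffAt_tder hz)
  have key : ∀ a b : Sp d × ℝ, HasFDerivAt
      (fun y => inner ℝ (fderiv ℝ (grd u) y a) b.1 + fderiv ℝ (tder T u) y a * b.2) _ z :=
    fun a b => (((h1.hasFDerivAt.clm_apply (hasFDerivAt_const a z)).inner ℝ
      (hasFDerivAt_const b.1 z)).add
        ((h2.hasFDerivAt.clm_apply (hasFDerivAt_const a z)).mul_const b.2))
  have e := (key b a).congr_of_eventuallyEq (f₁ := fun y => inner ℝ (fderiv ℝ (grd u) y a) b.1 +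
    fderiv ℝ (tder T u) y a * b.2) (by
      filter_upwards [eventually_mem_Ioo hz] with y hy
      exact hs.fderiv_comm hy a b)
  have := congrArg (fun L => L c) ((key a b).unique e)
  simpa [mul_comm, real_inner_comm] using this

theorem fderiv_fderiv_grd_comm (a b : Sp d × ℝ) :
    fderiv ℝ (fderiv ℝ (grd u)) z a b = fderiv ℝ (fderiv ℝ (grd u)) z b a :=
  ((hs.contDiffAt_grd hz).isSymmSndFDerivAt (by simp)).eq a b

theorem fderiv_fderiv_u (a b : Sp d × ℝ) :
    fderiv ℝ (fderiv ℝ (fun z : Sp d × ℝ => u z.1 z.2)) z a b =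
      inner ℝ (fderiv ℝ (grd u) z a) b.1 + fderiv ℝ (tder T u) z a * b.2 := by
  have hT := hz.1.trans hz.2
  have hC : ContDiffAt ℝ 3 (fun z : Sp d × ℝ => u z.1 z.2) z :=
    hs.contDiffOn_u.contDiffAt (cyl_mem_nhds hz)
  rw [← fderiv_fderiv_const (differentiableAt_fderiv (hC.of_le (by norm_num)))]
  have hev : (fun y => fderiv ℝ (fun z : Sp d × ℝ => u z.1 z.2) y b) =ᶠ[𝓝 z]
      fun y => inner ℝ (grd u y) b.1 + tder T u y * b.2 := by
    filter_upwards [eventually_mem_Ioo hz] with y hy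
    rw [← hs.fderivWithin_u hT (mem_cyl_of_mem_Ioo hy), fderivWithin_of_mem_nhds (cyl_mem_nhds hy)]
  have hd := ((hs.differentiableAt_grd hz).hasFDerivAt.inner ℝ
    (hasFDerivAt_const b.1 z)).add ((hs.differentiableAt_tder hz).hasFDerivAt.mul_const b.2)
  rw [hev.fderiv_eq]
  refine (congrArg (fun L => L a) hd.fderiv).trans ?_
  simp [mul_comm, real_inner_comm]

/-- The chain rule along `z ↦ (x, D_x u)`. -/
theorem hasFDerivAt_comp_grd {Y : Type} [NormedAddCommGroup Y] [NormedSpace ℝ Y]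
    {G : Sp d → Sp d → Y} (hG : DifferentiableAt ℝ (fun z : Sp d × Sp d => G z.1 z.2) (z.1, grd u z)) :
    HasFDerivAt (fun z => G z.1 (grd u z))
      ((fderiv ℝ (fun y => G y (grd u z)) z.1).comp (ContinuousLinearMap.fst ℝ (Sp d) ℝ) +
        (fderiv ℝ (G z.1) (grd u z)).comp (fderiv ℝ (grd u) z)) z := by
  have := HasFDerivWithinAt.comp_partial (G := G) (α := Prod.fst) (γ := grd u) (s := univ) hG
    hasFDerivWithinAt_fst (hs.differentiableAt_grd hz).hasFDerivAt.hasFDerivWithinAt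
  exact hasFDerivWithinAt_univ.1 this

section Ham

include hH

theorem contDiffAt_ham : ContDiffAt ℝ 2 (ham H u) z :=
  (hs.contDiffOn_ham hH (hz.1.trans hz.2)).contDiffAt (cyl_mem_nhds hz)

theorem contDiffAt_vel : ContDiffAt ℝ 2 (vel H u) z :=
  (hs.contDiffOn_vel hH (hz.1.trans hz.2)).contDiffAt (cyl_mem_nhds hz)

theorem fderiv_vel (a : Sp d × ℝ) :
    fderiv ℝ (vel H u) z a =
      Hxp H z.1 (grd u z) a.1 + Hpp H z.1 (grd u z) (fderiv ℝ (grd u) z a) := by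
  have h := hs.hasFDerivAt_comp_grd hz (G := Hp H)
    (hH.contDiff_Hp.contDiffAt.differentiableAt (by simp))
  have h' : fderiv ℝ (vel H u) z = _ := h.fderiv
  rw [h']; rfl

theorem fderiv_ham (a : Sp d × ℝ) :
    fderiv ℝ (ham H u) z a =
      inner ℝ (Hx H z.1 (grd u z)) a.1 + inner ℝ (vel H u z) (fderiv ℝ (grd u) z a) := by
  have h := (hs.hasFDerivWithinAt_ham hH (hz.1.trans hz.2) (mem_cyl_of_mem_Ioo hz)).hasFDerivAt
    (cyl_mem_nhds hz)
  rw [h.fderiv, fderivWithin_of_mem_nhds (cyl_mem_nhds hz)]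
  simp

theorem fderiv_fderiv_ham (a b : Sp d × ℝ) :
    fderiv ℝ (fderiv ℝ (ham H u)) z a b =
      inner ℝ (Hxx H z.1 (grd u z) a.1 +
          fderiv ℝ (fun q => Hx H z.1 q) (grd u z) (fderiv ℝ (grd u) z a)) b.1 +
        inner ℝ (fderiv ℝ (vel H u) z a) (fderiv ℝ (grd u) z b) +
        inner ℝ (vel H u z) (fderiv ℝ (fderiv ℝ (grd u)) z a b) := by
  have h2 := differentiableAt_fderiv (hs.contDiffAt_ham hH hz)
  rw [← fderiv_fderiv_const h2]
  have hev : (fun y => fderiv ℝ (ham H u) y b) =ᶠ[𝓝 z] fun y => inner ℝ (Hx H y.1 (grd u y)) b.1 +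
      inner ℝ (vel H u y) (fderiv ℝ (grd u) y b) := by
    filter_upwards [eventually_mem_Ioo hz] with y hy using hs.fderiv_ham hH hy b
  have h3 := hs.hasFDerivAt_comp_grd hz (G := Hx H)
    (hH.contDiff_Hx.contDiffAt.differentiableAt (by simp))
  have h4 := ((hs.contDiffAt_vel hH hz).differentiableAt (by simp)).hasFDerivAt
  have h5 := (differentiableAt_fderiv (hs.contDiffAt_grd hz)).hasFDerivAt.clm_apply
    (hasFDerivAt_const b z)
  rw [hev.fderiv_eq]
  refine (congrArg (fun L => L a)
    ((h3.inner ℝ (hasFDerivAt_const b.1 z)).add (h4.inner ℝ h5)).fderiv).trans ?_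
  simp [Hxx, real_inner_comm]
  ring

theorem fderiv_fderiv_vel (a b : Sp d × ℝ) :
    fderiv ℝ (fderiv ℝ (vel H u)) z a b =
      (Hxxp H z.1 (grd u z) a.1 b.1 + Hxpp H z.1 (grd u z) b.1 (fderiv ℝ (grd u) z a)) +
        (Hxpp H z.1 (grd u z) a.1 (fderiv ℝ (grd u) z b) +
          Hppp H z.1 (grd u z) (fderiv ℝ (grd u) z a) (fderiv ℝ (grd u) z b)) +
        Hpp H z.1 (grd u z) (fderiv ℝ (fderiv ℝ (grd u)) z a b) := by
  have h2 := differentiableAt_fderiv (hs.contDiffAt_vel hH hz)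
  rw [← fderiv_fderiv_const h2]
  have hev : (fun y => fderiv ℝ (vel H u) y b) =ᶠ[𝓝 z] fun y => Hxp H y.1 (grd u y) b.1 +
      Hpp H y.1 (grd u y) (fderiv ℝ (grd u) y b) := by
    filter_upwards [eventually_mem_Ioo hz] with y hy using hs.fderiv_vel hH hy b
  have h3 := hs.hasFDerivAt_comp_grd hz (G := Hxp H)
    (hH.contDiff_Hxp.contDiffAt.differentiableAt (by simp))
  have h4 := hs.hasFDerivAt_comp_grd hz (G := Hpp H)
    (hH.contDiff_Hpp.contDiffAt.differentiableAt (by simp))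
  have h5 := (differentiableAt_fderiv (hs.contDiffAt_grd hz)).hasFDerivAt.clm_apply
    (hasFDerivAt_const b z)
  rw [hev.fderiv_eq]
  refine (congrArg (fun L => L a)
    ((h3.clm_apply (hasFDerivAt_const b.1 z)).add (h4.clm_apply h5)).fderiv).trans ?_
  have e1 := hH.fderiv_Hxp_apply z.1 (grd u z) b.1 (fderiv ℝ (grd u) z a)
  simp only [add_apply, ContinuousLinearMap.comp_apply,
    ContinuousLinearMap.flip_apply, ContinuousLinearMap.coe_fst', zero_apply,
    map_zero, zero_add]
  rw [show fderiv ℝ (Hxp H z.1) (grd u z) = fderiv ℝ (fun q => Hxp H z.1 q) (grd u z) from rfl, e1]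
  simp only [Hxxp, Hxpp, Hppp]
  abel

theorem dvg_eq {ι : Type} [Fintype ι] (e : OrthonormalBasis ι ℝ (Sp d)) :
    dvg H u z = ∑ i, (inner ℝ (e i) (Hxp H z.1 (grd u z) (e i)) +
      inner ℝ (e i) (Hpp H z.1 (grd u z) (fderiv ℝ (grd u) z (e i, 0)))) := by
  rw [dvg, sum_fderiv_basis _ e]
  refine Finset.sum_congr rfl fun i _ => ?_
  rw [hs.fderiv_vel hH hz, inner_add_right]

theorem hasFDerivAt_dvg {ι : Type} [Fintype ι] (e : OrthonormalBasis ι ℝ (Sp d)) :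
    HasFDerivAt (dvg H u) (fderiv ℝ (dvg H u) z) z ∧ ∀ a, fderiv ℝ (dvg H u) z a =
      ∑ i, inner ℝ (e i) (fderiv ℝ (fderiv ℝ (vel H u)) z a (e i, 0)) := by
  have h2 := (differentiableAt_fderiv (hs.contDiffAt_vel hH hz)).hasFDerivAt
  have heq : dvg H u = fun y => ∑ i, inner ℝ (e i) (fderiv ℝ (vel H u) y (e i, 0)) :=
    funext fun y => sum_fderiv_basis _ e
  have h3 : HasFDerivAt (dvg H u) (∑ i, (innerSL ℝ (e i)).comp
      ((ContinuousLinearMap.apply ℝ (Sp d) ((e i, 0) : Sp d × ℝ)).comp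
        (fderiv ℝ (fderiv ℝ (vel H u)) z))) z := by
    rw [heq]
    refine HasFDerivAt.fun_sum fun i _ => ?_
    exact (innerSL ℝ (e i)).hasFDerivAt.comp z
      ((ContinuousLinearMap.apply ℝ (Sp d) ((e i, 0) : Sp d × ℝ)).hasFDerivAt.comp z h2)
  refine ⟨h3.differentiableAt.hasFDerivAt, fun a => ?_⟩
  rw [h3.fderiv]
  simp

end Ham

include hH hf

theorem m_pos : 0 < m z.1 z.2 :=
  (hs.cost_eq_of_mem hH hf (hz.1.trans hz.2) (mem_cyl_of_mem_Ioo hz)).1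

theorem cost_eventuallyEq : cost f m =ᶠ[𝓝 z] fun y => -tder T u y + ham H u y := by
  filter_upwards [eventually_mem_Ioo hz] with y hy
  exact (hs.cost_eq_of_mem hH hf (hy.1.trans hy.2) (mem_cyl_of_mem_Ioo hy)).2

theorem contDiffAt_cost : ContDiffAt ℝ 2 (cost f m) z :=
  ((hs.contDiffAt_tder hz).neg.add (hs.contDiffAt_ham hH hz)).congr_of_eventuallyEq
    (hs.cost_eventuallyEq hH hf hz)

theorem fderiv_cost (a : Sp d × ℝ) :
    fderiv ℝ (cost f m) z a = -fderiv ℝ (tder T u) z a + fderiv ℝ (ham H u) z a := by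
  rw [(hs.cost_eventuallyEq hH hf hz).fderiv_eq, fderiv_fun_add (hs.differentiableAt_tder hz).fun_neg
    ((hs.contDiffAt_ham hH hz).differentiableAt (by simp)), fderiv_fun_neg]
  rfl

theorem fderiv_fderiv_cost (a b : Sp d × ℝ) :
    fderiv ℝ (fderiv ℝ (cost f m)) z a b =
      -fderiv ℝ (fderiv ℝ (tder T u)) z a b + fderiv ℝ (fderiv ℝ (ham H u)) z a b := by
  have h1 := differentiableAt_fderiv (hs.contDiffAt_tder hz)
  have h2 := differentiableAt_fderiv (hs.contDiffAt_ham hH hz)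
  rw [← fderiv_fderiv_const (differentiableAt_fderiv (hs.contDiffAt_cost hH hf hz)),
    ← fderiv_fderiv_const h1, ← fderiv_fderiv_const h2]
  have hev : (fun y => fderiv ℝ (cost f m) y b) =ᶠ[𝓝 z]
      fun y => -fderiv ℝ (tder T u) y b + fderiv ℝ (ham H u) y b := by
    filter_upwards [eventually_mem_Ioo hz] with y hy using hs.fderiv_cost hH hf hy b
  have d1 : DifferentiableAt ℝ (fun y => fderiv ℝ (tder T u) y b) z :=
    h1.clm_apply (differentiableAt_const b)
  have d2 : DifferentiableAt ℝ (fun y => fderiv ℝ (ham H u) y b) z :=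
    h2.clm_apply (differentiableAt_const b)
  rw [hev.fderiv_eq, fderiv_fun_add d1.fun_neg d2, fderiv_fun_neg]
  rfl

omit hH hf in
theorem hasFDerivAt_m : HasFDerivAt (fun z : Sp d × ℝ => m z.1 z.2)
    (fderiv ℝ (fun z : Sp d × ℝ => m z.1 z.2) z) z :=
  ((hs.contDiffAt_m hz).differentiableAt (by simp)).hasFDerivAt

theorem fderiv_cost_eq_Dm (a : Sp d × ℝ) :
    fderiv ℝ (cost f m) z a = inner ℝ (Dx f z.1 (m z.1 z.2)) a.1 +
      Dm f z.1 (m z.1 z.2) * fderiv ℝ (fun z : Sp d × ℝ => m z.1 z.2) z a := by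
  have h := (hs.hasFDerivWithinAt_cost hH hf (hz.1.trans hz.2) (mem_cyl_of_mem_Ioo hz)).hasFDerivAt
    (cyl_mem_nhds hz)
  rw [h.fderiv, fderivWithin_of_mem_nhds (cyl_mem_nhds hz)]
  simp

/-- The continuity equation, as an equation for `f(x,m)` along the characteristics. -/
theorem fderiv_cost_along :
    fderiv ℝ (cost f m) z (vel H u z, -1) = inner ℝ (Dx f z.1 (m z.1 z.2)) (vel H u z) -
      m z.1 z.2 * Dm f z.1 (m z.1 z.2) * dvg H u z := by
  set mm := fun z : Sp d × ℝ => m z.1 z.2 with hmm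
  have hm := hs.hasFDerivAt_m hz
  have hv := ((hs.contDiffAt_vel hH hz).differentiableAt (by simp)).hasFDerivAt
  have h0 := hs.continuity z.1 z.2 hz
  have h1 : deriv (m z.1) z.2 = fderiv ℝ mm z (0, 1) := by
    have := HasFDerivAt.comp (f := fun s => (z.1, s)) (g := mm) z.2 hm
      (hasFDerivAt_prodMk_right z.1 z.2)
    have h' := this.hasDerivAt.deriv
    rw [ContinuousLinearMap.comp_apply, ContinuousLinearMap.inr_apply] at h'
    exact h'
  have h2 : fderiv ℝ (fun y => m y z.2 • Hp H y (spaceGrad u y z.2)) z.1 =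
      (m z.1 z.2 • fderiv ℝ (vel H u) z + (fderiv ℝ mm z).smulRight (vel H u z)).comp
        (ContinuousLinearMap.inl ℝ (Sp d) ℝ) := by
    have := HasFDerivAt.comp (f := fun y => (y, z.2)) (g := fun y => mm y • vel H u y) z.1
      (hm.smul hv) (hasFDerivAt_prodMk_left z.1 z.2)
    exact this.fderiv
  have h3 : divergence (fun y => m y z.2 • Hp H y (spaceGrad u y z.2)) z.1 =
      m z.1 z.2 * dvg H u z + fderiv ℝ mm z (vel H u z, 0) := by
    have h4 : fderiv ℝ mm z (vel H u z, 0) =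
        ∑ i, vel H u z i * fderiv ℝ mm z (EuclideanSpace.single i 1, 0) := by
      have : ((vel H u z, 0) : Sp d × ℝ) =
          ∑ i, vel H u z i • ((EuclideanSpace.single i 1, 0) : Sp d × ℝ) := by
        ext j
        · simp [Prod.fst_sum, Finset.sum_apply, Pi.single_apply]
        · simp [Prod.snd_sum]
      conv_lhs => rw [this]
      simp only [map_sum, map_smul, smul_eq_mul]
    rw [divergence, h4, dvg, Finset.mul_sum, ← Finset.sum_add_distrib]
    refine Finset.sum_congr rfl fun i _ => ?_
    rw [h2]
    simp [mul_comm]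
  rw [hs.fderiv_cost_eq_Dm hH hf hz]
  -- The continuity equation says that the derivative of `m` along `(b,-1)` is `-m div b`; it
  -- remains to multiply by `f_m` and add the explicit `x`-dependence of `f`.
  have h5 : fderiv ℝ mm z (vel H u z, -1) = fderiv ℝ mm z (vel H u z, 0) - fderiv ℝ mm z (0, 1) := by
    rw [← map_sub]; simp
  rw [h1, h3] at h0
  change _ + _ * fderiv ℝ mm z _ = _
  rw [h5, show fderiv ℝ mm z (vel H u z, 0) - fderiv ℝ mm z (0, 1) = -(m z.1 z.2 * dvg H u z) by
    linarith]
  ring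

/-- The second-order equation for `u`. -/
theorem elliptic_eq {ι : Type} [Fintype ι] (e : OrthonormalBasis ι ℝ (Sp d)) :
    (inner ℝ (fderiv ℝ (grd u) z (vel H u z, -1)) (vel H u z) -
        fderiv ℝ (tder T u) z (vel H u z, -1)) +
      m z.1 z.2 * Dm f z.1 (m z.1 z.2) *
        ∑ i, inner ℝ (e i) (Hpp H z.1 (grd u z) (fderiv ℝ (grd u) z (e i, 0))) =
    inner ℝ (Dx f z.1 (m z.1 z.2)) (vel H u z) - inner ℝ (Hx H z.1 (grd u z)) (vel H u z) -
      m z.1 z.2 * Dm f z.1 (m z.1 z.2) * ∑ i, inner ℝ (e i) (Hxp H z.1 (grd u z) (e i)) := by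
  have h1 := hs.fderiv_cost_along hH hf hz
  -- Replacing `f(x,m)` by `-u_t + H` turns its derivative along `(b,-1)` into second derivatives of
  -- `u`; the `H_pp` part of the divergence supplies the spatial ellipticity.
  rw [hs.fderiv_cost hH hf hz, hs.fderiv_ham hH hz, hs.dvg_eq hH hz e,
    Finset.sum_add_distrib] at h1
  rw [real_inner_comm]
  linarith

/-- The equation `fderiv_cost_along`, differentiated. -/
theorem fderiv_fderiv_cost_along (c : Sp d × ℝ) :
    fderiv ℝ (fderiv ℝ (cost f m)) z c (vel H u z, -1) +
        fderiv ℝ (cost f m) z (fderiv ℝ (vel H u) z c, 0) =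
      inner ℝ (Dxx f z.1 (m z.1 z.2) c.1 +
        fderiv ℝ (fun z : Sp d × ℝ => m z.1 z.2) z c • Dxm f z.1 (m z.1 z.2)) (vel H u z) +
      inner ℝ (Dx f z.1 (m z.1 z.2)) (fderiv ℝ (vel H u) z c) -
      (m z.1 z.2 * inner ℝ (Dxm f z.1 (m z.1 z.2)) c.1 +
        (Dm f z.1 (m z.1 z.2) + m z.1 z.2 * deriv (Dm f z.1) (m z.1 z.2)) *
          fderiv ℝ (fun z : Sp d × ℝ => m z.1 z.2) z c) * dvg H u z -
      m z.1 z.2 * Dm f z.1 (m z.1 z.2) * fderiv ℝ (dvg H u) z c := by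
  have hpos := hs.m_pos hH hf hz
  have hm := hs.hasFDerivAt_m hz
  set mm := fun z : Sp d × ℝ => m z.1 z.2 with hmm
  have hv := ((hs.contDiffAt_vel hH hz).differentiableAt (by simp)).hasFDerivAt
  have hfc := hf.isCoupling
  have hX : HasFDerivAt (fun y => ((vel H u y, -1) : Sp d × ℝ))
      ((fderiv ℝ (vel H u) z).prod 0) z := hv.prodMk (hasFDerivAt_const _ z)
  have hl := fderiv_fderiv_apply (differentiableAt_fderiv (hs.contDiffAt_cost hH hf hz))
    hX.differentiableAt c
  rw [hX.fderiv] at hl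
  simp only [ContinuousLinearMap.prod_apply, zero_apply] at hl
  rw [← hl]
  have hev : (fun y => fderiv ℝ (cost f m) y (vel H u y, -1)) =ᶠ[𝓝 z]
      fun y => inner ℝ (Dx f y.1 (mm y)) (vel H u y) - mm y * Dm f y.1 (mm y) * dvg H u y := by
    filter_upwards [eventually_mem_Ioo hz] with y hy using hs.fderiv_cost_along hH hf hy
  have k1 := hasFDerivWithinAt_univ.1 (HasFDerivWithinAt.comp_partial (G := Dx f) (α := Prod.fst)
    (γ := mm) (s := univ) ((hfc.contDiffAt_Dx hpos).differentiableAt (by simp))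
    hasFDerivWithinAt_fst hm.hasFDerivWithinAt)
  have k2 := hasFDerivWithinAt_univ.1 (HasFDerivWithinAt.comp_partial (G := Dm f) (α := Prod.fst)
    (γ := mm) (s := univ) ((hfc.contDiffAt_Dm hpos).differentiableAt (by simp))
    hasFDerivWithinAt_fst hm.hasFDerivWithinAt)
  have k3 := (hs.hasFDerivAt_dvg hH hz (EuclideanSpace.basisFun (Fin d) ℝ)).1
  rw [hev.fderiv_eq]
  refine (congrArg (fun L => L c) ((k1.inner ℝ hv).sub ((hm.mul k2).mul k3)).fderiv).trans ?_
  have e1 : fderiv ℝ (fun y => Dm f y (mm z)) z.1 c.1 = inner ℝ (Dxm f z.1 (mm z)) c.1 :=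
    hfc.fderiv_Dm hpos c.1
  have e2 : fderiv ℝ (Dx f z.1) (mm z) (fderiv ℝ mm z c) =
      fderiv ℝ mm z c • Dxm f z.1 (mm z) := by
    rw [show Dxm f z.1 (mm z) = fderiv ℝ (Dx f z.1) (mm z) 1 from
      fderiv_apply_one_eq_deriv.symm, ← map_smul]
    simp
  have e3 : fderiv ℝ (Dm f z.1) (mm z) (fderiv ℝ mm z c) =
      fderiv ℝ mm z c * deriv (Dm f z.1) (mm z) := by
    rw [← fderiv_apply_one_eq_deriv, ← smul_eq_mul, ← map_smul]; simp
  simp only [sub_apply, add_apply,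
    ContinuousLinearMap.comp_apply, smul_apply, smul_eq_mul,
    ContinuousLinearMap.coe_fst', ContinuousLinearMap.prod_apply, fderivInnerCLM_apply,
    Pi.mul_apply, e1, e2, e3]
  rw [show mm z = m z.1 z.2 from rfl, show (fderiv ℝ (fun y => Dx f y (m z.1 z.2)) z.1) =
    Dxx f z.1 (m z.1 z.2) from rfl]
  ring

/-- The Hessian of `H(x, D_x u)` along the characteristics. -/
theorem fderiv_fderiv_ham_along :
    fderiv ℝ (fderiv ℝ (ham H u)) z (vel H u z, -1) (vel H u z, -1) =
      fderiv ℝ (fderiv ℝ (cost f m)) z (vel H u z, 0) (vel H u z, -1) -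
        inner ℝ (fderiv ℝ (vel H u) z (vel H u z, -1)) (fderiv ℝ (grd u) z (0, 1)) := by
  have hsym := ((hs.contDiffAt_cost hH hf hz).isSymmSndFDerivAt (by simp)).eq
    (vel H u z, 0) (vel H u z, -1)
  rw [hsym, hs.fderiv_fderiv_cost hH hf hz]
  set X : Sp d × ℝ := (vel H u z, -1) with hX
  have e0 : ((vel H u z, 0) : Sp d × ℝ) = X + (0, 1) := by simp [hX]
  have h1 := hs.fderiv_fderiv_ham hH hz X (0, 1)
  -- The third derivatives of `u` in the `(X,(0,1))` entry of the Hessian of `H` are exactly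
  -- `D²u_t(X,(b,0))`, so they cancel against those from `-u_t`.
  have h2 := hs.fderiv_fderiv_comm hz (0, 1) (vel H u z, 0) X
  simp only [inner_zero_right, zero_add, mul_zero, add_zero, mul_one] at h1 h2
  rw [real_inner_comm] at h2
  rw [h2] at h1
  have e1 : fderiv ℝ (fderiv ℝ (ham H u)) z X (vel H u z, 0) =
      fderiv ℝ (fderiv ℝ (ham H u)) z X X + fderiv ℝ (fderiv ℝ (ham H u)) z X (0, 1) := by
    rw [← map_add, ← e0]
  rw [e1, h1]
  ring

end IsClassicalSolution

end MFG

end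

noncomputable section

namespace MFG

open Set Filter Topology MeasureTheory
open scoped ENNReal

/-! ### First and second order conditions -/

section Conditions

variable {d : ℕ}

theorem fderiv_fderiv_add {E : Type} [NormedAddCommGroup E] [NormedSpace ℝ E] {φ ψ : E → ℝ} {z : E}
    (hφ : ContDiffAt ℝ 2 φ z) (hψ : ContDiffAt ℝ 2 ψ z) :
    fderiv ℝ (fderiv ℝ fun y => φ y + ψ y) z =
      fderiv ℝ (fderiv ℝ φ) z + fderiv ℝ (fderiv ℝ ψ) z := by
  have hev : (fderiv ℝ fun y => φ y + ψ y) =ᶠ[𝓝 z] fun y => fderiv ℝ φ y + fderiv ℝ ψ y := by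
    filter_upwards [hφ.eventually (by simp), hψ.eventually (by simp)] with y h1 h2
    exact fderiv_fun_add (h1.differentiableAt (by simp)) (h2.differentiableAt (by simp))
  rw [hev.fderiv_eq]
  exact fderiv_fun_add (differentiableAt_fderiv hφ) (differentiableAt_fderiv hψ)

theorem fderiv_fderiv_const_mul {E : Type} [NormedAddCommGroup E] [NormedSpace ℝ E] {φ : E → ℝ}
    {z : E} (hφ : ContDiffAt ℝ 2 φ z) (c : ℝ) :
    fderiv ℝ (fderiv ℝ fun y => c * φ y) z = c • fderiv ℝ (fderiv ℝ φ) z := by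
  have hev : (fderiv ℝ fun y => c * φ y) =ᶠ[𝓝 z] fun y => c • fderiv ℝ φ y := by
    filter_upwards [hφ.eventually (by simp)] with y h1
    exact fderiv_const_mul (h1.differentiableAt (by simp)) c
  rw [hev.fderiv_eq]
  exact fderiv_fun_const_smul (differentiableAt_fderiv hφ) c

theorem fderiv_time {k : ℝ → ℝ} {k' : ℝ} {z : Sp d × ℝ} (hk : HasDerivAt k k' z.2) (a : Sp d × ℝ) :
    fderiv ℝ (fun z : Sp d × ℝ => k z.2) z a = k' * a.2 := by
  have h := (hk.hasFDerivAt.comp z (hasFDerivAt_snd (𝕜 := ℝ) (E := Sp d) (F := ℝ))).fderiv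
  rw [show (fun z : Sp d × ℝ => k z.2) = k ∘ Prod.snd from rfl, h]
  simp [mul_comm]

theorem fderiv_fderiv_time {k k' : ℝ → ℝ} {k'' : ℝ} {z : Sp d × ℝ}
    (hC : ContDiffAt ℝ 2 k z.2) (hk : ∀ t, HasDerivAt k (k' t) t)
    (hk' : HasDerivAt k' k'' z.2) (a b : Sp d × ℝ) :
    fderiv ℝ (fderiv ℝ fun z : Sp d × ℝ => k z.2) z a b = k'' * a.2 * b.2 := by
  have hC' : ContDiffAt ℝ 2 (fun z : Sp d × ℝ => k z.2) z := hC.comp z contDiffAt_snd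
  rw [← fderiv_fderiv_const (differentiableAt_fderiv hC')]
  have : (fun y : Sp d × ℝ => fderiv ℝ (fun z : Sp d × ℝ => k z.2) y b) =
      fun y => k' y.2 * b.2 := funext fun y => fderiv_time (hk y.2) b
  rw [this, fderiv_time (k := fun t => k' t * b.2) (hk'.mul_const b.2)]
  ring

/-- First and second order conditions at an interior maximum of `σ φ + k(t)`. -/
theorem conditions_of_isLocalMax {φ : Sp d × ℝ → ℝ} {z : Sp d × ℝ} (hφ : ContDiffAt ℝ 2 φ z)
    {k k' : ℝ → ℝ} {k'' σ : ℝ} (hC : ContDiffAt ℝ 2 k z.2) (hk : ∀ t, HasDerivAt k (k' t) t)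
    (hk' : HasDerivAt k' k'' z.2) (hmax : IsLocalMax (fun z => σ * φ z + k z.2) z) :
    (∀ a, σ * fderiv ℝ φ z a + k' z.2 * a.2 = 0) ∧
      ∀ a, σ * fderiv ℝ (fderiv ℝ φ) z a a + k'' * a.2 ^ 2 ≤ 0 := by
  have h1 : ContDiffAt ℝ 2 (fun z => σ * φ z) z := contDiffAt_const.mul hφ
  have h2 : ContDiffAt ℝ 2 (fun z : Sp d × ℝ => k z.2) z := hC.comp z contDiffAt_snd
  constructor
  · intro a
    have h := congrArg (fun L => L a) hmax.fderiv_eq_zero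
    rw [fderiv_fun_add (h1.differentiableAt (by simp)) (h2.differentiableAt (by simp)),
      fderiv_const_mul (hφ.differentiableAt (by simp))] at h
    rw [← fderiv_time (hk z.2)]
    simpa using h
  · intro a
    have h := fderiv_fderiv_nonpos_of_isLocalMax hmax (h1.add h2) a
    rw [fderiv_fderiv_add h1 h2, fderiv_fderiv_const_mul hφ] at h
    have h3 := fderiv_fderiv_time hC hk hk' a a
    simp only [add_apply, smul_apply, smul_eq_mul, h3] at h
    nlinarith

theorem isLocalMax_of_isMaxOn_cyl {T : ℝ} {Φ : Sp d × ℝ → ℝ} {z : Sp d × ℝ}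
    (h : IsMaxOn Φ (cyl d T) z) (hz : z.2 ∈ Ioo 0 T) : IsLocalMax Φ z :=
  h.isLocalMax (cyl_mem_nhds hz)

end Conditions

/-! ### Consequences of the standing assumptions -/

section Data

variable {d : ℕ} {C₀ τ T : ℝ} {H : Sp d → Sp d → ℝ} {f g : Sp d → ℝ → EReal}
    {m₀ : Sp d → ℝ}

/-- In such a basis `tr(D²_pp H A) = ∑ l_i ⟨A e_i, e_i⟩` with positive weights, so one-directional
second-order conditions can be summed. -/
theorem HamiltonianAssumptions.exists_eigenbasis (hH : HamiltonianAssumptions C₀ τ H)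
    (x p : Sp d) : ∃ (e : OrthonormalBasis (Fin d) ℝ (Sp d)) (l : Fin d → ℝ),
      (∀ i, Hpp H x p (e i) = l i • e i) ∧ ∀ i, 1 / C₀ ≤ l i ∧ l i ≤ C₀ := by
  have hsymm : (Hpp H x p : Sp d →ₗ[ℝ] Sp d).IsSymmetric := fun v y => hH.inner_Hpp_comm x p v y
  have hn : Module.finrank ℝ (Sp d) = d := by simp
  have key : ∀ i, Hpp H x p (hsymm.eigenvectorBasis hn i) =
      hsymm.eigenvalues hn i • hsymm.eigenvectorBasis hn i := fun i => by
    exact hsymm.apply_eigenvectorBasis hn i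
  refine ⟨hsymm.eigenvectorBasis hn, hsymm.eigenvalues hn, key, fun i => ?_⟩
  have h := hH.convex x p (hsymm.eigenvectorBasis hn i)
  rw [key i, inner_smul_left, real_inner_self_eq_norm_sq, OrthonormalBasis.norm_eq_one] at h
  simpa using h

theorem HamiltonianAssumptions.norm_Hpp_le (hH : HamiltonianAssumptions C₀ τ H) (hC : 0 < C₀)
    (x p v : Sp d) : ‖Hpp H x p v‖ ≤ C₀ * ‖v‖ := by
  obtain ⟨e, l, he, hl⟩ := hH.exists_eigenbasis x p
  have h1 : ∀ w : Sp d, ‖w‖ ^ 2 = ∑ i, (inner ℝ (e i) w) ^ 2 := fun w => by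
    rw [← e.sum_sq_norm_inner_right w]
    simp
  refine le_of_sq_le_sq ?_ (by positivity)
  rw [mul_pow, h1, h1 v, Finset.mul_sum]
  refine Finset.sum_le_sum fun i _ => ?_
  rw [← hH.inner_Hpp_comm, he, inner_smul_left, mul_pow]
  simp only [conj_trivial]
  have h0 : 0 ≤ 1 / C₀ := by positivity
  have := hl i
  exact mul_le_mul_of_nonneg_right (by nlinarith) (sq_nonneg _)

theorem InitialDensity.mem_Icc (hm : InitialDensity m₀) (x : Sp d) :
    m₀ x ∈ Icc (⨅ x, m₀ x) (⨆ x, m₀ x) := by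
  obtain ⟨B, hB⟩ := exists_bound_cylinder (S := {(0 : ℝ)}) isCompact_singleton
    (Φ := fun z : Sp d × ℝ => m₀ z.1)
    (hm.contDiff.continuous.comp continuous_fst).continuousOn (fun t _ => hm.periodic)
  have h : ∀ y, |m₀ y| ≤ B := fun y => hB (y, 0) ⟨mem_univ _, rfl⟩
  exact ⟨ciInf_le ⟨-B, forall_mem_range.2 fun y => (abs_le.1 (h y)).1⟩ x,
    le_ciSup (f := m₀) ⟨B, forall_mem_range.2 fun y => (abs_le.1 (h y)).2⟩ x⟩

theorem LargeConstant.chi_zero_le (hL : LargeConstant C₀ τ H f m₀) (hC : 0 < C₀) (x : Sp d) :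
    chi f x 0 ≤ C₀ :=
  (le_abs_self _).trans (norm_le_of_c0Norm_le hC.le
    ((le_self_add.trans le_self_add).trans hL.data_le) (mem_univ x))

theorem LargeConstant.norm_fderiv_m₀_le (hL : LargeConstant C₀ τ H f m₀) (hC : 0 < C₀)
    (x : Sp d) : ‖fderiv ℝ m₀ x‖ ≤ C₀ :=
  norm_le_of_c0Norm_le hC.le (((c0Norm_fderiv_le_ckNorm le_rfl univ m₀).trans
    (le_add_self.trans le_self_add)).trans hL.data_le) (mem_univ x)

theorem LargeConstant.abs_val_le (hL : LargeConstant C₀ τ H f m₀) (hC : 0 < C₀)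
    (hm : InitialDensity m₀) (x : Sp d) : |val f x (m₀ x)| ≤ C₀ :=
  norm_le_of_c0Norm_le (φ := fun z : Sp d × ℝ => val f z.1 z.2) (z := (x, m₀ x)) hC.le
    (((c0Norm_le_ckNorm 2 _ _).trans le_add_self).trans hL.data_le)
    ⟨mem_univ _, hm.mem_Icc x⟩

theorem LargeConstant.norm_fderiv_val_le (hL : LargeConstant C₀ τ H f m₀) (hC : 0 < C₀)
    (hm : InitialDensity m₀) (x : Sp d) :
    ‖fderiv ℝ (fun z : Sp d × ℝ => val f z.1 z.2) (x, m₀ x)‖ ≤ C₀ :=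
  norm_le_of_c0Norm_le (z := (x, m₀ x)) hC.le
    (((c0Norm_fderiv_le_ckNorm (by norm_num : 1 ≤ 2) _ _).trans le_add_self).trans hL.data_le)
    ⟨mem_univ _, hm.mem_Icc x⟩

theorem RunningCostAssumptions.chi_le_of_large (hf : RunningCostAssumptions C₀ τ f)
    (hL : LargeConstant C₀ τ H f m₀) (hC : 0 < C₀) {x : Sp d} {m : ℝ} (hm : 0 < m) :
    m * Dm f x m ≤ C₀ * (1 + |val f x m|) := by
  rw [← hf.isCoupling.chi_val hm]
  linarith [hf.chi_le x (val f x m), hL.chi_zero_le hC x]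

end Data

theorem rpow_le_one_add {a θ : ℝ} (ha : 0 ≤ a) (h0 : 0 ≤ θ) (h1 : θ ≤ 1) : a ^ θ ≤ 1 + a := by
  rcases le_total a 1 with h | h
  · linarith [Real.rpow_le_one ha h h0]
  · calc a ^ θ ≤ a ^ (1 : ℝ) := Real.rpow_le_rpow_of_exponent_le h h1
      _ ≤ 1 + a := by rw [Real.rpow_one]; linarith

/-! ### Bounds for `u` and for the terminal density -/

/-- The exponential rate of the barriers. -/
def barrierRate (d : ℕ) (C : ℝ) : ℝ := 2 * ((4 + d) * (1 + C) ^ 4) + 1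

/-- The slope of the barriers at the terminal time. -/
def barrierSlope (d : ℕ) (C T : ℝ) : ℝ := (2 * C + 1) * Real.exp (barrierRate d C * T)

namespace IsClassicalSolution

variable {d : ℕ} {T : ℝ} {H : Sp d → Sp d → ℝ} {f g : Sp d → ℝ → EReal}
    {m₀ : Sp d → ℝ} {u m : Sp d → ℝ → ℝ} (hs : IsClassicalSolution T H f g m₀ u m)
    {C₀ τ : ℝ} (hH : HamiltonianAssumptions C₀ τ H) (hf : RunningCostAssumptions C₀ τ f)
    (hL : LargeConstant C₀ τ H f m₀) (hC : 0 < C₀) (hτ : 0 ≤ τ) (hτ1 : τ < 1)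

/-- The arithmetic of the next estimate, with `G = C₀`, `W = |u_t|` and `n = d`. What matters is
linearity in `W`: this is what an exponential barrier can absorb. -/
theorem critical_estimate {G W χ F n q rhs B X Y P : ℝ} (hG : 0 ≤ G) (hW : 0 ≤ W) (hn : 0 ≤ n)
    (hχ0 : 0 ≤ χ) (hχ : χ ≤ G * (1 + (W + G))) (hF : F ≤ G * (1 + (1 + (W + G)) + (1 + χ)))
    (hB : 0 ≤ B) (hBG : B ≤ G) (hX : X ≤ F * B) (hY : Y ≤ G * B) (hP : P ≤ n * G)
    (hrhs : q = X + Y + χ * P) (hq : rhs ≤ q) :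
    rhs ≤ (4 + n) * (1 + G) ^ 4 * (1 + W) := by
  have h1 : F * B ≤ (G * (1 + (1 + (W + G)) + (1 + χ))) * G := by
    have : 0 ≤ G * (1 + (1 + (W + G)) + (1 + χ)) := by positivity
    nlinarith
  have h2 : χ * P ≤ (G * (1 + (W + G))) * (n * G) := by
    have : 0 ≤ n * G := by positivity
    nlinarith
  have h3 : G * G * χ ≤ G * G * (G * (1 + (W + G))) := mul_le_mul_of_nonneg_left hχ (by positivity)
  have h4 : rhs ≤ G * G * (1 + (1 + (W + G)) + 1) + G * G * (G * (1 + (W + G))) + G * G +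
      G * (1 + (W + G)) * (n * G) := by nlinarith
  refine h4.trans (sub_nonneg.1 ?_)
  ring_nf
  positivity

include hs hH hf hL hC hτ hτ1

/-- Where `D_x u = 0`, `f = -u_t + H(x,0)` is linear in `u_t` up to a constant. The bound on `χ_w`
makes `χ` at most linear in `f`, and the powers in the bound for `D_x f` are at most one. -/
theorem abs_rhs_le_of_grd_eq_zero {z : Sp d × ℝ} (hz : z.2 ∈ Ioo 0 T) (h0 : grd u z = 0)
    (e : OrthonormalBasis (Fin d) ℝ (Sp d)) :
    |inner ℝ (Dx f z.1 (m z.1 z.2)) (vel H u z) - inner ℝ (Hx H z.1 (grd u z)) (vel H u z) -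
      m z.1 z.2 * Dm f z.1 (m z.1 z.2) * ∑ i, inner ℝ (e i) (Hxp H z.1 (grd u z) (e i))| ≤
      (4 + d) * (1 + C₀) ^ 4 * (1 + |tder T u z|) := by
  have hpos := hs.m_pos hH hf hz
  have hcost := (hs.cost_eq_of_mem hH hf (hz.1.trans hz.2) (mem_cyl_of_mem_Ioo hz)).2
  have hham : |ham H u z| ≤ C₀ := by
    have h1 := hL.H_ge z.1 0
    have h2 := hL.H_le z.1 0
    simp only [norm_zero, ne_eq, OfNat.ofNat_ne_zero, not_false_eq_true, zero_pow, mul_zero] at h1 h2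
    rw [ham, h0]
    exact abs_le.2 ⟨by linarith, by linarith⟩
  have hw : |val f z.1 (m z.1 z.2)| ≤ |tder T u z| + C₀ := by
    change |cost f m z| ≤ _
    rw [hcost]
    refine (abs_add_le _ _).trans ?_
    rw [abs_neg]; linarith
  set χ := m z.1 z.2 * Dm f z.1 (m z.1 z.2) with hχ
  have hχ0 : 0 < χ := mul_pos hpos (hf.isCoupling.Dm_pos _ _ hpos)
  have hχ1 : χ ≤ C₀ * (1 + (|tder T u z| + C₀)) :=
    (hf.chi_le_of_large hL hC hpos).trans (by gcongr)
  have hF : ‖Dx f z.1 (m z.1 z.2)‖ ≤ C₀ * (1 + (1 + (|tder T u z| + C₀)) + (1 + χ)) := by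
    refine (hf.Dx_le z.1 _ hpos).trans ?_
    have h1 := rpow_le_one_add (abs_nonneg (val f z.1 (m z.1 z.2))) (θ := τ / 2) (by linarith)
      (by linarith)
    have h2 := rpow_le_one_add (abs_nonneg χ) (θ := (1 + τ) / 2) (by linarith) (by linarith)
    rw [abs_of_pos hχ0] at h2
    rw [← hχ, abs_of_pos hχ0]
    gcongr
    linarith
  have hb : ‖vel H u z‖ ≤ C₀ := by
    have := hL.Hp_le z.1 0
    rw [vel, h0]; simpa using this
  have hHx : ‖Hx H z.1 (grd u z)‖ ≤ C₀ := by
    have := hL.Hx_le z.1 0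
    rw [norm_zero, Real.zero_rpow (by linarith)] at this
    rw [h0]; simpa using this
  have hsum : |∑ i, inner ℝ (e i) (Hxp H z.1 (grd u z) (e i))| ≤ d * C₀ := by
    refine (Finset.abs_sum_le_sum_abs _ _).trans ?_
    have : ∀ i ∈ Finset.univ, |inner ℝ (e i) (Hxp H z.1 (grd u z) (e i))| ≤ C₀ := fun i _ => by
      refine (abs_real_inner_le_norm _ _).trans ?_
      have h1 := (Hxp H z.1 (grd u z)).le_opNorm (e i)
      have h2 := hL.Hxp_le z.1 0
      rw [norm_zero, add_zero, Real.one_rpow, mul_one, ← h0] at h2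
      rw [e.norm_eq_one] at h1 ⊢
      linarith
    simpa using Finset.sum_le_sum this
  refine critical_estimate (G := C₀) (W := |tder T u z|) (χ := χ)
    (F := ‖Dx f z.1 (m z.1 z.2)‖) (B := ‖vel H u z‖)
    (X := |inner ℝ (Dx f z.1 (m z.1 z.2)) (vel H u z)|)
    (Y := |inner ℝ (Hx H z.1 (grd u z)) (vel H u z)|)
    (P := |∑ i, inner ℝ (e i) (Hxp H z.1 (grd u z) (e i))|)
    hC.le (abs_nonneg _) (Nat.cast_nonneg d) hχ0.le hχ1 hF (norm_nonneg _) hb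
    (abs_real_inner_le_norm _ _)
    ((abs_real_inner_le_norm _ _).trans (by gcongr)) hsum rfl ?_
  rw [← abs_of_pos hχ0, ← abs_mul, abs_of_pos hχ0]
  exact (abs_sub _ _).trans (by gcongr; exact abs_sub _ _)

/-- The comparison principle with spatially constant barriers. -/
theorem exists_terminal_max (hT : 0 < T) (hm : InitialDensity m₀) {σ : ℝ} (hσ : σ = 1 ∨ σ = -1) :
    ∃ x₀, σ * cost f m (x₀, T) ≤ barrierSlope d C₀ T + C₀ ∧
      (∀ z ∈ cyl d T, σ * u z.1 z.2 ≤ σ * u x₀ T + barrierSlope d C₀ T) ∧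
      ∀ x, σ * u x T ≤ σ * u x₀ T := by
  set r := barrierRate d C₀ with hr
  -- A maximum at `t = 0` would require `σ u_t ≤ -s₀`, whereas `u_t = H(x,0) - f(x,m₀)` gives `|u_t|
  -- ≤ 2 C₀`.
  set s₀ := 2 * C₀ + 1 with hs₀
  set R := (4 + (d : ℝ)) * (1 + C₀) ^ 4 with hR
  have hR0 : 0 ≤ R := by positivity
  have hr1 : r = 2 * R + 1 := rfl
  have hrpos : 0 < r := by linarith
  have hσ2 : σ * σ = 1 := by rcases hσ with rfl | rfl <;> norm_num
  have hσa : |σ| = 1 := by rcases hσ with rfl | rfl <;> norm_num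
  let k : ℝ → ℝ := fun t => s₀ / r * Real.exp (r * t)
  let k' : ℝ → ℝ := fun t => s₀ * Real.exp (r * t)
  have hexp : ∀ t, HasDerivAt (fun t => Real.exp (r * t)) (r * Real.exp (r * t)) t := fun t => by
    have := ((hasDerivAt_id t).const_mul r).exp
    simpa [mul_comm] using this
  have hk : ∀ t, HasDerivAt k (k' t) t := fun t => by
    refine ((hexp t).const_mul (s₀ / r)).congr_deriv ?_
    simp only [k']; field_simp
  have hk' : ∀ t, HasDerivAt k' (r * k' t) t := fun t => by
    refine ((hexp t).const_mul s₀).congr_deriv ?_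
    simp only [k']; ring
  have hkC : ContDiff ℝ 2 k := by fun_prop
  have hk1 : ∀ t, 0 ≤ t → 1 ≤ k' t := fun t ht => by
    have : 1 ≤ Real.exp (r * t) := Real.one_le_exp (by positivity)
    simp only [k']; nlinarith
  have hkT : k' T = barrierSlope d C₀ T := rfl
  have hham : ∀ z, grd u z = 0 → |ham H u z| ≤ C₀ := fun z h0 => by
    have h1 := hL.H_ge z.1 0
    have h2 := hL.H_le z.1 0
    simp only [norm_zero, ne_eq, OfNat.ofNat_ne_zero, not_false_eq_true, zero_pow, mul_zero] at h1 h2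
    rw [ham, h0]
    exact abs_le.2 ⟨by linarith, by linarith⟩
  obtain ⟨z, hz, hmax⟩ := exists_isMaxOn_cylinder (d := d) isCompact_Icc (nonempty_Icc.2 hT.le)
    (Φ := fun z => σ * u z.1 z.2 + k z.2)
    ((continuousOn_const.mul hs.contDiffOn_u.continuousOn).add
      (hkC.continuous.comp continuous_snd).continuousOn)
    (fun t ht => (hs.u_periodic t ht).comp fun y => σ * y + k t)
  have hzQ : z ∈ cyl d T := ⟨mem_univ _, hz.2⟩
  have hLd := ((hs.hasFDerivWithinAt_u hzQ).const_mul σ).add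
    ((hk z.2).hasFDerivAt.comp z (hasFDerivAt_snd (𝕜 := ℝ) (E := Sp d) (F := ℝ))).hasFDerivWithinAt
  obtain ⟨c1, c2, c3⟩ := first_order_of_isMaxOn hzQ hmax hLd
  simp only [add_apply, smul_apply, hs.fderivWithin_u hT hzQ,
    ContinuousLinearMap.comp_apply, ContinuousLinearMap.coe_snd', inner_zero_right, smul_eq_mul,
    mul_zero, mul_one, add_zero, zero_add, map_zero, ContinuousLinearMap.toSpanSingleton_apply,
    one_mul] at c1 c2 c3
  have h0 : grd u z = 0 := by
    have := c1 (grd u z)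
    rcases hσ with rfl | rfl <;> simpa using this
  obtain ⟨hmpos, hcost⟩ := hs.cost_eq_of_mem hH hf hT hzQ
  have hH0 := abs_le.1 (hham z h0)
  -- the maximum is not attained at the initial time
  have hpos : 0 < z.2 := by
    refine hzQ.2.1.lt_of_ne fun h => ?_
    have h1 := c2 (by rw [← h]; exact hT)
    have h2 := abs_le.1 (hL.abs_val_le hC hm z.1)
    rw [← hs.initial, h] at h2
    change -C₀ ≤ cost f m z ∧ cost f m z ≤ C₀ at h2
    have h3 : k' z.2 = s₀ := by simp [k', ← h]
    rw [h3] at h1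
    rcases hσ with rfl | rfl <;> linarith
  -- nor in the interior
  have hend : z.2 = T := by
    refine le_antisymm hzQ.2.2 (not_lt.1 fun hlt => ?_)
    have hzI : z.2 ∈ Ioo 0 T := ⟨hpos, hlt⟩
    obtain ⟨e, l, he, hl⟩ := hH.exists_eigenbasis z.1 (grd u z)
    obtain ⟨d1, d2⟩ := conditions_of_isLocalMax
      ((hs.contDiffOn_u.contDiffAt (cyl_mem_nhds hzI)).of_le (by norm_num)) hkC.contDiffAt hk
      (hk' z.2) (isLocalMax_of_isMaxOn_cyl hmax hzI)
    have hell := hs.elliptic_eq hH hf hzI e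
    have hrhs := hs.abs_rhs_le_of_grd_eq_zero hH hf hL hC hτ hτ1 hzI h0 e
    rw [← hell] at hrhs
    have htd : |tder T u z| = k' z.2 := by
      have := c3 hpos
      have h2 := c2 hlt
      have h3 : σ * tder T u z = -k' z.2 := by linarith
      have : |σ * tder T u z| = k' z.2 := by
        rw [h3, abs_neg, abs_of_nonneg]; linarith [hk1 z.2 hpos.le]
      rwa [abs_mul, hσa, one_mul] at this
    have hX := d2 (vel H u z, -1)
    rw [hs.fderiv_fderiv_u hzI] at hX
    have hsum : σ * ∑ i, inner ℝ (e i) (Hpp H z.1 (grd u z) (fderiv ℝ (grd u) z (e i, 0))) ≤ 0 := by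
      rw [Finset.mul_sum]
      refine Finset.sum_nonpos fun i _ => ?_
      have := d2 (e i, 0)
      rw [hs.fderiv_fderiv_u hzI] at this
      rw [← hH.inner_Hpp_comm, he, inner_smul_left, conj_trivial, real_inner_comm, ← mul_assoc,
        mul_comm σ, mul_assoc]
      refine mul_nonpos_of_nonneg_of_nonpos ((by positivity : 0 ≤ 1 / C₀).trans (hl i).1) ?_
      simpa using this
    have hχ : 0 < m z.1 z.2 * Dm f z.1 (m z.1 z.2) :=
      mul_pos hmpos (hf.isCoupling.Dm_pos _ _ hmpos)
    rw [htd] at hrhs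
    set S := ∑ i, inner ℝ (e i) (Hpp H z.1 (grd u z) (fderiv ℝ (grd u) z (e i, 0)))
    set A := inner ℝ (fderiv ℝ (grd u) z (vel H u z, -1)) (vel H u z) -
      fderiv ℝ (tder T u) z (vel H u z, -1) with hA
    have e1 : σ * A + r * k' z.2 ≤ 0 := by
      rw [hA]; norm_num at hX; linarith
    have e2 : σ * (A + m z.1 z.2 * Dm f z.1 (m z.1 z.2) * S) ≤ -(r * k' z.2) := by
      have : m z.1 z.2 * Dm f z.1 (m z.1 z.2) * (σ * S) ≤ 0 :=
        mul_nonpos_of_nonneg_of_nonpos hχ.le hsum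
      linarith
    have e3 : -(R * (1 + k' z.2)) ≤ σ * (A + m z.1 z.2 * Dm f z.1 (m z.1 z.2) * S) := by
      have h1 := neg_abs_le (σ * (A + m z.1 z.2 * Dm f z.1 (m z.1 z.2) * S))
      rw [abs_mul, hσa, one_mul] at h1
      linarith
    -- Since `k' ≥ 1`, `R (1 + k') ≤ 2 R k' < r k'`, which contradicts `e2` and `e3`.
    nlinarith [hk1 z.2 hpos.le]
  have hzT : z = (z.1, T) := by rw [← hend]
  refine ⟨z.1, ?_, fun y hy => ?_, fun x => ?_⟩
  -- At `t = T` the one-sided condition reads `-σ u_t ≤ k'(T)`; the Hamilton-Jacobi equation with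
  -- `D_x u = 0` converts it into a bound for `σ f`.
  · have := c3 hpos
    rw [hend, hkT] at this
    rw [← hzT, hcost]
    rcases hσ with rfl | rfl <;> linarith
  · have h1 : σ * u y.1 y.2 + k y.2 ≤ σ * u z.1 z.2 + k z.2 := hmax hy
    rw [hend] at h1
    have h2 : 0 ≤ k y.2 := by positivity
    have h3 : k T ≤ k' T := by
      simp only [k, k']
      refine mul_le_mul_of_nonneg_right (div_le_self (by positivity) (by linarith)) (by positivity)
    linarith
  · have h1 : σ * u x T + k T ≤ σ * u z.1 z.2 + k z.2 :=
      hmax (show (x, T) ∈ univ ×ˢ Icc 0 T from ⟨mem_univ _, hT.le, le_rfl⟩)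
    rw [hend] at h1
    linarith

/-- Bounds for `u` and for the terminal density. -/
theorem value_bounds (hT : 0 < T) (hm : InitialDensity m₀) (hg : TerminalCostAssumptions g)
    {L₁ : ℝ} (hL₁ : barrierSlope d C₀ T + C₀ ≤ L₁) :
    let v := boundParams f g L₁
    0 ≤ v 3 ∧ 0 < v 4 ∧ (∀ z ∈ cyl d T, |u z.1 z.2| ≤ L₁ + v 1 + v 2) ∧
      (∀ x, m x T ≤ v 3) ∧ ∀ x, 0 < m x T ∧ 1 / m x T ≤ v 4 := by
  intro v
  have hfc := hf.isCoupling
  have hgc := hg.isCoupling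
  have hTQ : ∀ x : Sp d, (x, T) ∈ cyl d T := fun x => ⟨mem_univ _, hT.le, le_rfl⟩
  have hmT : ∀ x, 0 < m x T := fun x => (hs.cost_eq_of_mem hH hf hT (hTQ x)).1
  have hgu : ∀ x, val g x (m x T) = u x T := fun x => by
    rw [← EReal.coe_eq_coe_iff, hgc.coe_val (hmT x), hs.terminal]
  obtain ⟨hμ, hμ'⟩ := hf.lowerEnv_inv_spec L₁
  obtain ⟨hν, hν'⟩ := hf.upperEnv_inv_spec (-L₁)
  set μ := inv (lowerEnv f) L₁
  set ν := inv (upperEnv f) (-L₁)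
  obtain ⟨ha, ha'⟩ := hg.lowerEnv_inv_upperEnv_spec hμ
  obtain ⟨hb, hb'⟩ := hg.upperEnv_inv_lowerEnv_spec hν
  set a := upperEnv g μ with ha_def
  set b := lowerEnv g ν with hb_def
  have v1 : v 1 = |a| := rfl
  have v2 : v 2 = |b| := rfl
  have v3 : v 3 = inv (lowerEnv g) a := rfl
  have v4 : v 4 = 1 / inv (upperEnv g) b := rfl
  obtain ⟨x₁, p1, p2, p3⟩ := hs.exists_terminal_max hH hf hL hC hτ hτ1 hT hm (Or.inl rfl)
  obtain ⟨x₂, q1, q2, q3⟩ := hs.exists_terminal_max hH hf hL hC hτ hτ1 hT hm (Or.inr rfl)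
  -- At `x₁`, `f₀(m) ≤ f(x₁,m) ≤ L₁`, so `m` does not exceed `μ` there, and `u = g(x₁,m) ≤ g₁(μ)`.
  have h1 : u x₁ T ≤ a := by
    rw [← hgu]
    refine (hgc.val_le_val (hmT x₁) ?_).trans (hgc.le_upperEnv hμ x₁)
    by_contra! hlt
    have h2 := hfc.lowerEnv_le hμ x₁
    have h3 := hfc.val_lt_val (x := x₁) hμ hlt
    have h4 : cost f m (x₁, T) = val f x₁ (m x₁ T) := rfl
    linarith
  have h2 : b ≤ u x₂ T := by
    rw [← hgu]
    refine (hgc.lowerEnv_le hν x₂).trans (hgc.val_le_val hν ?_)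
    by_contra! hlt
    have h2 := hfc.le_upperEnv hν x₂
    have h3 := hfc.val_lt_val (x := x₂) (hmT x₂) hlt
    have h4 : cost f m (x₂, T) = val f x₂ (m x₂ T) := rfl
    linarith
  refine ⟨v3 ▸ ha.le, by rw [v4]; positivity, fun z hz => ?_, fun x => ?_, fun x => ⟨hmT x, ?_⟩⟩
  · have h3 := p2 z hz
    have h4 := q2 z hz
    rw [v1, v2]
    have := le_abs_self a
    have := neg_abs_le b
    exact abs_le.2 ⟨by linarith [abs_nonneg a], by linarith [abs_nonneg b]⟩
  · rw [v3]
    -- As `x₁` maximises `u(·,T)`, `g₀(m(x,T)) ≤ u(x,T) ≤ a` for every `x`.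
    by_contra! hlt
    have h3 := hgc.val_lt_val (x := x) ha hlt
    have h4 := hgc.lowerEnv_le ha x
    have h5 := p3 x
    rw [hgu] at h3
    linarith
  · rw [v4]
    refine one_div_le_one_div_of_le hb ?_
    by_contra! hlt
    have h3 := hgc.val_lt_val (x := x) (hmT x) hlt
    have h4 := hgc.le_upperEnv hb x
    have h5 := q3 x
    rw [hgu] at h3
    linarith

end IsClassicalSolution

end MFG

end

noncomputable section

namespace MFG

open Set Filter Topology MeasureTheory
open scoped ENNReal

/-! ### The maximum principle for `u_t` -/

theorem IsCoupling.continuousAt_Dxm {d : ℕ} {F : Sp d → ℝ → EReal} (hF : IsCoupling F) {x : Sp d}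
    {m : ℝ} (hm : 0 < m) : ContinuousAt (fun z : Sp d × ℝ => Dxm F z.1 z.2) (x, m) := by
  have h : ContDiffAt ℝ 2 (fun z : Sp d × ℝ => fderiv ℝ (Dx F z.1) z.2) (x, m) := by
    refine ContDiffAt.fderiv (n := 3) (f := fun (z : Sp d × ℝ) r => Dx F z.1 r)
      (g := fun z : Sp d × ℝ => z.2) ?_ contDiffAt_snd (by norm_num)
    exact ContDiffAt.comp (g := fun z : Sp d × ℝ => Dx F z.1 z.2)
      (f := fun z : (Sp d × ℝ) × ℝ => (z.1.1, z.2)) ((x, m), m) (hF.contDiffAt_Dx hm)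
      ((contDiffAt_fst.comp _ contDiffAt_fst).prodMk contDiffAt_snd)
  exact (h.clm_apply (contDiffAt_const (c := (1 : ℝ)))).continuousAt

namespace IsClassicalSolution

variable {d : ℕ} {T : ℝ} {H : Sp d → Sp d → ℝ} {f g : Sp d → ℝ → EReal}
    {m₀ : Sp d → ℝ} {u m : Sp d → ℝ → ℝ} (hs : IsClassicalSolution T H f g m₀ u m)
    {C₀ τ : ℝ} (hH : HamiltonianAssumptions C₀ τ H) (hf : RunningCostAssumptions C₀ τ f)

include hs hH hf

/-- The `m`-derivative of `m f_m`, in terms of `χ`. -/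
theorem deriv_chi_cost {z : Sp d × ℝ} (hz : z.2 ∈ Ioo 0 T) :
    Dm f z.1 (m z.1 z.2) + m z.1 z.2 * deriv (Dm f z.1) (m z.1 z.2) =
      deriv (chi f z.1) (cost f m z) * Dm f z.1 (m z.1 z.2) := by
  have hpos := hs.m_pos hH hf hz
  have h := (hf.isCoupling.hasDerivAt_chi (x := z.1) hpos).deriv
  rw [cost, h, div_mul_cancel₀ _ (hf.isCoupling.Dm_pos _ _ hpos).ne']

/-- The linearized equation solved by `u_t`, at a point where `D_x u_t = 0`. -/
theorem tder_eq_of_critical {z : Sp d × ℝ} (hz : z.2 ∈ Ioo 0 T)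
    (h0 : ∀ v, fderiv ℝ (tder T u) z (v, 0) = 0) {e : OrthonormalBasis (Fin d) ℝ (Sp d)}
    {l : Fin d → ℝ} (he : ∀ i, Hpp H z.1 (grd u z) (e i) = l i • e i) :
    fderiv ℝ (fderiv ℝ (tder T u)) z (vel H u z, -1) (vel H u z, -1) +
        m z.1 z.2 * Dm f z.1 (m z.1 z.2) *
          ∑ i, l i * fderiv ℝ (fderiv ℝ (tder T u)) z (e i, 0) (e i, 0) =
      -fderiv ℝ (tder T u) z (0, 1) * (inner ℝ (Dxm f z.1 (m z.1 z.2)) (vel H u z) /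
        Dm f z.1 (m z.1 z.2) - deriv (chi f z.1) (cost f m z) * dvg H u z) := by
  have hDm := hf.isCoupling.Dm_pos z.1 _ (hs.m_pos hH hf hz)
  -- `D_x u_t = 0` makes the time derivatives of `D_x u` and of `b` vanish, so only the terms with
  -- second derivatives of `u_t` and with `u_tt` survive. None is of zero order in `u_t`.
  have g0 : fderiv ℝ (grd u) z (0, 1) = 0 := ext_inner_right ℝ fun v => by
    have := hs.fderiv_comm hz (0, 1) (v, 0)
    rw [h0] at this
    simpa using this
  have v0 : fderiv ℝ (vel H u) z (0, 1) = 0 := by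
    rw [hs.fderiv_vel hH hz, g0]; simp
  have w0 : Dm f z.1 (m z.1 z.2) * fderiv ℝ (fun z : Sp d × ℝ => m z.1 z.2) z (0, 1) =
      -fderiv ℝ (tder T u) z (0, 1) := by
    have h1 := hs.fderiv_cost_eq_Dm hH hf hz (0, 1)
    rw [hs.fderiv_cost hH hf hz, hs.fderiv_ham hH hz, g0] at h1
    simp only [inner_zero_right, zero_add, add_zero] at h1
    exact h1.symm
  have hd : fderiv ℝ (dvg H u) z (0, 1) =
      ∑ i, l i * fderiv ℝ (fderiv ℝ (tder T u)) z (e i, 0) (e i, 0) := by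
    rw [(hs.hasFDerivAt_dvg hH hz e).2]
    refine Finset.sum_congr rfl fun i _ => ?_
    rw [hs.fderiv_fderiv_vel hH hz, g0]
    have h1 := hs.fderiv_fderiv_comm hz (0, 1) (e i, 0) (e i, 0)
    simp only [inner_zero_right, zero_add, mul_zero, add_zero, mul_one] at h1
    simp only [map_zero, zero_apply, zero_add, add_zero]
    rw [← hH.inner_Hpp_comm, he, inner_smul_left, conj_trivial, hs.fderiv_fderiv_grd_comm hz,
      real_inner_comm, h1]
  have hX : fderiv ℝ (fderiv ℝ (cost f m)) z (0, 1) (vel H u z, -1) =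
      fderiv ℝ (fderiv ℝ (tder T u)) z (vel H u z, -1) (vel H u z, -1) := by
    rw [((hs.contDiffAt_cost hH hf hz).isSymmSndFDerivAt (by simp)).eq,
      hs.fderiv_fderiv_cost hH hf hz, hs.fderiv_fderiv_ham hH hz, g0]
    have h1 := hs.fderiv_fderiv_comm hz (0, 1) (vel H u z, 0) (vel H u z, -1)
    simp only [inner_zero_right, zero_add, mul_zero, add_zero, mul_one] at h1 ⊢
    rw [real_inner_comm, h1, ← map_neg, ← map_add]
    simp
  have hmain := hs.fderiv_fderiv_cost_along hH hf hz (0, 1)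
  rw [hX, v0, hd, hs.deriv_chi_cost hH hf hz] at hmain
  simp only [map_zero, zero_add, inner_zero_right, mul_zero, add_zero, inner_smul_left,
    conj_trivial, Prod.mk_zero_zero] at hmain
  rw [← w0]
  field_simp
  linarith

/-- `± u_t` attains its maximum at the initial or at the terminal time. -/
theorem tder_le_of_boundary (hT : 0 < T) {σ B : ℝ} (hσ : σ = 1 ∨ σ = -1)
    (hB : ∀ x, σ * tder T u (x, 0) ≤ B ∧ σ * tder T u (x, T) ≤ B) {z : Sp d × ℝ}
    (hz : z ∈ cyl d T) : σ * tder T u z ≤ B := by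
  have hmc := hs.contDiffOn_m.continuousOn
  have hvc := hs.contDiffOn_vel hH hT
  have hsub : cube d ×ˢ Icc 0 T ⊆ cyl d T := prod_mono (subset_univ _) subset_rfl
  -- `M₁` and `M₂` depend on the solution. This is harmless: they only enter the rate of a
  -- perturbation that is finally sent to zero.
  obtain ⟨M₁, hM₁⟩ := (isCompact_cube (d := d)).prod (isCompact_Icc (a := 0) (b := T)) |>.exists_bound_of_continuousOn
    (f := fun z => inner ℝ (Dxm f z.1 (m z.1 z.2)) (vel H u z) / Dm f z.1 (m z.1 z.2)) (by
      intro y hy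
      have hpos := (hs.cost_eq_of_mem hH hf hT (hsub hy)).1
      have hc : ContinuousWithinAt (fun y : Sp d × ℝ => (y.1, m y.1 y.2)) (cyl d T) y :=
        continuousWithinAt_fst.prodMk (hmc y (hsub hy))
      have h1 := ContinuousAt.comp_continuousWithinAt (g := fun z : Sp d × ℝ => Dxm f z.1 z.2)
        (f := fun y : Sp d × ℝ => (y.1, m y.1 y.2)) (hf.isCoupling.continuousAt_Dxm hpos) hc
      have h2 := ContinuousAt.comp_continuousWithinAt (g := fun z : Sp d × ℝ => Dm f z.1 z.2)
        (f := fun y : Sp d × ℝ => (y.1, m y.1 y.2)) (hf.isCoupling.contDiffAt_Dm hpos).continuousAt hc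
      exact ((h1.inner (hvc.continuousOn y (hsub hy))).div h2
        (hf.isCoupling.Dm_pos _ _ hpos).ne').mono hsub)
  obtain ⟨M₂, hM₂⟩ := (isCompact_cube (d := d)).prod (isCompact_Icc (a := 0) (b := T)) |>.exists_bound_of_continuousOn
    (f := fun z => ∑ i, (fderivWithin ℝ (vel H u) (cyl d T) z (EuclideanSpace.single i 1, 0)) i)
      (by
        have h1 := hvc.continuousOn_fderivWithin (uniqueDiffOn_cyl hT) (by norm_num)
        refine (continuousOn_finsetSum _ fun i _ => ?_).mono hsub
        exact (EuclideanSpace.proj (𝕜 := ℝ) i).continuous.comp_continuousOn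
          (h1.clm_apply continuousOn_const))
  set M := |M₁| + C₀ * |M₂| + 1 with hM
  have hC0 : 0 ≤ C₀ := (abs_nonneg _).trans (hf.chi_w_le 0 0)
  have hMpos : 0 < M := by positivity
  refine le_of_forall_pos_le_add fun η hη => ?_
  -- The size is chosen so that the perturbation `ε e^{Mt}` is at most `η` on `[0,T]`.
  set ε := η * Real.exp (-(M * T)) with hε
  have hεpos : 0 < ε := by positivity
  let k : ℝ → ℝ := fun t => ε * Real.exp (M * t)
  have hexp : ∀ t, HasDerivAt (fun t => Real.exp (M * t)) (M * Real.exp (M * t)) t := fun t => by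
    have := ((hasDerivAt_id t).const_mul M).exp
    simpa [mul_comm] using this
  have hk : ∀ t, HasDerivAt k (M * k t) t := fun t => by
    refine ((hexp t).const_mul ε).congr_deriv ?_
    simp only [k]; ring
  have hkC : ContDiff ℝ 2 k := by fun_prop
  obtain ⟨y, hy, hmax⟩ := exists_isMaxOn_cylinder (d := d) isCompact_Icc (nonempty_Icc.2 hT.le)
    (Φ := fun z => σ * tder T u z + k z.2)
    ((continuousOn_const.mul (hs.contDiffOn_tder hT).continuousOn).add
      (hkC.continuous.comp continuous_snd).continuousOn)
    (fun t ht => (hs.periodic_tder ht).comp fun y => σ * y + k t)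
  have hkη : k y.2 ≤ η := by
    have h1 : Real.exp (M * y.2) ≤ Real.exp (M * T) :=
      Real.exp_le_exp.2 (mul_le_mul_of_nonneg_left hy.2.2 hMpos.le)
    calc k y.2 ≤ ε * Real.exp (M * T) := mul_le_mul_of_nonneg_left h1 hεpos.le
      _ = η := by rw [hε, mul_assoc, ← Real.exp_add]; simp
  have hle : σ * tder T u z ≤ σ * tder T u y + k y.2 := by
    have h1 : σ * tder T u z + k z.2 ≤ σ * tder T u y + k y.2 := hmax hz
    have h2 : 0 ≤ k z.2 := by positivity
    linarith
  suffices σ * tder T u y ≤ B by linarith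
  rcases eq_or_lt_of_le hy.2.1 with h | hy0
  · have := (hB y.1).1
    rwa [h] at this
  rcases eq_or_lt_of_le hy.2.2 with h | hyT
  · have := (hB y.1).2
    rwa [show (y.1, T) = y from Prod.ext rfl h.symm] at this
  exfalso
  have hyI : y.2 ∈ Ioo 0 T := ⟨hy0, hyT⟩
  obtain ⟨e, l, he, hl⟩ := hH.exists_eigenbasis y.1 (grd u y)
  obtain ⟨d1, d2⟩ := conditions_of_isLocalMax (hs.contDiffAt_tder hyI) hkC.contDiffAt hk
    ((hk y.2).const_mul M) (isLocalMax_of_isMaxOn_cyl hmax hyI)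
  have hσ2 : σ * σ = 1 := by rcases hσ with rfl | rfl <;> norm_num
  have hσ0 : σ ≠ 0 := by rintro rfl; norm_num at hσ2
  have h0 : ∀ v, fderiv ℝ (tder T u) y (v, 0) = 0 := fun v => by
    have := d1 (v, 0)
    simpa [hσ0] using this
  have hmain := hs.tder_eq_of_critical hH hf hyI h0 he
  have hpos := hs.m_pos hH hf hyI
  have hχ : 0 < m y.1 y.2 * Dm f y.1 (m y.1 y.2) := mul_pos hpos (hf.isCoupling.Dm_pos _ _ hpos)
  have hX := d2 (vel H u y, -1)
  have hsum : σ * ∑ i, l i * fderiv ℝ (fderiv ℝ (tder T u)) y (e i, 0) (e i, 0) ≤ 0 := by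
    rw [Finset.mul_sum]
    refine Finset.sum_nonpos fun i _ => ?_
    have := d2 (e i, 0)
    rw [mul_left_comm]
    refine mul_nonpos_of_nonneg_of_nonpos ((by positivity : 0 ≤ 1 / C₀).trans (hl i).1) ?_
    simpa using this
  have ht := d1 (0, 1)
  simp only [mul_one] at ht
  have b1 := hM₁ y ⟨hy.1, hy.2⟩
  have b2 := hM₂ y ⟨hy.1, hy.2⟩
  rw [fderivWithin_of_mem_nhds (cyl_mem_nhds hyI)] at b2
  change ‖dvg H u y‖ ≤ M₂ at b2
  have b3 := hf.chi_w_le y.1 (cost f m y)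
  set c := inner ℝ (Dxm f y.1 (m y.1 y.2)) (vel H u y) / Dm f y.1 (m y.1 y.2) -
    deriv (chi f y.1) (cost f m y) * dvg H u y with hc
  have hcM : -(M - 1) ≤ c := by
    have h1 : |c| ≤ |M₁| + C₀ * |M₂| := by
      refine (abs_sub _ _).trans (add_le_add (b1.trans (le_abs_self _)) ?_)
      rw [abs_mul]
      exact mul_le_mul b3 (b2.trans (le_abs_self _)) (abs_nonneg _) hC0
    have := neg_abs_le c
    linarith
  set S := ∑ i, l i * fderiv ℝ (fderiv ℝ (tder T u)) y (e i, 0) (e i, 0)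
  have hkpos : 0 < k y.2 := by positivity
  have e1 : σ * (-fderiv ℝ (tder T u) y (0, 1) * c) ≤ -(M * (M * k y.2)) := by
    rw [← hmain]
    have : m y.1 y.2 * Dm f y.1 (m y.1 y.2) * (σ * S) ≤ 0 :=
      mul_nonpos_of_nonneg_of_nonpos hχ.le hsum
    norm_num at hX
    linarith
  have e2 : σ * (-fderiv ℝ (tder T u) y (0, 1) * c) = M * k y.2 * c := by
    have : σ * fderiv ℝ (tder T u) y (0, 1) = -(M * k y.2) := by linarith
    linear_combination (-c) * this
  -- The result `M k c ≤ -M² k` is incompatible with `c ≥ -(M - 1)`.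
  rw [e2] at e1
  have e3 : 0 < M * k y.2 := by positivity
  nlinarith

end IsClassicalSolution

end MFG

end

noncomputable section

namespace MFG

open Set Filter Topology MeasureTheory
open scoped ENNReal

/-! ### Bernstein's method: the pointwise estimate -/

section Estimate

/-- Here `s` stands for `‖D_x u_{e_i}‖`. Completing the square in `h s`, the coercive term `(h s)² /
R²` absorbs everything linear in `s`. The remainder has order `y P³`, except for `k² P⁴`, which is
quadratic in the small weight and is absorbed later. -/
theorem summand_estimate {R P y h k s t D ζ : ℝ} (hR : 1 ≤ R) (hy : 1 ≤ y) (hyP : y ≤ P)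
    (hh : 0 ≤ h) (hhP : h ≤ R * P) (hk : 0 ≤ k) (hk1 : k ≤ 1)
    (ht : -(4 * R ^ 2 * (y * P)) - 5 * R ^ 2 * y * s + s ^ 2 / R ^ 2 ≤ t)
    (hζ : |ζ| ≤ R * y + R * s) (hD : |D| ≤ h * (2 * R ^ 3 * (y * P) + R ^ 2 * k * P ^ 2)) :
    -(32 * R ^ 10 * (y * P ^ 3)) - R ^ 8 * k ^ 2 * P ^ 4 / 2 ≤ h ^ 2 * t - D * ζ := by
  have hP : 1 ≤ P := hy.trans hyP
  set E := 2 * R ^ 3 * (y * P) + R ^ 2 * k * P ^ 2 with hE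
  have hE0 : 0 ≤ E := by positivity
  have h1 : D * ζ ≤ h * E * (R * y + R * s) := by
    refine (le_abs_self _).trans ?_
    rw [abs_mul]
    exact mul_le_mul hD hζ (abs_nonneg _) (by positivity)
  have h2 : h ^ 2 * (-(4 * R ^ 2 * (y * P)) - 5 * R ^ 2 * y * s + s ^ 2 / R ^ 2) ≤ h ^ 2 * t :=
    mul_le_mul_of_nonneg_left ht (sq_nonneg h)
  set c := 5 * R ^ 2 * (h * y) + R * E with hc
  have h3 : -(R ^ 2 * c ^ 2 / 4) ≤ (h * s) ^ 2 / R ^ 2 - (h * s) * c := by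
    have : (h * s) ^ 2 / R ^ 2 - (h * s) * c + R ^ 2 * c ^ 2 / 4 = (h * s / R - R * c / 2) ^ 2 := by
      field_simp; ring
    linarith [sq_nonneg (h * s / R - R * c / 2)]
  have hyP2 : y ^ 2 * P ^ 2 ≤ y * P ^ 3 := by
    have : y * (y * P ^ 2) ≤ P * (y * P ^ 2) := mul_le_mul_of_nonneg_right hyP (by positivity)
    linarith
  have h4 : c ≤ 7 * R ^ 4 * (y * P) + R ^ 3 * k * P ^ 2 := by
    have e1 : h * y ≤ R * P * y := mul_le_mul_of_nonneg_right hhP (by positivity)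
    have e2 : 5 * R ^ 2 * (h * y) ≤ 5 * R ^ 2 * (R * P * y) :=
      mul_le_mul_of_nonneg_left e1 (by positivity)
    have e3 : R ^ 3 * (y * P) ≤ R ^ 4 * (y * P) :=
      mul_le_mul_of_nonneg_right (pow_le_pow_right₀ hR (by norm_num)) (by positivity)
    rw [hc, hE]; linarith
  have h5 : c ^ 2 ≤ 98 * R ^ 8 * (y * P ^ 3) + 2 * R ^ 6 * k ^ 2 * P ^ 4 := by
    have hc0 : 0 ≤ c := by positivity
    have e1 : c ^ 2 ≤ (7 * R ^ 4 * (y * P) + R ^ 3 * k * P ^ 2) ^ 2 := pow_le_pow_left₀ hc0 h4 2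
    have e2 := sq_nonneg (7 * R ^ 4 * (y * P) - R ^ 3 * k * P ^ 2)
    have e3 : R ^ 8 * (y ^ 2 * P ^ 2) ≤ R ^ 8 * (y * P ^ 3) :=
      mul_le_mul_of_nonneg_left hyP2 (by positivity)
    linarith
  have h6 : R ^ 2 * c ^ 2 / 4 ≤ 25 * R ^ 10 * (y * P ^ 3) + R ^ 8 * k ^ 2 * P ^ 4 / 2 := by
    have e1 := mul_le_mul_of_nonneg_left h5 (show 0 ≤ R ^ 2 by positivity)
    have e2 : 0 ≤ R ^ 10 * (y * P ^ 3) := by positivity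
    linarith
  have h7 : h ^ 2 * (4 * R ^ 2 * (y * P)) ≤ 4 * R ^ 10 * (y * P ^ 3) := by
    have e1 : h ^ 2 ≤ (R * P) ^ 2 := pow_le_pow_left₀ hh hhP 2
    calc h ^ 2 * (4 * R ^ 2 * (y * P)) ≤ (R * P) ^ 2 * (4 * R ^ 2 * (y * P)) :=
          mul_le_mul_of_nonneg_right e1 (by positivity)
      _ = 4 * R ^ 4 * (y * P ^ 3) := by ring
      _ ≤ 4 * R ^ 10 * (y * P ^ 3) := by gcongr; norm_num
  have h8 : h * E * (R * y) ≤ 3 * R ^ 10 * (y * P ^ 3) := by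
    have e1 : E ≤ 3 * R ^ 3 * P ^ 2 := by
      have a1 : y * P ≤ P ^ 2 := by nlinarith
      have a2 : R ^ 2 * k * P ^ 2 ≤ R ^ 3 * 1 * P ^ 2 := by gcongr; norm_num
      have a3 : 2 * R ^ 3 * (y * P) ≤ 2 * R ^ 3 * P ^ 2 := by gcongr
      rw [hE]; linarith
    calc h * E * (R * y) ≤ (R * P) * (3 * R ^ 3 * P ^ 2) * (R * y) := by gcongr
      _ = 3 * R ^ 5 * (y * P ^ 3) := by ring
      _ ≤ 3 * R ^ 10 * (y * P ^ 3) := by gcongr; norm_num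
  have h9 : h ^ 2 * (-(4 * R ^ 2 * (y * P)) - 5 * R ^ 2 * y * s + s ^ 2 / R ^ 2) -
      h * E * (R * y + R * s) = ((h * s) ^ 2 / R ^ 2 - (h * s) * c) -
        h ^ 2 * (4 * R ^ 2 * (y * P)) - h * E * (R * y) := by
    rw [hc]; ring
  linarith

variable {d : ℕ}

theorem abs_inner_le {v w : Sp d} {a b : ℝ} (hv : ‖v‖ ≤ a) (hw : ‖w‖ ≤ b) :
    |inner ℝ v w| ≤ a * b :=
  (abs_real_inner_le_norm v w).trans (mul_le_mul hv hw (norm_nonneg _) ((norm_nonneg _).trans hv))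

theorem norm_apply_le {Y : Type} [NormedAddCommGroup Y] [NormedSpace ℝ Y] {A : Sp d →L[ℝ] Y}
    {v : Sp d} {a b : ℝ} (hA : ‖A‖ ≤ a) (hv : ‖v‖ ≤ b) : ‖A v‖ ≤ a * b :=
  (A.le_opNorm v).trans (mul_le_mul hA hv (norm_nonneg _) ((norm_nonneg _).trans hA))

-- In the application `P = 1 + |D_xu|`, `y = P^τ`, `h = √χ`, `b = D_pH`, `F = D_xf`, `X = D_xH`, `K
-- = κ ũ`, and `V = -K D_xu` is the spatial gradient of `H(x,D_xu)` at the maximum. Moreover `η` is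
-- the derivative of `ũ` along `(b,-1)`, `G = f_m D_xm · b`, `N = m (D_xf)_m · b` and `S i = D_x
-- u_{e_i}`. The subquadratic oscillation in `x` keeps the terms without `S` at order `y P³`, below
-- the `P⁴` of `η²`; the terms with `S` are left to `summand_estimate`.
set_option maxHeartbeats 2000000 in
theorem bernstein_estimate {R P y h k K χw η G N : ℝ} {b F V X : Sp d}
    {Hxp' Hxx' A Fxx : Sp d →L[ℝ] Sp d} {Hxxp' Hxpp' Hppp' : Sp d →L[ℝ] Sp d →L[ℝ] Sp d}
    {e : OrthonormalBasis (Fin d) ℝ (Sp d)} {l : Fin d → ℝ} {S : Fin d → Sp d} {κ : ℝ}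
    (hR : 1 ≤ R) (hd : (d : ℝ) ≤ R) (hy : 1 ≤ y) (hyP : y ≤ P)
    (hhR : 1 ≤ R * h) (hhP : h ≤ R * P) (hk1 : k ≤ 1) (hK : |K| ≤ k)
    (hb : ‖b‖ ≤ R * P) (hF : ‖F‖ ≤ R * (y * h)) (hV : ‖V‖ ≤ P) (hX : ‖X‖ ≤ R * (y * P))
    (hHxp : ‖Hxp'‖ ≤ R * y) (hHxx : ‖Hxx'‖ ≤ R * (y * P)) (hA : ‖A‖ ≤ R)
    (hFxx : ‖Fxx‖ ≤ R * (y * h)) (hHxxp : ‖Hxxp'‖ ≤ R * y) (hHxpp : ‖Hxpp'‖ ≤ R * (y / P))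
    (hHppp : ‖Hppp'‖ ≤ R * P⁻¹) (hl : ∀ i, 1 / R ≤ l i ∧ l i ≤ R)
    (hAc : ∀ v, 1 / R * ‖v‖ ^ 2 ≤ inner ℝ (A v) v)
    (hχw : |χw| ≤ R) (hχwh : |χw| ≤ R * h) (hη : |η| ≤ R * P ^ 2)
    (hN : |N| ≤ R * (y * h) * (R * P)) (hG : G = -(K * η) - inner ℝ F b)
    (hineq : -inner ℝ (A V) V - inner ℝ V (Hxp' b - A X) + inner ℝ (Fxx b) b + N * G / h ^ 2 +
      inner ℝ F (Hxp' b + A (V - X)) -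
      (N + χw * G) * ∑ i, (inner ℝ (e i) (Hxp' (e i)) + inner ℝ (e i) (A (S i))) +
      h ^ 2 * ∑ i, (-inner ℝ (e i) ((Hxxp' b (e i) + Hxpp' (e i) (V - X)) +
          (Hxpp' b (S i) + Hppp' (V - X) (S i))) +
        l i * (inner ℝ (Hxx' (e i)) (e i) + 2 * inner ℝ (Hxp' (e i)) (S i) +
          inner ℝ (A (S i)) (S i))) + κ * η ^ 2 +
      K * (inner ℝ F b - inner ℝ X b - h ^ 2 * ∑ i, inner ℝ (e i) (Hxp' (e i))) ≤ 0) :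
    κ * η ^ 2 ≤ 48 * R ^ 11 * (y * P ^ 3) + R ^ 9 * k ^ 2 * P ^ 4 / 2 := by
  have hP : 1 ≤ P := hy.trans hyP
  have hP0 : 0 < P := by linarith
  have hR0 : 0 < R := by linarith
  have hk : 0 ≤ k := (abs_nonneg _).trans hK
  have hh : 0 < h := by
    by_contra! hn
    nlinarith
  have hyP1 : P ≤ y * P := by nlinarith
  have he : ∀ i, ‖e i‖ ≤ 1 := fun i => (e.norm_eq_one i).le
  have hVX : ‖V - X‖ ≤ 2 * R * (y * P) := by
    refine (norm_sub_le _ _).trans ?_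
    have : y * P ≤ R * (y * P) := le_mul_of_one_le_left (by positivity) hR
    linarith
  -- `W` is a common unit: every term of `T1` to `T6` is at most a small multiple of it.
  set W := R ^ 11 * (y * P ^ 3) with hW
  have mono : ∀ (a : ℕ) (c : ℝ), a ≤ 11 → c ≤ y * P ^ 3 → R ^ a * c ≤ W := fun a c ha hc => by
    calc R ^ a * c ≤ R ^ a * (y * P ^ 3) := mul_le_mul_of_nonneg_left hc (by positivity)
      _ ≤ W := mul_le_mul_of_nonneg_right (pow_le_pow_right₀ hR ha) (by positivity)
  have m1 : P ^ 2 ≤ y * P ^ 3 := by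
    have : P ^ 2 * 1 ≤ P ^ 2 * (y * P) := by gcongr; nlinarith
    linarith
  have m2 : y * P ^ 2 ≤ y * P ^ 3 := by gcongr; norm_num
  have m3 : y ^ 2 * P ^ 2 ≤ y * P ^ 3 := by
    have : y * (y * P ^ 2) ≤ P * (y * P ^ 2) := mul_le_mul_of_nonneg_right hyP (by positivity)
    linarith
  -- the terms without second derivatives
  have T1 : inner ℝ (A V) V ≤ W := by
    refine (le_abs_self _).trans ((abs_inner_le (norm_apply_le hA hV) hV).trans ?_)
    have := mono 1 _ (by norm_num) m1
    linarith
  have hAX : ‖A X‖ ≤ R * (R * (y * P)) := norm_apply_le hA hX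
  have hHb : ‖Hxp' b‖ ≤ R * y * (R * P) := norm_apply_le hHxp hb
  have T2 : inner ℝ V (Hxp' b - A X) ≤ 2 * W := by
    refine (le_abs_self _).trans ((abs_inner_le hV ((norm_sub_le _ _).trans
      (add_le_add hHb hAX))).trans ?_)
    have := mono 2 _ (by norm_num) m2
    linarith
  have T3 : -W ≤ inner ℝ (Fxx b) b := by
    refine le_trans ?_ (neg_abs_le _)
    have h1 := abs_inner_le (norm_apply_le hFxx hb) hb
    have h2 := mono 4 _ (by norm_num) (le_refl (y * P ^ 3))
    have h3 : R * (y * h) * (R * P) * (R * P) ≤ R * (y * (R * P)) * (R * P) * (R * P) := by gcongr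
    linarith
  have hFb : |inner ℝ F b| ≤ R * (y * h) * (R * P) := abs_inner_le hF hb
  have hKη : |K * η| ≤ k * (R * P ^ 2) := by
    rw [abs_mul]; exact mul_le_mul hK hη (abs_nonneg _) hk
  have hGb : |G| ≤ k * (R * P ^ 2) + R * (y * h) * (R * P) := by
    rw [hG]
    refine (abs_sub _ _).trans ?_
    rw [abs_neg]
    exact add_le_add hKη hFb
  have T4 : -(2 * W) ≤ N * G / h ^ 2 := by
    refine le_trans ?_ (neg_abs_le _)
    rw [neg_le_neg_iff, abs_div, abs_mul, abs_of_pos (by positivity : 0 < h ^ 2),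
      div_le_iff₀ (by positivity)]
    have e1 : |N| * |G| ≤ R * (y * h) * (R * P) * (k * (R * P ^ 2) + R * (y * h) * (R * P)) :=
      mul_le_mul hN hGb (abs_nonneg _) (by positivity)
    -- The part `K η` of `G` carries no factor `h`. The lower bound `1 ≤ R h` supplies one, so the
    -- division by `h²` costs nothing.
    have e2 : k * (R * P ^ 2) ≤ R * h * (R * P ^ 2) :=
      mul_le_mul_of_nonneg_right (hk1.trans hhR) (by positivity)
    have e3 : R * (y * h) * (R * P) * (k * (R * P ^ 2) + R * (y * h) * (R * P)) ≤
        R * (y * h) * (R * P) * (R * h * (R * P ^ 2) + R * (y * h) * (R * P)) := by gcongr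
    have e4 := mono 4 _ (by norm_num) (le_refl (y * P ^ 3))
    have e5 := mono 4 _ (by norm_num) m3
    have e6 : R * (y * h) * (R * P) * (R * h * (R * P ^ 2) + R * (y * h) * (R * P)) =
      (R ^ 4 * (y * P ^ 3) + R ^ 4 * (y ^ 2 * P ^ 2)) * h ^ 2 := by ring
    have e7 : (R ^ 4 * (y * P ^ 3) + R ^ 4 * (y ^ 2 * P ^ 2)) * h ^ 2 ≤ 2 * W * h ^ 2 :=
      mul_le_mul_of_nonneg_right (by linarith) (by positivity)
    linarith
  have T5 : -(3 * W) ≤ inner ℝ F (Hxp' b + A (V - X)) := by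
    refine le_trans ?_ (neg_abs_le _)
    have h1 := abs_inner_le hF ((norm_add_le _ _).trans (add_le_add hHb (norm_apply_le hA hVX)))
    have h2 := mono 4 _ (by norm_num) m3
    have h3 : R * (y * h) * (R * y * (R * P) + R * (2 * R * (y * P))) ≤
      R * (y * (R * P)) * (R * y * (R * P) + R * (2 * R * (y * P))) := by gcongr
    linarith
  have hHe : ∀ i, |inner ℝ (e i) (Hxp' (e i))| ≤ R * y := fun i => by
    simpa using abs_inner_le (he i) (norm_apply_le hHxp (he i))
  have hsumHe : |∑ i, inner ℝ (e i) (Hxp' (e i))| ≤ R * (R * y) := by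
    refine (Finset.abs_sum_le_sum_abs _ _).trans ((Finset.sum_le_sum fun i _ => hHe i).trans ?_)
    simp only [Finset.sum_const, Finset.card_univ, Fintype.card_fin, nsmul_eq_mul]
    gcongr
  have T6 : -(3 * W) ≤ K * (inner ℝ F b - inner ℝ X b -
      h ^ 2 * ∑ i, inner ℝ (e i) (Hxp' (e i))) := by
    refine le_trans ?_ (neg_abs_le _)
    have h1 : |inner ℝ F b - inner ℝ X b - h ^ 2 * ∑ i, inner ℝ (e i) (Hxp' (e i))| ≤
        R * (y * h) * (R * P) + R * (y * P) * (R * P) + h ^ 2 * (R * (R * y)) := by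
      refine (abs_sub _ _).trans (add_le_add ((abs_sub _ _).trans
        (add_le_add hFb (abs_inner_le hX hb))) ?_)
      rw [abs_mul, abs_of_pos (by positivity : 0 < h ^ 2)]
      gcongr
    have h2 : R * (y * h) * (R * P) + R * (y * P) * (R * P) + h ^ 2 * (R * (R * y)) ≤
        R * (y * (R * P)) * (R * P) + R * (y * P) * (R * P) + (R * P) ^ 2 * (R * (R * y)) := by
      gcongr
    have a1 := mono 3 _ (by norm_num) m2
    have a2 := mono 2 _ (by norm_num) m2
    have a3 := mono 4 _ (by norm_num) m2
    have h3 : R * (y * (R * P)) * (R * P) + R * (y * P) * (R * P) + (R * P) ^ 2 * (R * (R * y)) =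
      R ^ 3 * (y * P ^ 2) + R ^ 2 * (y * P ^ 2) + R ^ 4 * (y * P ^ 2) := by ring
    rw [abs_mul, neg_le_neg_iff]
    calc _ ≤ 1 * (3 * W) := mul_le_mul (hK.trans hk1) (by linarith) (abs_nonneg _) zero_le_one
      _ = _ := one_mul _
  -- the terms with second derivatives
  have hD : |N + χw * G| ≤ h * (2 * R ^ 3 * (y * P) + R ^ 2 * k * P ^ 2) := by
    have e1 : |χw * G| ≤ R * h * (k * (R * P ^ 2)) + R * (R * (y * h) * (R * P)) := by
      rw [hG, mul_sub, mul_neg]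
      refine (abs_sub _ _).trans ?_
      rw [abs_neg, abs_mul χw, abs_mul χw]
      exact add_le_add (mul_le_mul hχwh hKη (abs_nonneg _) (by positivity))
        (mul_le_mul hχw hFb (abs_nonneg _) hR0.le)
    have e2 : R ^ 2 * (y * P * h) ≤ R ^ 3 * (y * P * h) :=
      mul_le_mul_of_nonneg_right (pow_le_pow_right₀ hR (by norm_num)) (by positivity)
    refine (abs_add_le _ _).trans ((add_le_add hN e1).trans ?_)
    linarith
  have hsummand : ∀ i ∈ Finset.univ, -(32 * R ^ 10 * (y * P ^ 3)) - R ^ 8 * k ^ 2 * P ^ 4 / 2 ≤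
      h ^ 2 * (-inner ℝ (e i) ((Hxxp' b (e i) + Hxpp' (e i) (V - X)) +
          (Hxpp' b (S i) + Hppp' (V - X) (S i))) +
        l i * (inner ℝ (Hxx' (e i)) (e i) + 2 * inner ℝ (Hxp' (e i)) (S i) +
          inner ℝ (A (S i)) (S i))) -
      (N + χw * G) * (inner ℝ (e i) (Hxp' (e i)) + inner ℝ (e i) (A (S i))) := fun i _ => by
    refine summand_estimate (s := ‖S i‖) hR hy hyP hh.le hhP hk hk1 ?_ ?_ hD
    · have b1 : |inner ℝ (e i) ((Hxxp' b (e i) + Hxpp' (e i) (V - X)) +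
          (Hxpp' b (S i) + Hppp' (V - X) (S i)))| ≤
          1 * ((R * y * (R * P) * 1 + R * (y / P) * 1 * (2 * R * (y * P))) +
            (R * (y / P) * (R * P) * ‖S i‖ + R * P⁻¹ * (2 * R * (y * P)) * ‖S i‖)) := by
        refine abs_inner_le (he i) ((norm_add_le _ _).trans (add_le_add
          ((norm_add_le _ _).trans (add_le_add ?_ ?_)) ((norm_add_le _ _).trans (add_le_add ?_ ?_))))
        · exact norm_apply_le (norm_apply_le hHxxp hb) (he i)
        · exact norm_apply_le (norm_apply_le hHxpp (he i)) hVX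
        · exact norm_apply_le (norm_apply_le hHxpp hb) le_rfl
        · exact norm_apply_le (norm_apply_le hHppp hVX) le_rfl
      have b1' : 1 * ((R * y * (R * P) * 1 + R * (y / P) * 1 * (2 * R * (y * P))) +
            (R * (y / P) * (R * P) * ‖S i‖ + R * P⁻¹ * (2 * R * (y * P)) * ‖S i‖)) =
          R ^ 2 * (y * P) + 2 * R ^ 2 * (y * y) + 3 * R ^ 2 * y * ‖S i‖ := by
        field_simp; ring
      rw [b1'] at b1
      have b2 : R ^ 2 * (y * y) ≤ R ^ 2 * (y * P) := by gcongr
      have b3 : |inner ℝ (Hxx' (e i)) (e i)| ≤ R * (y * P) := by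
        simpa using abs_inner_le (norm_apply_le hHxx (he i)) (he i)
      have b4 : |inner ℝ (Hxp' (e i)) (S i)| ≤ R * y * ‖S i‖ := by
        simpa using abs_inner_le (norm_apply_le hHxp (he i)) (le_refl ‖S i‖)
      have hl0 : 0 < l i := lt_of_lt_of_le (by positivity) (hl i).1
      have c3 : -(R * (R * (y * P))) ≤ l i * inner ℝ (Hxx' (e i)) (e i) := by
        have : |l i * inner ℝ (Hxx' (e i)) (e i)| ≤ R * (R * (y * P)) := by
          rw [abs_mul, abs_of_pos hl0]
          exact mul_le_mul (hl i).2 b3 (abs_nonneg _) hR0.le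
        exact (abs_le.1 this).1
      have c4 : -(R * (R * y * ‖S i‖)) ≤ l i * inner ℝ (Hxp' (e i)) (S i) := by
        have : |l i * inner ℝ (Hxp' (e i)) (S i)| ≤ R * (R * y * ‖S i‖) := by
          rw [abs_mul, abs_of_pos hl0]
          exact mul_le_mul (hl i).2 b4 (abs_nonneg _) hR0.le
        exact (abs_le.1 this).1
      have c5 : ‖S i‖ ^ 2 / R ^ 2 ≤ l i * inner ℝ (A (S i)) (S i) := by
        calc ‖S i‖ ^ 2 / R ^ 2 = 1 / R * (1 / R * ‖S i‖ ^ 2) := by field_simp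
          _ ≤ l i * inner ℝ (A (S i)) (S i) :=
            mul_le_mul (hl i).1 (hAc _) (by positivity) hl0.le
      have := (abs_le.1 b1).2
      linarith
    · refine (abs_add_le _ _).trans (add_le_add (hHe i) ?_)
      simpa using abs_inner_le (he i) (norm_apply_le hA (le_refl ‖S i‖))
  have T7 := Finset.sum_le_sum hsummand
  rw [Finset.sum_const, Finset.card_univ, Fintype.card_fin, nsmul_eq_mul, Finset.sum_sub_distrib,
    ← Finset.mul_sum, ← Finset.mul_sum] at T7
  have T8 : -(32 * W) - R ^ 9 * k ^ 2 * P ^ 4 / 2 ≤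
      d * (-(32 * R ^ 10 * (y * P ^ 3)) - R ^ 8 * k ^ 2 * P ^ 4 / 2) := by
    have : (d : ℝ) * (32 * R ^ 10 * (y * P ^ 3) + R ^ 8 * k ^ 2 * P ^ 4 / 2) ≤
        R * (32 * R ^ 10 * (y * P ^ 3) + R ^ 8 * k ^ 2 * P ^ 4 / 2) :=
      mul_le_mul_of_nonneg_right hd (by positivity)
    rw [hW]; linarith
  have hfin : 48 * R ^ 11 * (y * P ^ 3) = 48 * W := by rw [hW]; ring
  have hW0 : 0 ≤ W := by positivity
  rw [hfin]
  linarith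

end Estimate

end MFG

end

noncomputable section

namespace MFG

open Set Filter Topology MeasureTheory
open scoped ENNReal

/-! ### Bernstein's method: the differential inequality -/

/-- First and second order conditions at an interior maximum of `φ + κ ψ² / 2`. -/
theorem conditions_of_isLocalMax_add_sq {E : Type} [NormedAddCommGroup E] [NormedSpace ℝ E]
    {φ ψ : E → ℝ} {z : E} (hφ : ContDiffAt ℝ 2 φ z) (hψ : ContDiffAt ℝ 2 ψ z) {κ : ℝ}
    (hmax : IsLocalMax (fun y => φ y + κ / 2 * ψ y ^ 2) z) :
    (∀ a, fderiv ℝ φ z a + κ * ψ z * fderiv ℝ ψ z a = 0) ∧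
      ∀ a, fderiv ℝ (fderiv ℝ φ) z a a + κ * fderiv ℝ ψ z a ^ 2 +
        κ * ψ z * fderiv ℝ (fderiv ℝ ψ) z a a ≤ 0 := by
  have h2 : ContDiffAt ℝ 2 (fun y => κ / 2 * ψ y ^ 2) z := contDiffAt_const.mul (hψ.pow 2)
  have hd : ∀ y, DifferentiableAt ℝ ψ y →
      HasFDerivAt (fun y => κ / 2 * ψ y ^ 2) ((κ * ψ y) • fderiv ℝ ψ y) y := fun y hy => by
    refine ((hy.hasFDerivAt.pow 2).const_mul (κ / 2)).congr_fderiv ?_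
    ext a
    simp
    ring
  have hψ1 := hψ.differentiableAt (by simp)
  constructor
  · intro a
    have h := congrArg (fun L => L a) hmax.fderiv_eq_zero
    rw [fderiv_fun_add (hφ.differentiableAt (by simp)) (h2.differentiableAt (by simp)),
      (hd z hψ1).fderiv] at h
    simpa using h
  · intro a
    have h := fderiv_fderiv_nonpos_of_isLocalMax hmax (hφ.add h2) a
    have hev : (fderiv ℝ fun y => κ / 2 * ψ y ^ 2) =ᶠ[𝓝 z] fun y => (κ * ψ y) • fderiv ℝ ψ y := by
      filter_upwards [hψ.eventually (by simp)] with y h1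
      exact (hd y (h1.differentiableAt (by simp))).fderiv
    have h3 : fderiv ℝ (fun y => (κ * ψ y) • fderiv ℝ ψ y) z = _ :=
      ((hψ1.hasFDerivAt.const_mul κ).smul (differentiableAt_fderiv hψ).hasFDerivAt).fderiv
    rw [fderiv_fderiv_add hφ h2, hev.fderiv_eq, h3] at h
    simp at h
    linarith

namespace IsClassicalSolution

variable {d : ℕ} {T : ℝ} {H : Sp d → Sp d → ℝ} {f g : Sp d → ℝ → EReal}
    {m₀ : Sp d → ℝ} {u m : Sp d → ℝ → ℝ} (hs : IsClassicalSolution T H f g m₀ u m)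
    {C₀ τ : ℝ} (hH : HamiltonianAssumptions C₀ τ H) (hf : RunningCostAssumptions C₀ τ f)
    {z : Sp d × ℝ} (hz : z.2 ∈ Ioo 0 T)

include hs hz

theorem affine_time_u {c c' : ℝ} :
    ContDiffAt ℝ 2 (fun y : Sp d × ℝ => u y.1 y.2 + (c * y.2 + c')) z ∧
    (∀ a, fderiv ℝ (fun y : Sp d × ℝ => u y.1 y.2 + (c * y.2 + c')) z a =
      inner ℝ (grd u z) a.1 + (tder T u z + c) * a.2) ∧
    ∀ a b, fderiv ℝ (fderiv ℝ (fun y : Sp d × ℝ => u y.1 y.2 + (c * y.2 + c'))) z a b =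
      inner ℝ (fderiv ℝ (grd u) z a) b.1 + fderiv ℝ (tder T u) z a * b.2 := by
  have hT := hz.1.trans hz.2
  have h1 : ContDiffAt ℝ 2 (fun z : Sp d × ℝ => u z.1 z.2) z :=
    (hs.contDiffOn_u.contDiffAt (cyl_mem_nhds hz)).of_le (by norm_num)
  have hk : ∀ t : ℝ, HasDerivAt (fun t => c * t + c') c t := fun t => by
    simpa using ((hasDerivAt_id t).const_mul c).add_const c'
  have hC : ContDiff ℝ 2 fun t : ℝ => c * t + c' := by fun_prop
  have h2 : ContDiffAt ℝ 2 (fun z : Sp d × ℝ => c * z.2 + c') z :=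
    hC.contDiffAt.comp z contDiffAt_snd
  refine ⟨h1.add h2, fun a => ?_, fun a b => ?_⟩
  · rw [fderiv_fun_add (h1.differentiableAt (by simp)) (h2.differentiableAt (by simp))]
    have e1 := fderiv_time (k := fun t => c * t + c') (hk z.2) a
    have e2 := hs.fderivWithin_u hT (mem_cyl_of_mem_Ioo hz) a
    rw [fderivWithin_of_mem_nhds (cyl_mem_nhds hz)] at e2
    rw [add_apply, e1, e2]
    ring
  · rw [fderiv_fderiv_add h1 h2]
    have e1 := fderiv_fderiv_time (z := z) (k := fun t => c * t + c') (k' := fun _ => c) (k'' := 0)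
      hC.contDiffAt hk (hasDerivAt_const _ _) a b
    rw [add_apply, add_apply, e1, hs.fderiv_fderiv_u hz]
    ring

include hH

/-- The spatial part of the Hessian of `H(x, D_x u)`. -/
theorem fderiv_fderiv_ham_space (v : Sp d) :
    fderiv ℝ (fderiv ℝ (ham H u)) z (v, 0) (v, 0) =
      inner ℝ (Hxx H z.1 (grd u z) v) v +
      2 * inner ℝ (Hxp H z.1 (grd u z) v) (fderiv ℝ (grd u) z (v, 0)) +
      inner ℝ (Hpp H z.1 (grd u z) (fderiv ℝ (grd u) z (v, 0))) (fderiv ℝ (grd u) z (v, 0)) +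
      inner ℝ (vel H u z) (fderiv ℝ (fderiv ℝ (grd u)) z (v, 0) (v, 0)) := by
  rw [hs.fderiv_fderiv_ham hH hz, inner_add_left, hH.inner_fderiv_Hx, hs.fderiv_vel hH hz,
    inner_add_left]
  ring

/-- The third derivatives of `u` cancel. -/
theorem inner_fderiv_fderiv_vel {e : Sp d} {l : ℝ} (he : Hpp H z.1 (grd u z) e = l • e) {y : Sp d}
    (hy : fderiv ℝ (grd u) z (vel H u z, 0) = y) :
    inner ℝ e (fderiv ℝ (fderiv ℝ (vel H u)) z (vel H u z, 0) (e, 0)) =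
      inner ℝ e ((Hxxp H z.1 (grd u z) (vel H u z) e + Hxpp H z.1 (grd u z) e y) +
        (Hxpp H z.1 (grd u z) (vel H u z) (fderiv ℝ (grd u) z (e, 0)) +
          Hppp H z.1 (grd u z) y (fderiv ℝ (grd u) z (e, 0)))) +
      l * inner ℝ (vel H u z) (fderiv ℝ (fderiv ℝ (grd u)) z (e, 0) (e, 0)) := by
  have h1 := hs.fderiv_fderiv_comm hz (e, 0) (vel H u z, 0) (e, 0)
  simp only [mul_zero, add_zero] at h1
  have h2 : inner ℝ e (fderiv ℝ (fderiv ℝ (grd u)) z (e, 0) (vel H u z, 0)) =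
      inner ℝ (vel H u z) (fderiv ℝ (fderiv ℝ (grd u)) z (e, 0) (e, 0)) := by
    rw [real_inner_comm, ← h1, real_inner_comm]
  rw [hs.fderiv_fderiv_vel hH hz, hy, inner_add_right, ← hH.inner_Hpp_comm, he, inner_smul_left,
    hs.fderiv_fderiv_grd_comm hz, h2, conj_trivial]

include hf

/-- The inequality satisfied at an interior point where `H(x, D_x u) + κ ũ² / 2` satisfies the first
and second order conditions of a maximum, with `K = κ ũ`. -/
theorem bernstein_inequality (hC : 0 < C₀) {κ K c η : ℝ} (hκ : 0 ≤ κ)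
    (h1 : ∀ a : Sp d × ℝ, fderiv ℝ (ham H u) z a +
      K * (inner ℝ (grd u z) a.1 + (tder T u z + c) * a.2) = 0)
    (h2 : ∀ a : Sp d × ℝ, fderiv ℝ (fderiv ℝ (ham H u)) z a a +
      κ * (inner ℝ (grd u z) a.1 + (tder T u z + c) * a.2) ^ 2 +
      K * (inner ℝ (fderiv ℝ (grd u) z a) a.1 + fderiv ℝ (tder T u) z a * a.2) ≤ 0)
    {e : OrthonormalBasis (Fin d) ℝ (Sp d)} {l : Fin d → ℝ}
    (he : ∀ i, Hpp H z.1 (grd u z) (e i) = l i • e i) (hl : ∀ i, 0 ≤ l i)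
    (hη : η = inner ℝ (grd u z) (vel H u z) - (tder T u z + c))
    {b F V X : Sp d} (hb : b = vel H u z) (hF : F = Dx f z.1 (m z.1 z.2))
    (hV : V = -(K • grd u z)) (hX : X = Hx H z.1 (grd u z)) {χ N G : ℝ}
    (hχ : χ = m z.1 z.2 * Dm f z.1 (m z.1 z.2))
    (hN : N = m z.1 z.2 * inner ℝ (Dxm f z.1 (m z.1 z.2)) b)
    (hG : G = -(K * η) - inner ℝ F b)
    {S : Fin d → Sp d} (hS : ∀ i, S i = fderiv ℝ (grd u) z (e i, 0)) :
    -inner ℝ (Hpp H z.1 (grd u z) V) V -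
        inner ℝ V (Hxp H z.1 (grd u z) b - Hpp H z.1 (grd u z) X) +
        inner ℝ (Dxx f z.1 (m z.1 z.2) b) b + N * G / χ +
      inner ℝ F (Hxp H z.1 (grd u z) b + Hpp H z.1 (grd u z) (V - X)) -
      (N + deriv (chi f z.1) (cost f m z) * G) *
        ∑ i, (inner ℝ (e i) (Hxp H z.1 (grd u z) (e i)) +
          inner ℝ (e i) (Hpp H z.1 (grd u z) (S i))) +
      χ * ∑ i, (-inner ℝ (e i)
          ((Hxxp H z.1 (grd u z) b (e i) + Hxpp H z.1 (grd u z) (e i) (V - X)) +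
          (Hxpp H z.1 (grd u z) b (S i) + Hppp H z.1 (grd u z) (V - X) (S i))) +
        l i * (inner ℝ (Hxx H z.1 (grd u z) (e i)) (e i) +
          2 * inner ℝ (Hxp H z.1 (grd u z) (e i)) (S i) +
          inner ℝ (Hpp H z.1 (grd u z) (S i)) (S i))) + κ * η ^ 2 +
      K * (inner ℝ F b - inner ℝ X b -
        χ * ∑ i, inner ℝ (e i) (Hxp H z.1 (grd u z) (e i))) ≤ 0 := by
  have hpos := hs.m_pos hH hf hz
  have hDm := hf.isCoupling.Dm_pos z.1 _ hpos
  have hχ0 : 0 < χ := by rw [hχ]; exact mul_pos hpos hDm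
  set r := fderiv ℝ (grd u) z (0, 1) with hr
  -- The spatial first-order condition determines `D²_xx u · b`, leaving `D²_xx u` unknown only
  -- through the `S i`.
  have hSb : fderiv ℝ (grd u) z (vel H u z, 0) = V - X := ext_inner_right ℝ fun v => by
    have e1 := h1 (v, 0)
    rw [hs.fderiv_ham hH hz] at e1
    simp only [mul_zero, add_zero] at e1
    rw [hs.inner_fderiv_grd_comm hz, real_inner_comm, hV, hX, inner_sub_left, inner_neg_left,
      inner_smul_left, conj_trivial]
    linarith
  have hSX : fderiv ℝ (grd u) z (vel H u z, -1) = V - X - r := by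
    rw [← hSb, hr, ← map_sub]; simp
  have hdV : ∀ v, fderiv ℝ (ham H u) z (v, 0) = inner ℝ V v := fun v => by
    have e1 := h1 (v, 0)
    simp only [mul_zero, add_zero] at e1
    rw [hV, inner_neg_left, inner_smul_left, conj_trivial]
    linarith
  have hdq : ∀ v, fderiv ℝ (tder T u) z (v, 0) = inner ℝ r v := fun v => by
    have := hs.fderiv_comm hz (0, 1) (v, 0)
    simpa using this.symm
  have hdw : ∀ v, fderiv ℝ (cost f m) z (v, 0) = inner ℝ (V - r) v := fun v => by
    rw [hs.fderiv_cost hH hf hz, hdV, hdq, inner_sub_left]; ring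
  have hvb : fderiv ℝ (vel H u) z (vel H u z, 0) =
      Hxp H z.1 (grd u z) b + Hpp H z.1 (grd u z) (V - X) := by
    rw [hs.fderiv_vel hH hz, hSb, hb]
  have hvX : fderiv ℝ (vel H u) z (vel H u z, -1) =
      Hxp H z.1 (grd u z) b + Hpp H z.1 (grd u z) (V - X - r) := by
    rw [hs.fderiv_vel hH hz, hSX, hb]
  -- The first-order condition along `(b,-1)` eliminates `u_t`-derivatives from the spatial
  -- derivative of `f(x,m)` and thereby determines `f_m D_xm · b`.
  have hdm : Dm f z.1 (m z.1 z.2) * fderiv ℝ (fun z : Sp d × ℝ => m z.1 z.2) z (vel H u z, 0) =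
      G := by
    have e1 := hs.fderiv_cost_eq_Dm hH hf hz (vel H u z, 0)
    have e2 := h1 (vel H u z, -1)
    have e3 := hs.fderiv_ham hH hz (0, 1)
    have e4 : fderiv ℝ (ham H u) z (vel H u z, -1) =
        fderiv ℝ (ham H u) z (vel H u z, 0) - fderiv ℝ (ham H u) z (0, 1) := by
      rw [← map_sub]; simp
    rw [e4, e3, hdV] at e2
    rw [hdw, inner_sub_left] at e1
    simp only [inner_zero_right, zero_add] at e1 e2
    rw [real_inner_comm _ (vel H u z)] at e2
    rw [hG, hη, hF, hb]
    linarith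
  subst hb hF hχ hN
  set μ := fderiv ℝ (fun z : Sp d × ℝ => m z.1 z.2) z (vel H u z, 0) with hμ
  set B := Hxp H z.1 (grd u z) (vel H u z) + Hpp H z.1 (grd u z) (V - X) with hB
  set χ := m z.1 z.2 * Dm f z.1 (m z.1 z.2) with hχ
  set N := m z.1 z.2 * inner ℝ (Dxm f z.1 (m z.1 z.2)) (vel H u z) with hN
  have hXX : fderiv ℝ (fderiv ℝ (ham H u)) z (vel H u z, -1) (vel H u z, -1) =
      -inner ℝ V B + inner ℝ (Hpp H z.1 (grd u z) r) r +
        inner ℝ (Dxx f z.1 (m z.1 z.2) (vel H u z)) (vel H u z) + N * G / χ +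
        inner ℝ (Dx f z.1 (m z.1 z.2)) B -
        (N + deriv (chi f z.1) (cost f m z) * G) * dvg H u z -
        χ * fderiv ℝ (dvg H u) z (vel H u z, 0) := by
    have e1 := hs.fderiv_fderiv_ham_along hH hf hz
    have e2 := hs.fderiv_fderiv_cost_along hH hf hz (vel H u z, 0)
    rw [hdw, hs.deriv_chi_cost hH hf hz, hvb, inner_add_left (𝕜 := ℝ), inner_smul_left,
      inner_sub_left, conj_trivial] at e2
    have e3 : N * G / χ = μ * inner ℝ (Dxm f z.1 (m z.1 z.2)) (vel H u z) := by
      rw [hχ, hN, ← hdm]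
      field_simp
    have e4 : inner ℝ (Hxp H z.1 (grd u z) (vel H u z) + Hpp H z.1 (grd u z) (V - X - r)) r =
        inner ℝ r B - inner ℝ (Hpp H z.1 (grd u z) r) r := by
      rw [map_sub, ← add_sub_assoc, inner_sub_left, real_inner_comm]
    rw [hvX, e4] at e1
    rw [e1, e3]
    linear_combination e2 - deriv (chi f z.1) (cost f m z) * dvg H u z * hdm
  have hdZ : fderiv ℝ (dvg H u) z (vel H u z, 0) = ∑ i, (inner ℝ (e i)
      ((Hxxp H z.1 (grd u z) (vel H u z) (e i) + Hxpp H z.1 (grd u z) (e i) (V - X)) +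
        (Hxpp H z.1 (grd u z) (vel H u z) (S i) + Hppp H z.1 (grd u z) (V - X) (S i))) +
      l i * inner ℝ (vel H u z) (fderiv ℝ (fderiv ℝ (grd u)) z (e i, 0) (e i, 0))) := by
    rw [(hs.hasFDerivAt_dvg hH hz e).2]
    refine Finset.sum_congr rfl fun i _ => ?_
    rw [hs.inner_fderiv_fderiv_vel hH hz (he i) hSb, hS]
  -- The squares `κ (D_xu · e_i)²` have the favourable sign and are dropped.
  have hsum : ∑ i, l i * (fderiv ℝ (fderiv ℝ (ham H u)) z (e i, 0) (e i, 0) +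
      K * inner ℝ (S i) (e i)) ≤ 0 := by
    refine Finset.sum_nonpos fun i _ => mul_nonpos_of_nonneg_of_nonpos (hl i) ?_
    have := h2 (e i, 0)
    simp only [mul_zero, add_zero] at this
    rw [hS]
    have := mul_nonneg hκ (sq_nonneg (inner ℝ (grd u z) (e i)))
    linarith
  have hsum' : ∑ i, l i * (fderiv ℝ (fderiv ℝ (ham H u)) z (e i, 0) (e i, 0) +
      K * inner ℝ (S i) (e i)) - fderiv ℝ (dvg H u) z (vel H u z, 0) =
      ∑ i, (-inner ℝ (e i)
          ((Hxxp H z.1 (grd u z) (vel H u z) (e i) + Hxpp H z.1 (grd u z) (e i) (V - X)) +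
          (Hxpp H z.1 (grd u z) (vel H u z) (S i) + Hppp H z.1 (grd u z) (V - X) (S i))) +
        l i * (inner ℝ (Hxx H z.1 (grd u z) (e i)) (e i) +
          2 * inner ℝ (Hxp H z.1 (grd u z) (e i)) (S i) +
          inner ℝ (Hpp H z.1 (grd u z) (S i)) (S i))) +
      K * ∑ i, inner ℝ (e i) (Hpp H z.1 (grd u z) (S i)) := by
    rw [hdZ, Finset.mul_sum, ← Finset.sum_sub_distrib, ← Finset.sum_add_distrib]
    refine Finset.sum_congr rfl fun i _ => ?_
    rw [hs.fderiv_fderiv_ham_space hH hz, ← hS, ← hH.inner_Hpp_comm z.1 (grd u z) (e i), he,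
      inner_smul_left, conj_trivial, real_inner_comm (S i) (e i)]
    ring
  -- Multiplied by `K`, the elliptic equation removes the second derivatives of `u` produced by the
  -- Hessian of `ũ`.
  have hell := hs.elliptic_eq hH hf hz e
  have hmain := h2 (vel H u z, -1)
  -- `r = D_x u_t` is not controlled, but enters `hXX` only through this nonnegative term.
  have hr0 : 0 ≤ inner ℝ (Hpp H z.1 (grd u z) r) r :=
    (by positivity : 0 ≤ 1 / C₀ * ‖r‖ ^ 2).trans (hH.convex _ _ _).1
  have hVB : inner ℝ V B = inner ℝ (Hpp H z.1 (grd u z) V) V +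
      inner ℝ V (Hxp H z.1 (grd u z) (vel H u z) - Hpp H z.1 (grd u z) X) := by
    rw [real_inner_comm V, ← inner_add_right, hB, map_sub]
    congr 1
    abel
  rw [hXX, hs.dvg_eq hH hz e] at hmain
  simp only [← hS] at hell hmain
  rw [← hX] at hell
  have hη' : inner ℝ (grd u z) (vel H u z) + (tder T u z + c) * -1 = η := by rw [hη]; ring
  simp only [hη'] at hmain
  have hχsum := mul_nonpos_of_nonneg_of_nonpos hχ0.le hsum
  linear_combination hmain + hχsum + hr0 - χ * hsum' - K * hell + hVB

end IsClassicalSolution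

end MFG

end

noncomputable section

namespace MFG

open Set Filter Topology MeasureTheory
open scoped ENNReal

/-! ### Bernstein's method: the gradient bound -/

section Growth

theorem rpow_le_self_of_one_le {a θ : ℝ} (ha : 1 ≤ a) (h1 : θ ≤ 1) : a ^ θ ≤ a := by
  simpa using Real.rpow_le_rpow_of_exponent_le ha h1

variable {d : ℕ} {C₀ τ R : ℝ} {H : Sp d → Sp d → ℝ} {f : Sp d → ℝ → EReal} {m₀ : Sp d → ℝ}

theorem one_add_rpow_le {a : ℝ} (ha : 0 ≤ a) (hτ : 0 ≤ τ) :
    1 + a ^ (1 + τ) ≤ 2 * ((1 + a) ^ τ * (1 + a)) := by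
  have h1 : (1 + a) ^ τ * (1 + a) = (1 + a) ^ (1 + τ) := by
    rw [add_comm 1 τ, Real.rpow_add (by linarith), Real.rpow_one]
  have h2 : a ^ (1 + τ) ≤ (1 + a) ^ (1 + τ) := Real.rpow_le_rpow ha (by linarith) (by linarith)
  have h3 : 1 ≤ (1 + a) ^ (1 + τ) := Real.one_le_rpow (by linarith) (by linarith)
  rw [h1]; linarith

/-- Bounds for the coupling terms, with `P = 1 + |D_x u|`. -/
theorem RunningCostAssumptions.bounds (hf : RunningCostAssumptions C₀ τ f)
    (hL : LargeConstant C₀ τ H f m₀) (hC : 0 < C₀) (hτ : 0 ≤ τ) (hτ1 : τ < 1) (hR : 1 ≤ R)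
    (hCR : C₀ ≤ R) {P : ℝ} (hP : 1 ≤ P) {x : Sp d} {m : ℝ} (hm : 0 < m)
    (hw : |val f x m| ≤ 3 * R * P ^ 2) (hχ : |1 / chi f x (val f x m)| ≤ R)
    (hh : |deriv (hfun f x) (val f x m)| ≤ R) {h : ℝ} (hh0 : h = √(m * Dm f x m)) :
    h ^ 2 = m * Dm f x m ∧ 1 ≤ R * h ∧ h ≤ 2 * R * P ∧
    ‖Dx f x m‖ ≤ 6 * R ^ 3 * (P ^ τ * h) ∧ ‖Dxx f x m‖ ≤ 6 * R ^ 3 * (P ^ τ * h) ∧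
    |deriv (chi f x) (val f x m)| ≤ 2 * R * h := by
  have hDm := hf.isCoupling.Dm_pos x m hm
  have hχ0 : 0 < m * Dm f x m := mul_pos hm hDm
  have hh2 : h ^ 2 = m * Dm f x m := by rw [hh0, Real.sq_sqrt hχ0.le]
  have hhpos : 0 < h := by rw [hh0]; exact Real.sqrt_pos.2 hχ0
  have hy1 : 1 ≤ P ^ τ := Real.one_le_rpow hP hτ
  rw [hf.isCoupling.chi_val hm] at hχ
  have e1 : 1 ≤ R * h := by
    rw [abs_of_pos (by positivity), div_le_iff₀ hχ0, ← hh2] at hχ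
    by_contra! hn
    nlinarith
  have e2 : h ≤ 2 * R * P := by
    have h1 := hf.chi_le_of_large hL hC hm (x := x)
    refine le_of_sq_le_sq ?_ (by positivity)
    rw [hh2]
    have h2 : C₀ * (1 + |val f x m|) ≤ R * (1 + 3 * R * P ^ 2) :=
      mul_le_mul hCR (by linarith) (by positivity) (by linarith)
    have h3 : R * 1 ≤ R * (R * P ^ 2) := by
      have : 1 * 1 ≤ R * P ^ 2 := mul_le_mul hR (one_le_pow₀ hP) zero_le_one (by linarith)
      exact mul_le_mul_of_nonneg_left (by linarith) (by linarith)
    linarith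
  have e3 : |val f x m| ^ (τ / 2) ≤ 3 * R * P ^ τ := by
    calc |val f x m| ^ (τ / 2) ≤ (3 * R * P ^ 2) ^ (τ / 2) :=
          Real.rpow_le_rpow (abs_nonneg _) hw (by linarith)
      _ = (3 * R) ^ (τ / 2) * P ^ τ := by
          rw [Real.mul_rpow (by linarith) (by positivity), ← Real.rpow_two, ← Real.rpow_mul
            (by linarith)]
          congr 2; ring
      _ ≤ 3 * R * P ^ τ := mul_le_mul_of_nonneg_right
          (rpow_le_self_of_one_le (by linarith) (by linarith)) (by linarith)
  -- With `m f_m = h²` the power equals `h · h^τ`. Exactly one factor `h` is kept, and `h ≤ 2 R P`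
  -- turns the other into `P^τ`.
  have e4 : |m * Dm f x m| ^ ((1 + τ) / 2) ≤ 2 * R * (P ^ τ * h) := by
    have h1 : |m * Dm f x m| ^ ((1 + τ) / 2) = h * h ^ τ := by
      rw [abs_of_pos hχ0, ← hh2, ← Real.rpow_two, ← Real.rpow_mul hhpos.le,
        show 2 * ((1 + τ) / 2) = 1 + τ by ring, Real.rpow_add hhpos, Real.rpow_one]
    have h2 : h ^ τ ≤ 2 * R * P ^ τ := by
      calc h ^ τ ≤ (2 * R * P) ^ τ := Real.rpow_le_rpow hhpos.le e2 hτ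
        _ = (2 * R) ^ τ * P ^ τ := Real.mul_rpow (by linarith) (by linarith)
        _ ≤ 2 * R * P ^ τ := mul_le_mul_of_nonneg_right
          (rpow_le_self_of_one_le (by linarith) hτ1.le) (by linarith)
    rw [h1]
    calc h * h ^ τ ≤ h * (2 * R * P ^ τ) := mul_le_mul_of_nonneg_left h2 hhpos.le
      _ = _ := by ring
  have e5 : C₀ * (1 + |val f x m| ^ (τ / 2) + |m * Dm f x m| ^ ((1 + τ) / 2)) ≤
      6 * R ^ 3 * (P ^ τ * h) := by
    have h1 : 1 + |val f x m| ^ (τ / 2) + |m * Dm f x m| ^ ((1 + τ) / 2) ≤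
        6 * R ^ 2 * (P ^ τ * h) := by
      have k1 : 1 * P ^ τ ≤ R * h * P ^ τ := mul_le_mul_of_nonneg_right e1 (by linarith)
      have k2 : R * (P ^ τ * h) ≤ R ^ 2 * (P ^ τ * h) :=
        mul_le_mul_of_nonneg_right (by nlinarith) (by positivity)
      have k3 : 3 * R * (1 * P ^ τ) ≤ 3 * R * (R * h * P ^ τ) :=
        mul_le_mul_of_nonneg_left k1 (by linarith)
      linarith
    calc _ ≤ R * (6 * R ^ 2 * (P ^ τ * h)) := mul_le_mul hCR h1 (by positivity) (by linarith)
      _ = _ := by ring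
  refine ⟨hh2, e1, e2, (hf.Dx_le x m hm).trans e5, (hf.Dxx_le x m hm).trans e5, ?_⟩
  rw [hf.deriv_hfun, hf.isCoupling.chi_val hm, ← hh0, abs_div, abs_of_pos (by positivity : 0 < 2 * h),
    div_le_iff₀ (by positivity)] at hh
  linarith

/-- Bounds for the Hamiltonian, with `P = 1 + |p|`. -/
theorem LargeConstant.bounds (hH : HamiltonianAssumptions C₀ τ H)
    (hL : LargeConstant C₀ τ H f m₀) (hC : 0 < C₀) (hτ : 0 ≤ τ) (hR : 1 ≤ R)
    (hCR : C₀ ≤ R) (x p : Sp d) {P : ℝ} (hP : P = 1 + ‖p‖) :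
    ‖Hp H x p‖ ≤ R * P ∧ ‖Hx H x p‖ ≤ 2 * R * (P ^ τ * P) ∧ ‖Hxx H x p‖ ≤ 2 * R * (P ^ τ * P) ∧
    ‖Hxp H x p‖ ≤ R * P ^ τ ∧ ‖Hpp H x p‖ ≤ R ∧ ‖Hxxp H x p‖ ≤ R * P ^ τ ∧
    ‖Hxpp H x p‖ ≤ R * (P ^ τ / P) ∧ ‖Hppp H x p‖ ≤ R * P⁻¹ ∧
    H x p ≤ R * P ^ 2 + R ∧ P ^ 2 / (2 * R) - 2 * R ≤ H x p := by
  have hn := norm_nonneg p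
  have hP1 : 1 ≤ P := by linarith
  have hR0 : 0 < R := by linarith
  have h1 : C₀ * (1 + ‖p‖ ^ (1 + τ)) ≤ 2 * R * (P ^ τ * P) := by
    have := one_add_rpow_le (τ := τ) hn hτ
    rw [← hP] at this
    calc _ ≤ R * (2 * (P ^ τ * P)) := mul_le_mul hCR this (by positivity) hR0.le
      _ = _ := by ring
  have hy : 0 ≤ P ^ τ := by positivity
  refine ⟨?_, (hL.Hx_le x p).trans h1, (hL.Hxx_le x p).trans h1, ?_, ?_, ?_, ?_, ?_, ?_, ?_⟩
  · exact (hL.Hp_le x p).trans (by rw [hP]; gcongr)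
  · exact (hL.Hxp_le x p).trans (by rw [hP]; gcongr)
  · exact (ContinuousLinearMap.opNorm_le_bound _ hC.le (hH.norm_Hpp_le hC x p)).trans hCR
  · exact (hH.Hxxp_le x p).trans (by rw [hP]; gcongr)
  · refine (hH.Hxpp_le x p).trans ?_
    rw [← hP, Real.rpow_sub (by linarith), Real.rpow_one]
    gcongr
  · exact (hH.Hppp_le x p).trans (by rw [hP]; gcongr)
  · refine (hL.H_le x p).trans (add_le_add (mul_le_mul hCR ?_ (by positivity) hR0.le) hCR)
    rw [hP]; gcongr; linarith
  · refine le_trans ?_ (hL.H_ge x p)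
    have h2 : 1 / R * ‖p‖ ^ 2 ≤ 1 / C₀ * ‖p‖ ^ 2 := by gcongr
    have h3 : P ^ 2 / (2 * R) ≤ 1 / R * ‖p‖ ^ 2 + 1 / R := by
      rw [div_le_iff₀ (by positivity)]
      have : (1 / R * ‖p‖ ^ 2 + 1 / R) * (2 * R) = 2 * ‖p‖ ^ 2 + 2 := by field_simp
      rw [this, hP]
      nlinarith [sq_nonneg (‖p‖ - 1)]
    have h4 : 1 / R ≤ R := by
      rw [div_le_iff₀ hR0]; nlinarith
    linarith

end Growth

/-- The bound resulting from `κ η² ≤ …`, since `η` grows quadratically and `P ^ τ` is sublinear. -/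
theorem le_of_absorption {R M P τ κ k η : ℝ} (hR : 1 ≤ R) (hM : M = 10 * R ^ 4) (hP : 1 ≤ P)
    (hτ1 : τ < 1) (hτR : 1 / (1 - τ) ≤ R) (hκ : κ = 1 / M ^ 12) (hk0 : 0 ≤ k)
    (hk : k ≤ 3 * R * κ) (hη : P ^ 2 / (2 * R) - 8 * R ^ 2 ≤ η)
    (h : κ * η ^ 2 ≤ 48 * M ^ 11 * (P ^ τ * P ^ 3) + M ^ 9 * k ^ 2 * P ^ 4 / 2) :
    P ≤ 32 * R ^ 3 + (1536 * R ^ 2 * M ^ 23) ^ R := by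
  have hR0 : 0 < R := by linarith
  have hM0 : 0 < M := by rw [hM]; positivity
  have hM1 : 1 ≤ M := by
    have : 1 ≤ R ^ 4 := one_le_pow₀ hR
    linarith
  have hκ0 : 0 < κ := by rw [hκ]; positivity
  have hP0 : 0 < P := by linarith
  set Q := 1536 * R ^ 2 * M ^ 23 with hQ
  have hQ1 : 1 ≤ Q := by
    have h1 : 1 ≤ R ^ 2 := one_le_pow₀ hR
    have h2 : 1 ≤ M ^ 23 := one_le_pow₀ hM1
    have h3 : 1 * 1 ≤ R ^ 2 * M ^ 23 := mul_le_mul h1 h2 zero_le_one (by positivity)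
    rw [hQ]; nlinarith
  have hQR : 0 ≤ Q ^ R := by positivity
  rcases le_total P (32 * R ^ 3) with hPs | hPl
  · linarith
  have hPP : 32 * R ^ 3 ≤ P ^ 2 := by nlinarith
  have hη1 : P ^ 2 / (4 * R) ≤ η := by
    refine le_trans ?_ hη
    have : 8 * R ^ 2 ≤ P ^ 2 / (4 * R) := by
      rw [le_div_iff₀ (by positivity)]; linarith
    have h2 : P ^ 2 / (2 * R) = P ^ 2 / (4 * R) + P ^ 2 / (4 * R) := by field_simp; norm_num
    linarith
  have hη2 : κ * (P ^ 4 / (16 * R ^ 2)) ≤ κ * η ^ 2 := by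
    have : (P ^ 2 / (4 * R)) ^ 2 ≤ η ^ 2 := pow_le_pow_left₀ (by positivity) hη1 2
    have e : (P ^ 2 / (4 * R)) ^ 2 = P ^ 4 / (16 * R ^ 2) := by field_simp; norm_num
    rw [e] at this
    exact mul_le_mul_of_nonneg_left this hκ0.le
  -- As `k` is at most `3 R κ`, this term is quadratic in `κ`; the choice `κ = M^{-12}` makes it at
  -- most half of the lower bound `hη2`.
  have hk2 : M ^ 9 * k ^ 2 * P ^ 4 / 2 ≤ κ * (P ^ 4 / (32 * R ^ 2)) := by
    have h1 : k ^ 2 ≤ (3 * R * κ) ^ 2 := pow_le_pow_left₀ hk0 hk 2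
    have h2 : M ^ 9 * κ * (9 * R ^ 2) ≤ 1 / (16 * R ^ 2) := by
      rw [hκ, le_div_iff₀ (by positivity)]
      have : M ^ 9 * (1 / M ^ 12) * (9 * R ^ 2) * (16 * R ^ 2) = 144 * R ^ 4 / M ^ 3 := by
        field_simp; norm_num
      rw [this, div_le_one (by positivity), hM]
      have : R ^ 4 ≤ R ^ 12 := pow_le_pow_right₀ hR (by norm_num)
      have e : (10 * R ^ 4) ^ 3 = 1000 * R ^ 12 := by ring
      rw [e]; nlinarith [pow_pos hR0 12]
    calc M ^ 9 * k ^ 2 * P ^ 4 / 2 ≤ M ^ 9 * (3 * R * κ) ^ 2 * P ^ 4 / 2 := by gcongr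
      _ = (M ^ 9 * κ * (9 * R ^ 2)) * (κ * P ^ 4 / 2) := by ring
      _ ≤ (1 / (16 * R ^ 2)) * (κ * P ^ 4 / 2) := by gcongr
      _ = _ := by field_simp; norm_num
  have h3 : P ≤ Q * P ^ τ := by
    have e1 : κ * (P ^ 4 / (32 * R ^ 2)) ≤ 48 * M ^ 11 * (P ^ τ * P ^ 3) := by
      have : κ * (P ^ 4 / (16 * R ^ 2)) =
        κ * (P ^ 4 / (32 * R ^ 2)) + κ * (P ^ 4 / (32 * R ^ 2)) := by field_simp; norm_num
      linarith
    have e2 : κ * (P ^ 4 / (32 * R ^ 2)) = P * (P ^ 3 / (32 * R ^ 2 * M ^ 12)) := by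
      rw [hκ]; field_simp
    have e3 : 48 * M ^ 11 * (P ^ τ * P ^ 3) = Q * P ^ τ * (P ^ 3 / (32 * R ^ 2 * M ^ 12)) := by
      rw [hQ]; field_simp; norm_num
    rw [e2, e3] at e1
    exact le_of_mul_le_mul_right e1 (by positivity)
  have h4 : P ^ (1 - τ) ≤ Q := by
    rw [Real.rpow_sub hP0, Real.rpow_one, div_le_iff₀ (by positivity)]
    exact h3
  -- The bound is `Q` to the power `1 / (1 - τ)`; as `Q ≥ 1`, the exponent may be enlarged to `R`.
  have h5 : P ≤ Q ^ R := by
    calc P = (P ^ (1 - τ)) ^ (1 / (1 - τ)) := by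
          rw [← Real.rpow_mul hP0.le, mul_one_div_cancel (by linarith), Real.rpow_one]
      _ ≤ Q ^ (1 / (1 - τ)) := Real.rpow_le_rpow (by positivity) h4 (by
          have : 0 < 1 - τ := by linarith
          positivity)
      _ ≤ Q ^ R := Real.rpow_le_rpow_of_exponent_le hQ1 hτR
  have : 0 ≤ 32 * R ^ 3 := by positivity
  linarith

end MFG

end

/-! ### Bernstein's method at an interior maximum. -/

noncomputable section

namespace MFG

open Set Filter Topology MeasureTheory
open scoped ENNReal

/-- The (large) constant in the pointwise estimate. -/
def estimateConst (R : ℝ) : ℝ := 10 * R ^ 4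

/-- The weight of the quadratic term in Bernstein's method. -/
def bernsteinWeight (R : ℝ) : ℝ := 1 / estimateConst R ^ 12

/-- The bound for `1 + |D_x u|` at the maximum in Bernstein's method. -/
def bernsteinBound (R : ℝ) : ℝ :=
  32 * R ^ 3 + (1536 * R ^ 2 * estimateConst R ^ 23) ^ R + 8 * R ^ 4 * estimateConst R ^ 12

theorem bernsteinWeight_pos {R : ℝ} (hR : 1 ≤ R) : 0 < bernsteinWeight R := by
  have : 0 < R := by linarith
  unfold bernsteinWeight estimateConst
  positivity

theorem bernsteinWeight_mul_le {R : ℝ} (hR : 1 ≤ R) : 9 * R ^ 2 * bernsteinWeight R ≤ 1 := by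
  have h0 : 0 < R := by linarith
  have h1 : 1 ≤ estimateConst R := by
    have : 1 ≤ R ^ 4 := one_le_pow₀ hR
    unfold estimateConst; linarith
  have h2 : 9 * R ^ 2 ≤ estimateConst R := by
    have : R ^ 2 ≤ R ^ 4 := pow_le_pow_right₀ hR (by norm_num)
    have : 0 ≤ R ^ 4 := by positivity
    unfold estimateConst; linarith
  rw [bernsteinWeight, mul_one_div, div_le_one (by positivity)]
  calc _ ≤ estimateConst R := h2
    _ = estimateConst R ^ 1 := (pow_one _).symm
    _ ≤ _ := pow_le_pow_right₀ h1 (by norm_num)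

namespace IsClassicalSolution

variable {d : ℕ} {T : ℝ} {H : Sp d → Sp d → ℝ} {f g : Sp d → ℝ → EReal}
    {m₀ : Sp d → ℝ} {u m : Sp d → ℝ → ℝ} (hs : IsClassicalSolution T H f g m₀ u m)
    {C₀ τ : ℝ} (hH : HamiltonianAssumptions C₀ τ H) (hf : RunningCostAssumptions C₀ τ f)
    (hL : LargeConstant C₀ τ H f m₀) (hC : 0 < C₀) (hτ : 0 ≤ τ) (hτ1 : τ < 1)
    {R : ℝ} (hR : 1 ≤ R) (hCR : C₀ ≤ R) {z : Sp d × ℝ}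

include hs hH hf hL hC hτ hR hCR

/-- The derivative of `u + c t` along the characteristics grows quadratically in `D_x u`. -/
theorem along_ge (hT : 0 < T) (hz : z ∈ cyl d T) (hw : -R ≤ cost f m z) {c : ℝ}
    (hc : |c| ≤ 4 * R ^ 2) :
    (1 + ‖grd u z‖) ^ 2 / (2 * R) - 8 * R ^ 2 ≤
      inner ℝ (grd u z) (vel H u z) - (tder T u z + c) := by
  obtain ⟨-, -, -, -, -, -, -, -, -, hV⟩ := hL.bounds hH hC hτ hR hCR z.1 (grd u z) rfl
  have h1 := (hs.cost_eq_of_mem hH hf hT hz).2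
  have h2 := hH.growth z.1 (grd u z)
  rw [real_inner_comm] at h2
  have h3 := (abs_le.1 hc).2
  have h4 : R ≤ R ^ 2 := by nlinarith
  change _ ≤ inner ℝ (grd u z) (vel H u z) at h2
  rw [ham] at h1
  linarith

set_option maxHeartbeats 1000000 in
/-- At an interior maximum in Bernstein's method, `D_x u` is bounded. -/
theorem norm_grd_le_of_interior (hd : (d : ℝ) ≤ R) (hτ1 : τ < 1) (hτR : 1 / (1 - τ) ≤ R)
    (hz : z.2 ∈ Ioo 0 T)
    (hχ : |1 / chi f z.1 (cost f m z)| ≤ R) (hh : |deriv (hfun f z.1) (cost f m z)| ≤ R)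
    (hw : -R ≤ cost f m z) (hq : -(2 * R) ≤ tder T u z) {c c' : ℝ} (hc : |c| ≤ 4 * R ^ 2)
    (hψ : |u z.1 z.2 + (c * z.2 + c')| ≤ 3 * R)
    (hmax : IsLocalMax (fun y : Sp d × ℝ => ham H u y +
      bernsteinWeight R / 2 * (u y.1 y.2 + (c * y.2 + c')) ^ 2) z) :
    1 + ‖grd u z‖ ≤ bernsteinBound R := by
  have hT := hz.1.trans hz.2
  have hzc := mem_cyl_of_mem_Ioo hz
  have hR0 : 0 < R := by linarith
  have hκ := bernsteinWeight_pos hR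
  have hκR := bernsteinWeight_mul_le hR
  have hpos := hs.m_pos hH hf hz
  obtain ⟨hψC, hψ1, hψ2⟩ := hs.affine_time_u hz (c := c) (c' := c')
  obtain ⟨h1, h2⟩ := conditions_of_isLocalMax_add_sq (hs.contDiffAt_ham hH hz) hψC hmax
  simp only [hψ1, hψ2] at h1 h2
  set K := bernsteinWeight R * (u z.1 z.2 + (c * z.2 + c')) with hK
  set P := 1 + ‖grd u z‖ with hP
  have hn := norm_nonneg (grd u z)
  have hP1 : 1 ≤ P := by linarith
  have hP2 : 1 ≤ P ^ 2 := one_le_pow₀ hP1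
  have hRP : R * 1 ≤ R * P ^ 2 := mul_le_mul_of_nonneg_left hP2 hR0.le
  obtain ⟨bHp, bHx, bHxx, bHxp, bHpp, bHxxp, bHxpp, bHppp, bHle, bHge⟩ :=
    hL.bounds hH hC hτ hR hCR z.1 (grd u z) hP
  have hcost := (hs.cost_eq_of_mem hH hf hT hzc).2
  rw [ham] at hcost
  have hP2R : 0 ≤ P ^ 2 / (2 * R) := by positivity
  have hwabs : |val f z.1 (m z.1 z.2)| ≤ 3 * R * P ^ 2 := by
    change |cost f m z| ≤ _
    -- The upper bound uses `u_t ≥ -2R`: then `f = -u_t + H` is at most quadratic in `D_x u`.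
    refine abs_le.2 ⟨by linarith, ?_⟩
    have hle := hL.H_le z.1 (grd u z)
    have h3 : C₀ * ‖grd u z‖ ^ 2 ≤ R * ‖grd u z‖ ^ 2 := by gcongr
    have h4 : R * (‖grd u z‖ ^ 2 + 3) ≤ R * (3 * P ^ 2) :=
      mul_le_mul_of_nonneg_left (by rw [hP]; nlinarith) hR0.le
    linarith
  obtain ⟨hh2, bh1, bh2, bF, bFxx, bχw⟩ :=
    hf.bounds hL hC hτ hτ1 hR hCR hP1 hpos hwabs hχ hh rfl
  set h := √(m z.1 z.2 * Dm f z.1 (m z.1 z.2)) with hhdef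
  have hh0 : 0 ≤ h := Real.sqrt_nonneg _
  obtain ⟨e, l, he, hl⟩ := hH.exists_eigenbasis z.1 (grd u z)
  have hη := hs.along_ge hH hf hL hC hτ hR hCR hT hzc hw hc
  set η := inner ℝ (grd u z) (vel H u z) - (tder T u z + c) with hηdef
  have hineq := hs.bernstein_inequality hH hf hz hC hκ.le h1 h2 he
    (fun i => (by positivity : 0 ≤ 1 / C₀).trans (hl i).1) hηdef rfl rfl rfl rfl hh2 rfl rfl
    (fun _ => rfl)
  -- All structural bounds, with constants up to `6 R⁴`, are relaxed to the single constant `M = 10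
  -- R⁴` required by `bernstein_estimate`.
  set M := estimateConst R with hM
  have hM' : M = 10 * R ^ 4 := rfl
  have r1 : R ≤ R ^ 4 := by simpa using pow_le_pow_right₀ hR (by norm_num : 1 ≤ 4)
  have r2 : R ^ 2 ≤ R ^ 4 := pow_le_pow_right₀ hR (by norm_num)
  have r3 : R ^ 3 ≤ R ^ 4 := pow_le_pow_right₀ hR (by norm_num)
  have hRM : 2 * R ≤ M := by linarith
  have hM6 : 6 * R ^ 3 ≤ M := by linarith
  have hM4 : 6 * R ^ 4 ≤ M := by linarith
  have hM1 : 1 ≤ M := by linarith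
  have hy1 : 1 ≤ P ^ τ := Real.one_le_rpow hP1 hτ
  have hyP : P ^ τ ≤ P := rpow_le_self_of_one_le hP1 hτ1.le
  set y := P ^ τ
  have hy0 : 0 ≤ y := by linarith
  have hP0 : 0 < P := by linarith
  have hKk : |K| ≤ 3 * R * bernsteinWeight R := by
    rw [hK, abs_mul, abs_of_pos hκ, mul_comm]
    exact mul_le_mul_of_nonneg_right hψ hκ.le
  have hk1 : 3 * R * bernsteinWeight R ≤ 1 := by
    refine (mul_le_mul_of_nonneg_right ?_ hκ.le).trans hκR
    have : R * 1 ≤ R * R := mul_le_mul_of_nonneg_left hR hR0.le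
    linarith
  have hηabs : |η| ≤ M * P ^ 2 := by
    have a1 : |inner ℝ (grd u z) (vel H u z)| ≤ P * (R * P) :=
      abs_inner_le (by linarith) bHp
    have a2 : |H z.1 (grd u z)| ≤ 2 * R * P ^ 2 := abs_le.2 ⟨by linarith, by linarith⟩
    have a3 : 4 * R ^ 2 * 1 ≤ 4 * R ^ 4 * P ^ 2 :=
      mul_le_mul (by linarith) hP2 zero_le_one (by positivity)
    have a4 : R * P ^ 2 ≤ R ^ 4 * P ^ 2 := mul_le_mul_of_nonneg_right r1 (by positivity)
    change |cost f m z| ≤ _ at hwabs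
    rw [abs_le] at a1 a2 hwabs hc ⊢
    rw [hηdef, hM']
    constructor <;> linarith
  have key := bernstein_estimate (R := M) (P := P) (y := y) (h := h) hM1 (by linarith) hy1 hyP
    (bh1.trans (mul_le_mul_of_nonneg_right (by linarith) hh0))
    (bh2.trans (mul_le_mul_of_nonneg_right hRM hP0.le)) hk1 hKk
    (bHp.trans (mul_le_mul_of_nonneg_right (by linarith) hP0.le))
    (bF.trans (mul_le_mul_of_nonneg_right hM6 (by positivity)))
    (by
      rw [norm_neg, norm_smul, Real.norm_eq_abs]
      calc |K| * ‖grd u z‖ ≤ 1 * P :=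
            mul_le_mul (hKk.trans hk1) (by linarith) hn zero_le_one
        _ = P := one_mul P)
    (bHx.trans (mul_le_mul_of_nonneg_right hRM (by positivity)))
    (bHxp.trans (mul_le_mul_of_nonneg_right (by linarith) hy0))
    (bHxx.trans (mul_le_mul_of_nonneg_right hRM (by positivity)))
    (bHpp.trans (by linarith))
    (bFxx.trans (mul_le_mul_of_nonneg_right hM6 (by positivity)))
    (bHxxp.trans (mul_le_mul_of_nonneg_right (by linarith) hy0))
    (bHxpp.trans (mul_le_mul_of_nonneg_right (by linarith) (by positivity)))
    (bHppp.trans (mul_le_mul_of_nonneg_right (by linarith) (by positivity)))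
    (fun i => ⟨(one_div_le_one_div_of_le hC (by linarith)).trans (hl i).1,
      (hl i).2.trans (by linarith)⟩)
    (fun v => (mul_le_mul_of_nonneg_right (one_div_le_one_div_of_le hC (by linarith))
      (sq_nonneg _)).trans (hH.convex z.1 (grd u z) v).1)
    ((hf.chi_w_le _ _).trans (by linarith))
    (bχw.trans (mul_le_mul_of_nonneg_right hRM hh0)) hηabs
    (by
      rw [← real_inner_smul_left]
      refine (abs_real_inner_le_norm _ _).trans (mul_le_mul ((hf.Dxm_le _ _ hpos).trans ?_)
        (bHp.trans (mul_le_mul_of_nonneg_right (by linarith) hP0.le)) (norm_nonneg _)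
        (by positivity))
      calc C₀ * ‖Dx f z.1 (m z.1 z.2)‖ ≤ R * (6 * R ^ 3 * (y * h)) :=
            mul_le_mul hCR bF (norm_nonneg _) hR0.le
        _ = 6 * R ^ 4 * (y * h) := by ring
        _ ≤ M * (y * h) := mul_le_mul_of_nonneg_right hM4 (by positivity))
    rfl hineq
  have hfin := le_of_absorption hR hM' hP1 hτ1 hτR rfl (by positivity) le_rfl hη key
  have : 0 ≤ 8 * R ^ 4 * M ^ 12 := by positivity
  rw [bernsteinBound]
  linarith

end IsClassicalSolution

end MFG

end

/-! ### Bernstein's method at a maximum on the initial or terminal boundary. -/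

noncomputable section

namespace MFG

open Set Filter Topology MeasureTheory
open scoped ENNReal

theorem IsCoupling.fderiv_val_prod {d : ℕ} {F : Sp d → ℝ → EReal} (hF : IsCoupling F) {x : Sp d}
    {m : ℝ} (hm : 0 < m) (a : Sp d × ℝ) :
    fderiv ℝ (fun z : Sp d × ℝ => val F z.1 z.2) (x, m) a =
      inner ℝ (Dx F x m) a.1 + Dm F x m * a.2 := by
  have h := hasFDerivAt_of_partial (G := val F) (a := x) (b := m)
    ((hF.contDiffAt_val hm).differentiableAt (by simp))
  rw [h.fderiv, Dx, inner_gradient, Dm]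
  simp [mul_comm]

theorem IsCoupling.norm_Dx_le {d : ℕ} {F : Sp d → ℝ → EReal} (hF : IsCoupling F) {x : Sp d}
    {m B : ℝ} (hm : 0 < m)
    (h : ‖fderiv ℝ (fun z : Sp d × ℝ => val F z.1 z.2) (x, m)‖ ≤ B) : ‖Dx F x m‖ ≤ B := by
  have h1 := hF.fderiv_val_prod hm (x := x) (Dx F x m, 0)
  rw [mul_zero, add_zero, real_inner_self_eq_norm_sq] at h1
  have h2 := ((fderiv ℝ (fun z : Sp d × ℝ => val F z.1 z.2) (x, m)).le_opNorm
    (Dx F x m, 0)).trans (mul_le_mul_of_nonneg_right h (norm_nonneg _))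
  rw [h1, Real.norm_eq_abs, abs_of_nonneg (sq_nonneg _), Prod.norm_def] at h2
  simp only [norm_zero, norm_nonneg, sup_of_le_left] at h2
  by_contra! hn
  have hB : 0 ≤ B := (norm_nonneg _).trans h
  nlinarith

/-- The boundary counterpart of `le_of_absorption`: once `P ≥ 32 R³`, `η ≥ P² / (4R)` outgrows a
bound linear in `P`. The third summand of `bernsteinBound` is reserved for this case. -/
theorem le_bernsteinBound {R P η : ℝ} (hR : 1 ≤ R) (hP : 1 ≤ P)
    (hη : P ^ 2 / (2 * R) - 8 * R ^ 2 ≤ η)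
    (h : 0 ≤ η → bernsteinWeight R * η ≤ R ^ 3 * P ∨ P ≤ 32 * R ^ 3) : P ≤ bernsteinBound R := by
  have hR0 : 0 < R := by linarith
  have hM : 0 < estimateConst R := by unfold estimateConst; positivity
  have b1 : 32 * R ^ 3 ≤ bernsteinBound R := by
    have : 0 ≤ (1536 * R ^ 2 * estimateConst R ^ 23) ^ R + 8 * R ^ 4 * estimateConst R ^ 12 := by
      positivity
    unfold bernsteinBound; linarith
  have b2 : 8 * R ^ 4 * estimateConst R ^ 12 ≤ bernsteinBound R := by
    have : 0 ≤ 32 * R ^ 3 + (1536 * R ^ 2 * estimateConst R ^ 23) ^ R := by positivity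
    unfold bernsteinBound; linarith
  rcases le_total P (32 * R ^ 3) with hPs | hPl
  · exact hPs.trans b1
  have hPP : 32 * R ^ 3 ≤ P ^ 2 := by nlinarith
  have hη1 : P ^ 2 / (4 * R) ≤ η := by
    refine le_trans ?_ hη
    have : 8 * R ^ 2 ≤ P ^ 2 / (4 * R) := by
      rw [le_div_iff₀ (by positivity)]; linarith
    have h2 : P ^ 2 / (2 * R) = P ^ 2 / (4 * R) + P ^ 2 / (4 * R) := by field_simp; norm_num
    linarith
  rcases h ((by positivity : 0 ≤ P ^ 2 / (4 * R)).trans hη1) with h | h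
  · have h1 : bernsteinWeight R * (P ^ 2 / (4 * R)) ≤ R ^ 3 * P :=
      (mul_le_mul_of_nonneg_left hη1 (bernsteinWeight_pos hR).le).trans h
    have h2 : bernsteinWeight R * (P ^ 2 / (4 * R)) = P * (P / (4 * R * estimateConst R ^ 12)) := by
      rw [bernsteinWeight]; field_simp
    rw [h2, mul_comm (R ^ 3)] at h1
    have h3 := le_of_mul_le_mul_left h1 (by linarith)
    rw [div_le_iff₀ (by positivity)] at h3
    have h4 : R ^ 3 * (4 * R * estimateConst R ^ 12) = 4 * R ^ 4 * estimateConst R ^ 12 := by ring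
    have h5 : 0 ≤ R ^ 4 * estimateConst R ^ 12 := by positivity
    linarith
  · exact h.trans b1

/-- The gradient bound. -/
def gradientBound (R : ℝ) : ℝ := 4 * R * bernsteinBound R + R * bernsteinBound R ^ 2 + 4 * R

namespace IsClassicalSolution

variable {d : ℕ} {T : ℝ} {H : Sp d → Sp d → ℝ} {f g : Sp d → ℝ → EReal}
    {m₀ : Sp d → ℝ} {u m : Sp d → ℝ → ℝ} (hs : IsClassicalSolution T H f g m₀ u m)
    {C₀ τ : ℝ} (hH : HamiltonianAssumptions C₀ τ H) (hf : RunningCostAssumptions C₀ τ f)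
    (hL : LargeConstant C₀ τ H f m₀) (hC : 0 < C₀) (hτ : 0 ≤ τ) (hT : 0 < T)
    {R : ℝ} (hR : 1 ≤ R) (hCR : C₀ ≤ R) {z : Sp d × ℝ}

include hs in
theorem hasFDerivAt_m_slice (hz : z ∈ cyl d T) :
    HasFDerivAt (fun y => m y z.2) ((fderivWithin ℝ (fun z : Sp d × ℝ => m z.1 z.2)
      (cyl d T) z).comp (ContinuousLinearMap.inl ℝ (Sp d) ℝ)) z.1 := by
  have h0 : HasFDerivWithinAt (fun z : Sp d × ℝ => m z.1 z.2)
      (fderivWithin ℝ (fun z : Sp d × ℝ => m z.1 z.2) (cyl d T) z) (cyl d T) z :=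
    (hs.contDiffOn_m.differentiableOn (by simp) z hz).hasFDerivWithinAt
  have h := h0.comp (f := fun y => (y, z.2)) (s := univ) z.1
    (hasFDerivAt_prodMk_left z.1 z.2).hasFDerivWithinAt (fun y _ => ⟨mem_univ _, hz.2⟩)
  exact hasFDerivWithinAt_univ.1 h

include hs hH hf hT

/-- First order conditions on the boundary, along the characteristics. -/
theorem boundary_conditions {κ K c c' : ℝ} (hz : z ∈ cyl d T)
    (hK : K = κ * (u z.1 z.2 + (c * z.2 + c')))
    (hmax : IsMaxOn (fun y : Sp d × ℝ => ham H u y +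
      κ / 2 * (u y.1 y.2 + (c * y.2 + c')) ^ 2) (cyl d T) z) {D : ℝ}
    (hD : D = inner ℝ (Dx f z.1 (m z.1 z.2)) (vel H u z) + Dm f z.1 (m z.1 z.2) *
        fderivWithin ℝ (fun z : Sp d × ℝ => m z.1 z.2) (cyl d T) z (vel H u z, 0)) :
    (z.2 = 0 → 0 ≤ D + K * (inner ℝ (grd u z) (vel H u z) - (tder T u z + c))) ∧
    (z.2 = T → D + K * (inner ℝ (grd u z) (vel H u z) - (tder T u z + c)) ≤ 0) := by
  have h1 : HasFDerivWithinAt (fun y : Sp d × ℝ => u y.1 y.2 + (c * y.2 + c'))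
      (fderivWithin ℝ (fun z : Sp d × ℝ => u z.1 z.2) (cyl d T) z +
        c • ContinuousLinearMap.snd ℝ (Sp d) ℝ) (cyl d T) z :=
    (hs.hasFDerivWithinAt_u hz).add ((hasFDerivWithinAt_snd.const_mul c).add_const c')
  obtain ⟨c1, c2, c3⟩ := first_order_of_isMaxOn hz hmax
    ((hs.hasFDerivWithinAt_ham hH hT hz).add ((h1.pow 2).const_mul (κ / 2)))
  -- The direction `(b,-1)` points out of the cylinder at `t = 0` and into it at `t = T`, which
  -- fixes the two signs. `ham_along` trades the derivative of `H(x,D_xu)` for `D`, which involves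
  -- only `f` and `D_xm`.
  have h2 := hs.ham_along hH hf hT hz
  rw [← hD] at h2
  have h3 := c1 (vel H u z)
  have e0 : ((vel H u z, -1) : Sp d × ℝ) = (vel H u z, 0) - (0, 1) := by simp
  rw [e0, map_sub, inner_sub_right] at h2
  simp only [add_apply, smul_apply, ContinuousLinearMap.comp_apply, hs.fderivWithin_u hT hz,
    ContinuousLinearMap.coe_fst', ContinuousLinearMap.coe_snd', innerSL_apply_apply, smul_eq_mul,
    mul_zero, add_zero, inner_zero_right, zero_add, mul_one] at h3 c2 c3
  norm_num at h3 c2 c3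
  constructor
  · intro h0
    have := c2 (h0.trans_lt hT)
    rw [hK]
    linarith
  · intro h0
    have := c3 (hT.trans_eq h0.symm)
    rw [hK]
    linarith

include hL hC hτ hR hCR

/-- At a maximum at the initial time in Bernstein's method, `D_x u` is bounded. -/
theorem norm_grd_le_of_initial (hm : InitialDensity m₀) (hz : z ∈ cyl d T) (hz0 : z.2 = 0)
    {c c' : ℝ} (hc : |c| ≤ 4 * R ^ 2) (hψ : u z.1 z.2 + (c * z.2 + c') ≤ -1)
    (hmax : IsMaxOn (fun y : Sp d × ℝ => ham H u y +
      bernsteinWeight R / 2 * (u y.1 y.2 + (c * y.2 + c')) ^ 2) (cyl d T) z) :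
    1 + ‖grd u z‖ ≤ bernsteinBound R := by
  have hR0 : 0 < R := by linarith
  have hn := norm_nonneg (grd u z)
  have hm0 : m z.1 z.2 = m₀ z.1 := by rw [hz0, hs.initial]
  have hfc := hf.isCoupling
  have hw : -R ≤ cost f m z := by
    have := (abs_le.1 (hL.abs_val_le hC hm z.1)).1
    rw [cost, hm0]; linarith
  obtain ⟨bHp, -⟩ := hL.bounds hH hC hτ hR hCR z.1 (grd u z) rfl
  refine le_bernsteinBound hR (by linarith) (hs.along_ge hH hf hL hC hτ hR hCR hT hz hw hc)
    fun hη => Or.inl ?_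
  have hb := (hs.boundary_conditions hH hf hT hz rfl hmax rfl).1 hz0
  -- At `t = 0` the spatial derivative of `m` is that of the given `m₀`, so `D` is at most linear in
  -- `P`.
  have hdm : fderivWithin ℝ (fun z : Sp d × ℝ => m z.1 z.2) (cyl d T) z (vel H u z, 0) =
      fderiv ℝ m₀ z.1 (vel H u z) := by
    have h1 := (hs.hasFDerivAt_m_slice hz).fderiv
    have h2 : (fun y => m y z.2) = m₀ := by rw [hz0]; exact funext hs.initial
    rw [h2] at h1
    rw [h1]; simp
  have hD := hfc.fderiv_val_prod (hm.pos z.1) (x := z.1) (vel H u z, fderiv ℝ m₀ z.1 (vel H u z))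
  rw [hdm, hm0] at hb
  rw [← hD] at hb
  have hv : ‖vel H u z‖ ≤ R * (1 + ‖grd u z‖) := bHp
  have h3 : ‖fderiv ℝ m₀ z.1 (vel H u z)‖ ≤ R * (R * (1 + ‖grd u z‖)) :=
    norm_apply_le ((hL.norm_fderiv_m₀_le hC z.1).trans hCR) hv
  have h4 : ‖((vel H u z, fderiv ℝ m₀ z.1 (vel H u z)) : Sp d × ℝ)‖ ≤
      R * (R * (1 + ‖grd u z‖)) := by
    refine max_le (hv.trans ?_) h3
    exact le_mul_of_one_le_left (by positivity) hR
  have h5 := (ContinuousLinearMap.le_opNorm (fderiv ℝ (fun z : Sp d × ℝ => val f z.1 z.2)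
    (z.1, m₀ z.1)) (vel H u z, fderiv ℝ m₀ z.1 (vel H u z))).trans
    (mul_le_mul ((hL.norm_fderiv_val_le hC hm z.1).trans hCR) h4 (norm_nonneg _) hR0.le)
  have h6 := (le_abs_self _).trans h5
  set η := inner ℝ (grd u z) (vel H u z) - (tder T u z + c)
  -- Since `ũ ≤ -1`, the condition `0 ≤ D + κ ũ η` yields `κ η ≤ D`.
  have h7 : bernsteinWeight R * η * 1 ≤
      bernsteinWeight R * η * -(u z.1 z.2 + (c * z.2 + c')) :=
    mul_le_mul_of_nonneg_left (by linarith) (mul_nonneg (bernsteinWeight_pos hR).le hη)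
  linarith

/-- At a maximum at the terminal time in Bernstein's method, `D_x u` is bounded. -/
theorem norm_grd_le_of_terminal (hg : IsCoupling g) (hz : z ∈ cyl d T) (hzT : z.2 = T)
    (hw : -R ≤ cost f m z) (hfx : ‖Dx f z.1 (m z.1 z.2)‖ ≤ R) (hgx : ‖Dx g z.1 (m z.1 z.2)‖ ≤ R)
    {c c' : ℝ} (hc : |c| ≤ 4 * R ^ 2) (hψ : 1 ≤ u z.1 z.2 + (c * z.2 + c'))
    (hmax : IsMaxOn (fun y : Sp d × ℝ => ham H u y +
      bernsteinWeight R / 2 * (u y.1 y.2 + (c * y.2 + c')) ^ 2) (cyl d T) z) :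
    1 + ‖grd u z‖ ≤ bernsteinBound R := by
  have hR0 : 0 < R := by linarith
  have hn := norm_nonneg (grd u z)
  have hfc := hf.isCoupling
  have hpos := (hs.cost_eq_of_mem hH hf hT hz).1
  obtain ⟨bHp, -, -, -, -, -, -, -, -, bHge⟩ := hL.bounds hH hC hτ hR hCR z.1 (grd u z) rfl
  have hv : ‖vel H u z‖ ≤ R * (1 + ‖grd u z‖) := bHp
  refine le_bernsteinBound hR (by linarith) (hs.along_ge hH hf hL hC hτ hR hCR hT hz hw hc)
    fun hη => ?_
  have hb := (hs.boundary_conditions hH hf hT hz rfl hmax rfl).2 hzT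
  set μ := fderivWithin ℝ (fun z : Sp d × ℝ => m z.1 z.2) (cyl d T) z (vel H u z, 0) with hμ
  -- The terminal condition `u = g(x,m)` is differentiated in the direction `b`.
  have hgrd : inner ℝ (grd u z) (vel H u z) =
      inner ℝ (Dx g z.1 (m z.1 z.2)) (vel H u z) + Dm g z.1 (m z.1 z.2) * μ := by
    have h1 := hs.hasFDerivAt_m_slice hz
    have h2 : (fun y => u y z.2) = fun y => val g y (m y z.2) := funext fun y => by
      have hy : (y, T) ∈ cyl d T := ⟨mem_univ _, hT.le, le_rfl⟩
      rw [hzT, ← EReal.coe_eq_coe_iff, hg.coe_val (hs.cost_eq_of_mem hH hf hT hy).1, hs.terminal]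
    have h3 := ((hg.contDiffAt_val hpos (x := z.1)).differentiableAt (by simp)).hasFDerivAt.comp z.1
      ((hasFDerivAt_id z.1).prodMk h1)
    rw [grd, spaceGrad, inner_gradient, h2]
    refine (congrArg (fun L => L (vel H u z)) h3.fderiv).trans ?_
    rw [ContinuousLinearMap.comp_apply, hg.fderiv_val_prod hpos]
    simp [hμ]
  have hF := (abs_le.1 (abs_inner_le hfx hv)).1
  have hG := (abs_le.1 (abs_inner_le hgx hv)).2
  have hRR : R * (R * (1 + ‖grd u z‖)) ≤ R ^ 3 * (1 + ‖grd u z‖) := by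
    rw [← mul_assoc, ← pow_two]
    exact mul_le_mul_of_nonneg_right (pow_le_pow_right₀ hR (by norm_num)) (by linarith)
  -- `μ = D_xm · b` is not bounded, but either sign helps. If `μ ≥ 0`, then `f_m μ` can be dropped
  -- from `κ η ≤ -D`. If `μ ≤ 0`, then `g_m μ` can be dropped from `hgrd`, so `D_xu · D_pH` is at
  -- most linear in `P`, against its quadratic growth.
  rcases le_total 0 μ with h0 | h0
  · left
    have h1 : 0 ≤ Dm f z.1 (m z.1 z.2) * μ := mul_nonneg (hfc.Dm_pos _ _ hpos).le h0
    set η := inner ℝ (grd u z) (vel H u z) - (tder T u z + c)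
    have h7 : bernsteinWeight R * η * 1 ≤
        bernsteinWeight R * η * (u z.1 z.2 + (c * z.2 + c')) :=
      mul_le_mul_of_nonneg_left (by linarith) (mul_nonneg (bernsteinWeight_pos hR).le hη)
    linarith
  · right
    have h1 : Dm g z.1 (m z.1 z.2) * μ ≤ 0 :=
      mul_nonpos_of_nonneg_of_nonpos (hg.Dm_pos _ _ hpos).le h0
    have h2 := hH.growth z.1 (grd u z)
    rw [real_inner_comm] at h2
    change _ ≤ inner ℝ (grd u z) (vel H u z) at h2
    set P := 1 + ‖grd u z‖
    have hP1 : 1 ≤ P := by simp only [P]; linarith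
    have h3 : P ^ 2 / R ≤ R ^ 2 * P + 5 * R := by
      have : 2 * (P ^ 2 / (2 * R)) = P ^ 2 / R := by field_simp
      linarith
    rw [div_le_iff₀ hR0] at h3
    have h4 : P * P ≤ P * (R ^ 3 + 5 * R ^ 2) := by
      have : 5 * R ^ 2 * 1 ≤ 5 * R ^ 2 * P := mul_le_mul_of_nonneg_left hP1 (by positivity)
      linarith
    have h5 := le_of_mul_le_mul_left h4 (by linarith)
    have h6 : R ^ 2 ≤ R ^ 3 := pow_le_pow_right₀ hR (by norm_num)
    have h7 : 0 ≤ R ^ 3 := by positivity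
    linarith

end IsClassicalSolution

end MFG

end

/-! ### From the bound at the maximum point to the global gradient bound. -/

noncomputable section

namespace MFG

open Set Filter Topology MeasureTheory
open scoped ENNReal

namespace IsClassicalSolution

variable {d : ℕ} {T : ℝ} {H : Sp d → Sp d → ℝ} {f g : Sp d → ℝ → EReal}
    {m₀ : Sp d → ℝ} {u m : Sp d → ℝ → ℝ}

/-- The gradient bound, given bounds for the values of the solution and of the data. -/
theorem gradient_bound (hs : IsClassicalSolution T H f g m₀ u m)
    {C₀ τ : ℝ} (hH : HamiltonianAssumptions C₀ τ H) (hf : RunningCostAssumptions C₀ τ f)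
    (hL : LargeConstant C₀ τ H f m₀) (hC : 0 < C₀) (hτ : 0 ≤ τ) (hT : 0 < T)
    {R : ℝ} (hR : 1 ≤ R) (hCR : C₀ ≤ R) (hτ1 : τ < 1) (hd : (d : ℝ) ≤ R) (hτR : 1 / (1 - τ) ≤ R)
    (hm : InitialDensity m₀) (hg : IsCoupling g) {L K : ℝ} (hu : ∀ z ∈ cyl d T, |u z.1 z.2| ≤ L)
    (hLR : L ≤ R) (hTR : 1 / T ≤ R) (hKR : K ≤ R) (hCK : C₀ + 1 ≤ K)
    (hfT : ∀ x, -(K - 1) ≤ val f x (m x T))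
    (hbT : ∀ x, |val f x (m x T)| ≤ R ∧ ‖Dx f x (m x T)‖ ≤ R ∧ ‖Dx g x (m x T)‖ ≤ R)
    (hχ : ∀ x w, -K ≤ w → |1 / chi f x w| ≤ R ∧ |deriv (hfun f x) w| ≤ R)
    {z : Sp d × ℝ} (hz : z ∈ cyl d T) : ‖grd u z‖ + |tder T u z| ≤ gradientBound R := by
  have hR0 : 0 < R := by linarith
  have hL0 : 0 ≤ L := (abs_nonneg _).trans (hu z hz)
  have hκ := bernsteinWeight_pos hR
  have hκR := bernsteinWeight_mul_le hR
  -- With `|u| ≤ L`, these choices make `ũ = u + c t + c'` at most `-1` at `t = 0`, at least `1` at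
  -- `t = T`, and at most `2 L + 1` in absolute value.
  set c := (2 * L + 2) / T with hcdef
  set c' := -(L + 1) with hc'
  have hcT : c * T = 2 * L + 2 := by rw [hcdef]; field_simp
  have hc0 : 0 ≤ c := by positivity
  have hc : |c| ≤ 4 * R ^ 2 := by
    rw [abs_of_nonneg hc0, hcdef, div_eq_mul_one_div]
    calc (2 * L + 2) * (1 / T) ≤ (4 * R) * R :=
          mul_le_mul (by linarith) hTR (by positivity) (by positivity)
      _ = _ := by ring
  have hψ : ∀ y ∈ cyl d T, |u y.1 y.2 + (c * y.2 + c')| ≤ 3 * R := fun y hy => by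
    have h1 := abs_le.1 (hu y hy)
    have h2 : 0 ≤ c * y.2 := mul_nonneg hc0 hy.2.1
    have h3 : c * y.2 ≤ c * T := mul_le_mul_of_nonneg_left hy.2.2 hc0
    rw [hcT] at h3
    have : |u y.1 y.2 + (c * y.2 + c')| ≤ 2 * L + 1 := abs_le.2 ⟨by linarith, by linarith⟩
    linarith
  set Φ := fun y : Sp d × ℝ => ham H u y +
    bernsteinWeight R / 2 * (u y.1 y.2 + (c * y.2 + c')) ^ 2 with hΦ
  obtain ⟨y, hy, hmax⟩ := exists_isMaxOn_cylinder (d := d) (isCompact_Icc (a := 0) (b := T))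
    (nonempty_Icc.2 hT.le) (Φ := Φ)
    ((hs.contDiffOn_ham hH hT).continuousOn.add (continuousOn_const.mul
      ((hs.contDiffOn_u.continuousOn.add (by fun_prop)).pow 2)))
    (fun t ht x i => by
      have h1 := hs.periodic_ham hH ht x i
      have h2 := hs.u_periodic t ht x i
      simp only [hΦ] at h1 h2 ⊢
      rw [h1, h2])
  have hyc : y ∈ cyl d T := ⟨mem_univ _, hy.2⟩
  have hsq : ∀ y ∈ cyl d T, 0 ≤ bernsteinWeight R / 2 * (u y.1 y.2 + (c * y.2 + c')) ^ 2 ∧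
      bernsteinWeight R / 2 * (u y.1 y.2 + (c * y.2 + c')) ^ 2 ≤ 1 := fun y hy => by
    refine ⟨by positivity, ?_⟩
    have h1 : (u y.1 y.2 + (c * y.2 + c')) ^ 2 ≤ (3 * R) ^ 2 := by
      rw [← sq_abs]
      exact pow_le_pow_left₀ (abs_nonneg _) (hψ y hy) 2
    have h2 := mul_le_mul_of_nonneg_left h1 hκ.le
    linarith
  -- The quadratic term lies in `[0,1]`, so maximising the sum nearly maximises `H(x,D_xu)` itself.
  have hham : ∀ x ∈ cyl d T, ham H u x ≤ ham H u y + 1 := fun x hx => by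
    have h1 : Φ x ≤ Φ y := hmax hx
    have h2 := (hsq x hx).1
    have h3 := (hsq y hyc).2
    simp only [hΦ] at h1
    linarith
  have hcost := fun x (hx : x ∈ cyl d T) => (hs.cost_eq_of_mem hH hf hT hx).2
  have h0c : ∀ x : Sp d, (x, (0 : ℝ)) ∈ cyl d T := fun x => ⟨mem_univ _, le_rfl, hT.le⟩
  have hTc : ∀ x : Sp d, (x, T) ∈ cyl d T := fun x => ⟨mem_univ _, hT.le, le_rfl⟩
  have hf0 : ∀ x, |cost f m (x, 0)| ≤ C₀ := fun x => by
    rw [cost, hs.initial]; exact hL.abs_val_le hC hm x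
  have hge : ∀ x, -R ≤ ham H u x := fun x => by
    have h1 := hL.H_ge x.1 (grd u x)
    have h2 : 0 ≤ 1 / C₀ * ‖grd u x‖ ^ 2 := by positivity
    rw [ham]
    linarith
  -- At the end times `u_t = H - f`, with `H ≤ H(y) + 1` and `f ≥ -(K - 1)`; the maximum principle
  -- carries the bound inside.
  have hup : ∀ x ∈ cyl d T, tder T u x ≤ ham H u y + K := fun x hx => by
    have := hs.tder_le_of_boundary hH hf hT (σ := 1) (B := ham H u y + K) (Or.inl rfl)
      (fun x => ⟨by
        have h1 := hcost _ (h0c x)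
        have h2 := hham _ (h0c x)
        have h3 := (abs_le.1 (hf0 x)).1
        linarith, by
        have h1 := hcost _ (hTc x)
        have h2 := hham _ (hTc x)
        have h3 : -(K - 1) ≤ cost f m (x, T) := hfT x
        linarith⟩) hx
    linarith
  have hlow : ∀ x ∈ cyl d T, -(2 * R) ≤ tder T u x := fun x hx => by
    have := hs.tder_le_of_boundary hH hf hT (σ := -1) (B := 2 * R) (Or.inr rfl)
      (fun x => ⟨by
        have h1 := hcost _ (h0c x)
        have h2 := hge (x, 0)
        have h3 := (abs_le.1 (hf0 x)).2
        linarith, by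
        have h1 := hcost _ (hTc x)
        have h2 := hge (x, T)
        have h3 : cost f m (x, T) ≤ R := (abs_le.1 (hbT x).1).2
        linarith⟩) hx
    linarith
  -- Evaluated at `y`, `u_t ≤ H + K` means exactly `f ≥ -K`. The quantities `1/χ` and `h_w` are
  -- therefore needed only on `w ≥ -K`, where `K` was fixed before any gradient bound.
  have hw : -K ≤ cost f m y := by
    have h1 := hcost y hyc
    have h2 := hup y hyc
    linarith
  set B := bernsteinBound R with hB
  have hP : 1 + ‖grd u y‖ ≤ B := by
    have hψy := abs_le.1 (hu y hyc)
    rcases eq_or_lt_of_le hy.2.1 with h | hy0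
    · refine hs.norm_grd_le_of_initial hH hf hL hC hτ hT hR hCR hm hyc h.symm hc ?_ hmax
      rw [← h] at hψy ⊢
      linarith
    rcases eq_or_lt_of_le hy.2.2 with h | hyT
    · obtain ⟨b1, b2, b3⟩ := hbT y.1
      rw [← h] at b1 b2 b3
      refine hs.norm_grd_le_of_terminal hH hf hL hC hτ hT hR hCR hg hyc h (abs_le.1 b1).1 b2 b3 hc
        ?_ hmax
      rw [h, hcT]
      rw [h] at hψy
      linarith
    · exact hs.norm_grd_le_of_interior hH hf hL hC hτ hR hCR hd hτ1 hτR ⟨hy0, hyT⟩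
        (hχ _ _ hw).1 (hχ _ _ hw).2 (by linarith) (hlow y hyc) hc (hψ y hyc)
        (isLocalMax_of_isMaxOn_cyl hmax ⟨hy0, hyT⟩)
  have hB1 : 1 ≤ B := by linarith [norm_nonneg (grd u y)]
  have hV : ham H u y ≤ R * B ^ 2 + R := by
    obtain ⟨-, -, -, -, -, -, -, -, h1, -⟩ := hL.bounds hH hC hτ hR hCR y.1 (grd u y) rfl
    have h2 : R * (1 + ‖grd u y‖) ^ 2 ≤ R * B ^ 2 := by gcongr
    rw [ham]
    linarith
  have hgrd : ‖grd u z‖ ≤ 4 * R * B := by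
    obtain ⟨-, -, -, -, -, -, -, -, -, h1⟩ := hL.bounds hH hC hτ hR hCR z.1 (grd u z) rfl
    have h2 := hham z hz
    rw [ham] at h2
    have h3 : (1 + ‖grd u z‖) ^ 2 / (2 * R) ≤ R * B ^ 2 + 4 * R := by linarith
    rw [div_le_iff₀ (by positivity)] at h3
    have h4 : R ^ 2 * 1 ≤ R ^ 2 * B ^ 2 := mul_le_mul_of_nonneg_left (one_le_pow₀ hB1) (by positivity)
    have h6 : 0 ≤ R ^ 2 * B ^ 2 := by positivity
    have h5 : 1 + ‖grd u z‖ ≤ 4 * R * B := by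
      refine le_of_sq_le_sq ?_ (by positivity)
      linarith
    linarith
  have htder : |tder T u z| ≤ R * B ^ 2 + 4 * R := by
    have h1 := hup z hz
    have h2 := hlow z hz
    have h3 : 0 ≤ R * B ^ 2 := by positivity
    exact abs_le.2 ⟨by linarith, by linarith⟩
  rw [gradientBound]
  linarith

end IsClassicalSolution

end MFG

end

/-! ### Monotonicity of the constants, and the conclusion. -/

noncomputable section

namespace MFG

open Set Filter Topology MeasureTheory
open scoped ENNReal

theorem estimateConst_mono {R S : ℝ} (hR : 1 ≤ R) (h : R ≤ S) :
    1 ≤ estimateConst R ∧ estimateConst R ≤ estimateConst S := by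
  have h1 : 1 ≤ R ^ 4 := one_le_pow₀ hR
  have h2 : R ^ 4 ≤ S ^ 4 := pow_le_pow_left₀ (by linarith) h 4
  unfold estimateConst
  constructor <;> linarith

theorem bernsteinBound_nonneg {R : ℝ} (hR : 1 ≤ R) : 0 ≤ bernsteinBound R := by
  have h0 : 0 ≤ R := by linarith
  have h1 : 0 ≤ estimateConst R := by unfold estimateConst; positivity
  unfold bernsteinBound
  positivity

theorem bernsteinBound_mono {R S : ℝ} (hR : 1 ≤ R) (h : R ≤ S) :
    bernsteinBound R ≤ bernsteinBound S := by
  obtain ⟨h1, h2⟩ := estimateConst_mono hR h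
  have h0 : 0 ≤ R := by linarith
  have h0' : 0 ≤ S := by linarith
  have h1' : 0 ≤ estimateConst R := by linarith
  have h3 : 1536 * R ^ 2 * estimateConst R ^ 23 ≤ 1536 * S ^ 2 * estimateConst S ^ 23 := by gcongr
  -- The power is monotone in its exponent because the base is at least one.
  have h4 : 1 ≤ 1536 * S ^ 2 * estimateConst S ^ 23 := by
    have e1 : 1 ≤ S ^ 2 := one_le_pow₀ (hR.trans h)
    have e2 : 1 ≤ estimateConst S ^ 23 := one_le_pow₀ (h1.trans h2)
    have e3 : 1 * 1 ≤ 1536 * S ^ 2 * estimateConst S ^ 23 :=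
      mul_le_mul (by linarith) e2 zero_le_one (by positivity)
    linarith
  have h5 : (1536 * R ^ 2 * estimateConst R ^ 23) ^ R ≤ (1536 * S ^ 2 * estimateConst S ^ 23) ^ S :=
    (Real.rpow_le_rpow (by positivity) h3 h0).trans (Real.rpow_le_rpow_of_exponent_le h4 h)
  have h6 : 8 * R ^ 4 * estimateConst R ^ 12 ≤ 8 * S ^ 4 * estimateConst S ^ 12 := by gcongr
  have h7 : 32 * R ^ 3 ≤ 32 * S ^ 3 := by gcongr
  unfold bernsteinBound
  linarith

theorem gradientBound_pos {R : ℝ} (hR : 1 ≤ R) : 0 < gradientBound R := by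
  have h0 : 0 < R := by linarith
  have h1 := bernsteinBound_nonneg hR
  unfold gradientBound
  positivity

theorem gradientBound_mono {R S : ℝ} (hR : 1 ≤ R) (h : R ≤ S) :
    gradientBound R ≤ gradientBound S := by
  have h0 : 0 ≤ R := by linarith
  have h1 := bernsteinBound_nonneg hR
  have h2 := bernsteinBound_mono hR h
  have h0' : 0 ≤ S := by linarith
  unfold gradientBound
  gcongr

/-- The choice of `L₁`. The bounds for the values need only the first two summands; `1/(1 - τ)` is
added because the later constants see `τ` only through `L₁`. -/
theorem isMonotoneConstant_valueConst (d : ℕ) : IsMonotoneConstant baseParams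
    fun v => barrierSlope d (v 0) (v 2) + v 0 + 1 / (1 - v 1) := by
  constructor
  · rintro v ⟨h0, h1, h2, h3⟩
    have : 0 < 1 - v 1 := by linarith
    unfold barrierSlope
    positivity
  · rintro v ⟨h0, h1, h2, h3⟩ w ⟨k0, k1, k2, k3⟩ hvw
    have e0 := hvw 0
    have e1 := hvw 1
    have e2 := hvw 2
    have e3 : 0 < 1 - w 1 := by linarith
    have e4 : 0 ≤ barrierRate d (v 0) := by unfold barrierRate; positivity
    have e5 : barrierRate d (v 0) ≤ barrierRate d (w 0) := by unfold barrierRate; gcongr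
    have e6 := e4.trans e5
    simp only
    unfold barrierSlope
    gcongr

/-- The choice of both `L` and `K₁`. A sum dominates each of its parameters, and the `2` provides
positivity and the room for inequalities such as `C₀ + 1 ≤ K₁`. -/
theorem isMonotoneConstant_two_add_sum {n : ℕ} :
    IsMonotoneConstant (Ici (0 : Fin n → ℝ)) fun v => 2 + ∑ i, v i :=
  ⟨fun v hv => by
      have : 0 ≤ ∑ i, v i := Finset.sum_nonneg fun i _ => hv i
      linarith,
    fun _ _ _ _ h => add_le_add le_rfl (Finset.sum_le_sum fun i _ => h i)⟩

/-- The choice of `K`: the argument `R = d + 1 + K₁ + β` dominates at once `d`, `1`, `C₀`, `1/(1 -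
τ)`, `L`, `1/T` and the norms in `β`. -/
theorem isMonotoneConstant_gradientBound (d : ℕ) :
    IsMonotoneConstant (Ici (0 : Fin 2 → ℝ)) fun v => gradientBound (d + 1 + v 0 + v 1) := by
  have h1 : ∀ v ∈ Ici (0 : Fin 2 → ℝ), 1 ≤ d + 1 + v 0 + v 1 := fun v hv => by
    have h0 : 0 ≤ v 0 := hv 0
    have h1 : 0 ≤ v 1 := hv 1
    have h2 : (0 : ℝ) ≤ d := d.cast_nonneg
    linarith
  refine ⟨fun v hv => gradientBound_pos (h1 v hv), fun v hv w _ h => ?_⟩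
  exact gradientBound_mono (h1 v hv) (by linarith [h 0, h 1])

theorem norm_fullGrad_le {d : ℕ} (T : ℝ) (u : Sp d → ℝ → ℝ) (z : Sp d × ℝ) :
    ‖fullGrad T u z‖ ≤ ‖grd u z‖ + |tder T u z| := by
  rw [fullGrad, WithLp.prod_norm_eq_of_L2]
  refine Real.sqrt_le_iff.2 ⟨by positivity, ?_⟩
  have h1 := mul_nonneg (norm_nonneg (grd u z)) (abs_nonneg (tder T u z))
  change ‖grd u z‖ ^ 2 + |tder T u z| ^ 2 ≤ _
  nlinarith

/-- Pointwise consequences of the finiteness of `β_K`. -/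
theorem bounds_of_beta {d : ℕ} {f g : Sp d → ℝ → EReal} (hf : IsCoupling f) {K : ℝ} (hK : 0 < K)
    (hβ : beta f g K ≠ ⊤) :
    (∀ x, ∀ r ∈ Icc (1 / K) K, |val f x r| ≤ (beta f g K).toReal ∧
      ‖Dx f x r‖ ≤ (beta f g K).toReal ∧ ‖Dx g x r‖ ≤ (beta f g K).toReal) ∧
    ∀ x w, -K ≤ w → |1 / chi f x w| ≤ (beta f g K).toReal ∧
      |deriv (hfun f x) w| ≤ (beta f g K).toReal := by
  set b := (beta f g K).toReal with hb
  have hb0 : 0 ≤ b := ENNReal.toReal_nonneg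
  have hle : beta f g K ≤ ENNReal.ofReal b := (ENNReal.ofReal_toReal hβ).ge
  rw [beta] at hle
  clear_value b
  have h3 := le_self_add.trans hle
  have h2 := le_self_add.trans h3
  have hf1 := le_self_add.trans h2
  have hg1 := le_add_self.trans h2
  have hχ := le_add_self.trans h3
  have hh := le_add_self.trans hle
  refine ⟨fun x r hr => ?_, fun x w hw => ⟨?_, ?_⟩⟩
  · have hr0 : 0 < r := (by positivity : 0 < 1 / K).trans_le hr.1
    have hmem : (x, r) ∈ (univ : Set (Sp d)) ×ˢ Icc (1 / K) K := ⟨mem_univ _, hr⟩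
    have e1 := norm_le_of_c0Norm_le hb0 ((c0Norm_le_ckNorm 1 _ _).trans hf1) hmem
    have e2 := norm_le_of_c0Norm_le hb0 ((c0Norm_fderiv_le_ckNorm le_rfl _ _).trans hf1) hmem
    have e3 := norm_le_of_c0Norm_le hb0 ((c0Norm_le_ckNorm 1 _ _).trans hg1) hmem
    exact ⟨e1, hf.norm_Dx_le hr0 e2, e3⟩
  · have hmem : (x, w) ∈ (univ : Set (Sp d)) ×ˢ Ici (-K) := ⟨mem_univ _, hw⟩
    exact norm_le_of_c0Norm_le hb0 hχ hmem
  · have hmem : (x, w) ∈ (univ : Set (Sp d)) ×ˢ Ici (-K) := ⟨mem_univ _, hw⟩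
    exact norm_le_of_c0Norm_le hb0 hh hmem

end MFG

end

theorem mainTheorem3 (d : ℕ) :
    ∃ (cL₁ : (Fin 3 → ℝ) → ℝ) (cL : (Fin 5 → ℝ) → ℝ) (cK₁ : (Fin 3 → ℝ) → ℝ)
      (cK : (Fin 2 → ℝ) → ℝ),
      MFG.IsMonotoneConstant MFG.baseParams cL₁ ∧
      MFG.IsMonotoneConstant (Set.Ici 0) cL ∧
      MFG.IsMonotoneConstant (Set.Ici 0) cK₁ ∧
      MFG.IsMonotoneConstant (Set.Ici 0) cK ∧
      ∀ (C₀ τ T : ℝ) (H : MFG.Sp d → MFG.Sp d → ℝ) (f g : MFG.Sp d → ℝ → EReal)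
        (m₀ : MFG.Sp d → ℝ) (u m : MFG.Sp d → ℝ → ℝ),
        0 < C₀ → 0 ≤ τ → τ < 1 → 0 < T →
        MFG.InitialDensity m₀ →
        MFG.HamiltonianAssumptions C₀ τ H →
        MFG.RunningCostAssumptions C₀ τ f →
        MFG.TerminalCostAssumptions g →
        MFG.LargeConstant C₀ τ H f m₀ →
        MFG.IsClassicalSolution T H f g m₀ u m →
        let L₁ := cL₁ ![C₀, τ, T]
        let L := cL (MFG.boundParams f g L₁)
        let K₁ := cK₁ ![L, max (-MFG.lowerEnv f (1 / L)) 0, 1 / T]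
        MFG.c0Norm (Set.univ ×ˢ Set.Icc 0 T) (fun z : MFG.Sp d × ℝ => u z.1 z.2) +
            MFG.c0Norm Set.univ (fun x => m x T) +
            MFG.c0Norm Set.univ (fun x => 1 / m x T) ≤ ENNReal.ofReal L ∧
        (∀ x, 0 < m x T) ∧
        MFG.beta f g K₁ ≠ ⊤ ∧
        MFG.c0Norm (Set.univ ×ˢ Set.Icc 0 T) (MFG.fullGrad T u) ≤
          ENNReal.ofReal (cK ![K₁, (MFG.beta f g K₁).toReal]) := by
  refine ⟨_, _, _, _, MFG.isMonotoneConstant_valueConst d, MFG.isMonotoneConstant_two_add_sum,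
    MFG.isMonotoneConstant_two_add_sum, MFG.isMonotoneConstant_gradientBound d, ?_⟩
  intro C₀ τ T H f g m₀ u m hC hτ hτ1 hT hm hH hf hg hLC hs L₁ L K₁
  have hτ2 : 0 < 1 / (1 - τ) := one_div_pos.2 (by linarith)
  have hslope : 0 ≤ MFG.barrierSlope d C₀ T := by unfold MFG.barrierSlope; positivity
  have hL₁ : L₁ = MFG.barrierSlope d C₀ T + C₀ + 1 / (1 - τ) := rfl
  have hL₁0 : 0 ≤ L₁ := by rw [hL₁]; positivity
  obtain ⟨hv3, hv4, hu, hm1, hm2⟩ := hs.value_bounds hH hf hLC hC hτ hτ1 hT hm hg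
    (L₁ := L₁) (by linarith)
  have hv1 : 0 ≤ MFG.boundParams f g L₁ 1 := abs_nonneg _
  have hv2 : 0 ≤ MFG.boundParams f g L₁ 2 := abs_nonneg _
  have hL : L = 2 + (L₁ + MFG.boundParams f g L₁ 1 + MFG.boundParams f g L₁ 2 +
      MFG.boundParams f g L₁ 3 + MFG.boundParams f g L₁ 4) := by
    change 2 + ∑ i, MFG.boundParams f g L₁ i = _
    rw [Fin.sum_univ_five]; rfl
  have hK₁ : K₁ = 2 + (L + max (-MFG.lowerEnv f (1 / L)) 0 + 1 / T) := by
    change 2 + ∑ i, ![L, max (-MFG.lowerEnv f (1 / L)) 0, 1 / T] i = _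
    rw [Fin.sum_univ_three]; rfl
  have hmax := le_max_left (-MFG.lowerEnv f (1 / L)) 0
  have hmax0 := le_max_right (-MFG.lowerEnv f (1 / L)) 0
  have hT0 : 0 < 1 / T := one_div_pos.2 hT
  have hL0 : 0 < L := by linarith
  have hK0 : 0 < K₁ := by linarith
  have hβ := MFG.beta_ne_top (f := f) (g := g) hf hg hK0
  have hpos : ∀ x, 0 < m x T := fun x => (hm2 x).1
  obtain ⟨hb1, hb2⟩ := MFG.bounds_of_beta (f := f) (g := g) hf.isCoupling hK0 hβ
  have hb0 : 0 ≤ (MFG.beta f g K₁).toReal := ENNReal.toReal_nonneg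
  have hd0 : (0 : ℝ) ≤ d := d.cast_nonneg
  refine ⟨?_, hpos, hβ, MFG.c0Norm_le fun z hz => (MFG.norm_fullGrad_le T u z).trans ?_⟩
  · have h1 := MFG.c0Norm_le (S := Set.univ ×ˢ Set.Icc 0 T)
      (φ := fun z : MFG.Sp d × ℝ => u z.1 z.2) hu
    have h2 := MFG.c0Norm_le (S := Set.univ) (φ := fun x => m x T)
      (r := MFG.boundParams f g L₁ 3) fun x _ => by
        rw [Real.norm_eq_abs, abs_of_pos (hpos x)]; exact hm1 x
    have h3 := MFG.c0Norm_le (S := Set.univ) (φ := fun x => 1 / m x T)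
      (r := MFG.boundParams f g L₁ 4) fun x _ => by
        rw [Real.norm_eq_abs, abs_of_pos (one_div_pos.2 (hpos x))]; exact (hm2 x).2
    refine (add_le_add (add_le_add h1 h2) h3).trans ?_
    rw [← ENNReal.ofReal_add (by linarith) hv3, ← ENNReal.ofReal_add (by linarith) hv4.le]
    exact ENNReal.ofReal_le_ofReal (by linarith)
  -- `K₁ ≥ L` places the terminal density in the range over which `β_{K₁}` measures `f` and `D_x g`.
  · have hmK : ∀ x, m x T ∈ Set.Icc (1 / K₁) K₁ := fun x => by
      refine ⟨?_, by linarith [hm1 x]⟩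
      have h1 : 1 / m x T ≤ K₁ := by linarith [(hm2 x).2]
      exact (one_div_le hK0 (hpos x)).2 h1
    change _ ≤ MFG.gradientBound (d + 1 + K₁ + (MFG.beta f g K₁).toReal)
    refine hs.gradient_bound hH hf hLC hC hτ hT (L := L) (K := K₁) ?_ ?_ hτ1 ?_ ?_ hm
      hg.isCoupling (fun z hz => (hu z hz).trans (by linarith)) ?_ ?_ ?_ ?_ (fun x => ?_)
      (fun x => ?_) (fun x w hw => ?_) hz
    any_goals linarith
    -- Here `f₀(1/L)^-` enters: `m(·,T) ≥ 1/L` gives `f(x,m) ≥ f₀(1/L) ≥ -(K₁ - 1)`.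
    · have h1 : 1 / L ≤ m x T :=
        (one_div_le hL0 (hpos x)).2 (by linarith [(hm2 x).2])
      have h2 := hf.isCoupling.lowerEnv_le (one_div_pos.2 hL0) x
      have h3 := hf.isCoupling.val_le_val (x := x) (one_div_pos.2 hL0) h1
      linarith
    · obtain ⟨h1, h2, h3⟩ := hb1 x _ (hmK x)
      exact ⟨by linarith, by linarith, by linarith⟩
    · obtain ⟨h1, h2⟩ := hb2 x w hw
      exact ⟨by linarith, by linarith⟩
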